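/- Let $k\ge 1$ and let $G_N=\frac1{\sqrt N}G$, where $G$ is an $N\times N$ matrix of i.i.d. standard complex normal random variables (mean $0$, $\mathbb E|G_{ij}|^2=1$, independent real and imaginary parts of variance $\tfrac12$). Fix $z\in\mathbb C$ with $|z|=1$ and vectors $\vec u,\vec v\in\mathbb C^k$ (repeated entries allowed), and set $$x_j=z-\frac{u_j}{\overline z\sqrt N},\qquad \overline{y_j}=\overline z-\frac{\overline{v_j}}{z\sqrt N},\qquad j=1,\dots,k .$$ For $t\in(0,1)$, $a,b\in\mathbb C$, $\vec a,\vec b\in\mathbb C^k$ and $E\subseteq\mathbb R$ measurable let $$p_t(a,b)=\frac{1}{\sqrt{2\pi t}}e^{-(a-b)^2/(2t)},\qquad \mathcal Z_t(\vec a,\vec b,E)=\int_{E^k}\det\{p_t(a_i,s_j)\}_{i,j=1}^k\,\det\{p_{1-t}(s_i,b_j)\}_{i,j=1}^k\,d\vec s .$$ For vectors $\vec u,\vec v$ that each have pairwise distinct entries put $$F_k^{(\mathrm{edge})}(\vec u,\vec v)=\frac{\mathcal Z_{1/2}(\vec u,\overline{\vec v},\mathbb R_+)}{\prod_{1\le i<j\le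 k}(u_j-u_i)(\overline{v_j}-\overline{v_i})},\qquad \mathbb R_+=(0,\infty),$$ and if $\vec u$ or $\vec v$ has repeated entries let $F_k^{(\mathrm{edge})}(\vec u,\vec v)$ be the limit of this ratio as pairs of vectors, each with pairwise distinct entries, tend to $(\vec u,\vec v)$. Then the integral defining $\mathcal Z_{1/2}(\vec u,\overline{\vec v},\mathbb R_+)$ converges absolutely, this limit exists (and at pairs without repeated entries it equals the ratio itself), the expectation below is absolutely convergent for every $N$, and as $N\to\infty$ $$\mathbb E\Big(\prod_{j=1}^k\det(G_N-x_j)\det(G_N^\dagger-\overline{y_j})\Big)=\exp\Big(-\sum_{j=1}^k\Big(\sqrt N(u_j+\overline{v_j})-\frac{u_j^2+\overline{v_j}^2}{2}\Big)+\frac{k^2}{2}\log N\Big)\,\frac{(2\pi)^k}{k!}\,\Big(F_k^{(\mathrm{edge})}(\vec u,\vec v)+o(1)\Big).$$ In particular, whenever $F_k^{(\mathrm{edge})}(\vec u,\vec v)\neq0$, the last factor may be written as $F_k^{(\mathrm{edge})}(\vec u,\vec v)\,(1+o(1))$. -/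

import Mathlib

open MeasureTheory Filter Topology
open scoped ComplexConjugate

noncomputable section

/-- The standard complex normal law: the law of `X + i Y` with `X`, `Y` independent real centred
Gaussians of variance `1/2`, so that `E |X + i Y|^2 = 1`. -/
def stdComplexGaussian : Measure ℂ :=
  ((ProbabilityTheory.gaussianReal 0 (1 / 2)).prod
    (ProbabilityTheory.gaussianReal 0 (1 / 2))).map (fun p : ℝ × ℝ => (⟨p.1, p.2⟩ : ℂ))

/-- The law of the array of entries of an `N × N` matrix with i.i.d. standard complex normal
entries. -/
def gaussianEntries (N : ℕ) : Measure (Fin N → Fin N → ℂ) :=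
  Measure.pi fun _ => Measure.pi fun _ => stdComplexGaussian

/-- The normalised Ginibre matrix `G_N = G / √N` built from the array `g` of entries. -/
def ginibreMatrix (N : ℕ) (g : Fin N → Fin N → ℂ) : Matrix (Fin N) (Fin N) ℂ :=
  ((Real.sqrt N : ℂ)⁻¹) • Matrix.of g

/-- `∏_j det (G_N - x_j) det (G_N^† - conj y_j)` as a function of the entries. -/
def charPolyProduct (N : ℕ) {k : ℕ} (x y : Fin k → ℂ) (g : Fin N → Fin N → ℂ) : ℂ :=
  ∏ j, (ginibreMatrix N g - Matrix.scalar (Fin N) (x j)).det *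
    ((ginibreMatrix N g).conjTranspose - Matrix.scalar (Fin N) (conj (y j))).det

/-- `E (∏_j det (G_N - x_j) det (G_N^† - conj y_j))`. -/
def charPolyCorrelation (N : ℕ) {k : ℕ} (x y : Fin k → ℂ) : ℂ :=
  ∫ g, charPolyProduct N x y g ∂(gaussianEntries N)

/-- The edge scaling `z - w / (conj z √N)`; for `x_j` take `w = u_j`, for `y_j` take `w = v_j`
(so that `conj y_j = conj z - conj v_j / (z √N)`). -/
def edgePoint (z : ℂ) (N : ℕ) (w : ℂ) : ℂ := z - w / (conj z * (Real.sqrt N : ℂ))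

/-- The Brownian transition density `p_t(u, v)`, continued to complex `u`, `v`. -/
def brownianDensity (t : ℝ) (u v : ℂ) : ℂ :=
  1 / (Real.sqrt (2 * Real.pi * t) : ℂ) * Complex.exp (-(u - v) ^ 2 / (2 * (t : ℂ)))

/-- The integrand of the Karlin–McGregor formula. -/
def karlinMcGregorIntegrand {k : ℕ} (t : ℝ) (u v : Fin k → ℂ) (s : Fin k → ℝ) : ℂ :=
  (Matrix.of fun i j => brownianDensity t (u i) (s j : ℂ)).det *
    (Matrix.of fun i j => brownianDensity (1 - t) (s i : ℂ) (v j)).det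

/-- The Karlin–McGregor quantity `𝒵_t(u, v, E)`, an integral over `E^k`. -/
def karlinMcGregor {k : ℕ} (t : ℝ) (u v : Fin k → ℂ) (E : Set ℝ) : ℂ :=
  ∫ s in {s : Fin k → ℝ | ∀ i, s i ∈ E}, karlinMcGregorIntegrand t u v s

/-- `𝒵_{1/2}(u, conj v, ℝ₊)` divided by `∏_{i<j} (u_j - u_i)(conj v_j - conj v_i)`; meaningful
when `u` and `v` each have pairwise distinct entries. -/
def edgeRatio {k : ℕ} (u v : Fin k → ℂ) : ℂ :=
  karlinMcGregor (1 / 2) u (fun j => conj (v j)) (Set.Ioi 0) /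
    ∏ i, ∏ j ∈ Finset.Ioi i, (u j - u i) * (conj (v j) - conj (v i))

/-- Pairs of vectors without degeneracies. -/
def nondegeneratePairs (k : ℕ) : Set ((Fin k → ℂ) × (Fin k → ℂ)) :=
  {p | Function.Injective p.1 ∧ Function.Injective p.2}

open scoped Classical in
/-- `F_k^{(edge)}(u, v)`: the ratio when there are no degeneracies, and otherwise the limit of the
ratio along nondegenerate pairs tending to `(u, v)`. -/
def edgeF {k : ℕ} (u v : Fin k → ℂ) : ℂ :=
  if (u, v) ∈ nondegeneratePairs k then edgeRatio u v
  else limUnder (𝓝[nondegeneratePairs k] (u, v)) (fun p => edgeRatio p.1 p.2)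

/-- The factor
`exp (-∑_j (√N (u_j + conj v_j) - (u_j^2 + (conj v_j)^2) / 2) + (k^2 / 2) log N)`. -/
def edgePrefactor (N : ℕ) {k : ℕ} (u v : Fin k → ℂ) : ℂ :=
  Complex.exp (-(∑ j, ((Real.sqrt N : ℂ) * (u j + conj (v j)) -
      ((u j) ^ 2 + (conj (v j)) ^ 2) / 2)) + (k : ℂ) ^ 2 / 2 * (Real.log N : ℂ))

end

/-! The core is an exact identity at finite `N` (`integral_prod_det_scalar_sub`): for an unscaled
Gaussian matrix `g`, the expectation of `∏ det (x_j - g) det (y_j - g†)`, multiplied by the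
Vandermonde determinants of `x` and `y`, equals `∏_{b<k} (N+b)!` times `det (e_n(x_i y_j))`, where
`n = N+k-1` and `e_n` is the truncated exponential series. It is proved algebraically: expectation
is a linear functional on polynomials in Gaussian variables and their conjugates, and it satisfies
`E (conj g_i · p) = E (∂p/∂g_i)`.

Under the pairing `E (f(g) h(conj g))`, differentiation in `g_ab` is adjoint to multiplication by
`conj g_ab`. Formally `f(g + c ξξ*)` is `exp(c ∑ ξ_a conj ξ_b ∂_ab) f`, so averaging over a Gaussian
vector `ξ` is adjoint to division by `det (1 - c conj g)`; `gaussianPairing_det_mul` is the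
inverse-free form. On the other side, Vandermonde times `∏ χ_g(x_i)` is `det (ℓ_i(X^j χ_g))` with
`ℓ_i` the evaluation at `x_i`, and the same averaging acts on each `ℓ_i` as precomposition with `1 -
c d/dX` (`gaussianExpectation_charpolyDet`). Hence every factor `det (1 - conj g / y_m)` can be
stripped off by inverting `1 - y_m⁻¹ d/dX`. What remains is holomorphic in `g`, so its mean is its
value at `g = 0`, where `χ = X^N`. The inverse operators are truncated geometric series, and partial
fractions turn them into the entries `e_n(x_i y_j)`.

At the edge, `n! e_n(x) = ∫ (x+t)^n e^{-t} dt` over the half-line. After removing factors that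
depend on `u_i` or on `w_j = conj v_j` alone, the kernel converges by dominated convergence to `2π ∫
p_{1/2}(u,s) p_{1/2}(s,w) ds` over the positive half-line (`tendsto_edgeKernel`,
`edgeLimitKernel_eq`). Andréief's identity recognises the determinant of these integrals as the
Karlin–McGregor quantity, which settles vectors with distinct entries.

Repeated entries are reached by compactness. The normalised correlation is an entire function of
`(u, w)`. On a torus whose radii are spaced by one the Vandermonde determinants have modulus at
least one, so there it is bounded uniformly in large `N`, and the maximum modulus principle carries
the bound to the whole polydisc. Bounded holomorphic functions are locally equi-Lipschitz, so
convergence on the dense set of nondegenerate pairs extends to all pairs and also forces the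
limiting ratio to have a limit. -/

/-! ### Moments of the standard complex Gaussian. -/

theorem integral_stdComplexGaussian (f : ℂ → ℂ) (hf : Measurable f) :
    ∫ z, f z ∂stdComplexGaussian = ∫ z : ℂ, f z * ((1 / Real.pi * Real.exp (-‖z‖ ^ 2) : ℝ) : ℂ) := by
  have hm : Measurable (fun p : ℝ × ℝ => (⟨p.1, p.2⟩ : ℂ)) :=
    Complex.measurableEquivRealProd.symm.measurable
  have hg : ProbabilityTheory.gaussianReal 0 (1 / 2) =
      volume.withDensity (ProbabilityTheory.gaussianPDF 0 (1 / 2)) :=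
    ProbabilityTheory.gaussianReal_of_var_ne_zero 0 (by norm_num)
  rw [stdComplexGaussian, integral_map hm.aemeasurable hf.aestronglyMeasurable, hg,
    prod_withDensity (ProbabilityTheory.measurable_gaussianPDF _ _)
      (ProbabilityTheory.measurable_gaussianPDF _ _),
    integral_withDensity_eq_integral_toReal_smul
      (f := fun z : ℝ × ℝ => ProbabilityTheory.gaussianPDF 0 (1 / 2) z.1 *
        ProbabilityTheory.gaussianPDF 0 (1 / 2) z.2)
      (((ProbabilityTheory.measurable_gaussianPDF _ _).comp measurable_fst).mul
        ((ProbabilityTheory.measurable_gaussianPDF _ _).comp measurable_snd))]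
  · rw [← (Complex.volume_preserving_equiv_real_prod.symm).integral_comp
      Complex.measurableEquivRealProd.symm.measurableEmbedding]
    refine integral_congr_ae (Eventually.of_forall fun p => ?_)
    have e : Complex.measurableEquivRealProd.symm p = (⟨p.1, p.2⟩ : ℂ) := rfl
    simp only [e]
    rw [ENNReal.toReal_mul, ProbabilityTheory.toReal_gaussianPDF,
      ProbabilityTheory.toReal_gaussianPDF, ProbabilityTheory.gaussianPDFReal,
      ProbabilityTheory.gaussianPDFReal, Complex.sq_norm, Complex.normSq_mk, Complex.real_smul,
      mul_comm]
    congr 2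
    have h2 : (((1 / 2 : NNReal) : ℝ)) = 1 / 2 := by norm_num
    have h3 : (2 : ℝ) * Real.pi * (1 / 2) = Real.pi := by ring
    rw [h2, h3, mul_mul_mul_comm, ← mul_inv, Real.mul_self_sqrt Real.pi_pos.le, ← Real.exp_add]
    congr 1
    · rw [one_div]
    · congr 1; ring
  · refine Eventually.of_forall fun p => ?_
    exact ENNReal.mul_lt_top ProbabilityTheory.gaussianPDF_lt_top ProbabilityTheory.gaussianPDF_lt_top

instance : IsProbabilityMeasure stdComplexGaussian :=
  Measure.isProbabilityMeasure_map
    (Complex.measurableEquivRealProd.symm.measurable : Measurable fun p : ℝ × ℝ => (⟨p.1, p.2⟩ : ℂ)).aemeasurable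

theorem integrable_norm_pow_stdComplexGaussian (m : ℕ) :
    Integrable (fun z : ℂ => ‖z‖ ^ m) stdComplexGaussian := by
  have hm : Measurable (fun p : ℝ × ℝ => (⟨p.1, p.2⟩ : ℂ)) :=
    Complex.measurableEquivRealProd.symm.measurable
  rw [stdComplexGaussian, integrable_map_measure (by fun_prop) hm.aemeasurable]
  have h1 : MemLp (fun p : ℝ × ℝ => (p.1 : ℂ)) m ((ProbabilityTheory.gaussianReal 0 (1 / 2)).prod
      (ProbabilityTheory.gaussianReal 0 (1 / 2))) :=
    ((ProbabilityTheory.memLp_id_gaussianReal m).comp_measurePreserving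
      measurePreserving_fst).ofReal
  have h2 : MemLp (fun p : ℝ × ℝ => (p.2 : ℂ)) m ((ProbabilityTheory.gaussianReal 0 (1 / 2)).prod
      (ProbabilityTheory.gaussianReal 0 (1 / 2))) :=
    ((ProbabilityTheory.memLp_id_gaussianReal m).comp_measurePreserving
      measurePreserving_snd).ofReal
  have h3 := h1.add (h2.mul_const Complex.I)
  refine (h3.integrable_norm_pow' ).congr (Eventually.of_forall fun p => ?_)
  simp only [Function.comp_apply, Pi.add_apply, Complex.mk_eq_add_mul_I]

/-- The diagonal moments are radial integrals equal to `Γ(a+1)`. The others vanish by rotation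
invariance, since a rotation by `c` multiplies the integral by `c^a · conj c^b`. -/
theorem stdComplexGaussian_moment (a b : ℕ) :
    ∫ z : ℂ, z ^ a * conj z ^ b ∂stdComplexGaussian = if a = b then (a.factorial : ℂ) else 0 := by
  rw [integral_stdComplexGaussian _ (by fun_prop)]
  split_ifs with h
  · subst h
    have := Complex.integral_rpow_mul_exp_neg_rpow (p := 2) (q := 2 * a) (by norm_num)
      (by have : (0 : ℝ) ≤ a := Nat.cast_nonneg a
          linarith)
    have h3 : ∀ z : ℂ, z ^ a * conj z ^ a * ((1 / Real.pi * Real.exp (-‖z‖ ^ 2) : ℝ) : ℂ) =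
        ((1 / Real.pi * (‖z‖ ^ (2 * a : ℝ) * Real.exp (-‖z‖ ^ (2 : ℝ))) : ℝ) : ℂ) := by
      intro z
      rw [← mul_pow, Complex.mul_conj, Complex.normSq_eq_norm_sq]
      have : ‖z‖ ^ (2 * a : ℝ) = (‖z‖ ^ 2) ^ a := by
        rw [← pow_mul, ← Real.rpow_natCast]; norm_num
      rw [this, Real.rpow_two]; push_cast; ring
    simp_rw [h3]
    rw [integral_complex_ofReal, integral_const_mul, this]
    rw [show ((2 * (a:ℝ) + 2) / 2) = (a : ℝ) + 1 by ring, Real.Gamma_nat_eq_factorial]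
    have := Real.pi_ne_zero
    norm_cast
    field_simp
  · set I := ∫ z : ℂ, z ^ a * conj z ^ b * ((1 / Real.pi * Real.exp (-‖z‖ ^ 2) : ℝ) : ℂ) with hI
    have key : ∀ c : Circle, I = (c : ℂ) ^ a * conj (c : ℂ) ^ b * I := by
      intro c
      have := (rotation c).measurePreserving.integral_comp (rotation c).toHomeomorph.measurableEmbedding
        (fun z : ℂ => z ^ a * conj z ^ b * ((1 / Real.pi * Real.exp (-‖z‖ ^ 2) : ℝ) : ℂ))
      rw [hI, ← integral_const_mul]
      conv_lhs => rw [← this]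
      refine integral_congr_ae (Eventually.of_forall fun z => ?_)
      simp only [rotation_apply, map_mul, norm_mul, Circle.norm_coe, one_mul]
      ring
    have hab : ((a : ℝ) - b) ≠ 0 := sub_ne_zero.2 (by exact_mod_cast h)
    have hab' : ((a : ℂ) - b) ≠ 0 := sub_ne_zero.2 (by exact_mod_cast h)
    -- This angle makes the rotation factor `exp(iπ) = -1`, so the integral equals its own negative.
    have hc := key (Circle.exp (Real.pi / (a - b)))
    have h1 : ((Circle.exp (Real.pi / (a - b)) : Circle) : ℂ) ^ a *
        conj ((Circle.exp (Real.pi / (a - b)) : Circle) : ℂ) ^ b = -1 := by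
      rw [Circle.coe_exp, ← Complex.exp_conj, ← Complex.exp_nat_mul, ← Complex.exp_nat_mul,
        ← Complex.exp_add, ← Complex.exp_pi_mul_I]
      congr 1
      simp only [map_mul, Complex.conj_ofReal, Complex.conj_I]
      push_cast
      field_simp
      ring
    rw [h1] at hc
    linear_combination hc / 2

/-- The functional sending a polynomial in independent standard complex Gaussians (indexed by
`Sum.inl`) and their conjugates (indexed by `Sum.inr`) to its expectation. -/
noncomputable def gaussianExpectation (ι : Type*) [Fintype ι] : MvPolynomial (ι ⊕ ι) ℂ →ₗ[ℂ] ℂ :=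
  (MvPolynomial.basisMonomials (ι ⊕ ι) ℂ).constr ℂ
    fun m => ∏ i, if m (Sum.inl i) = m (Sum.inr i) then ((m (Sum.inl i)).factorial : ℂ) else 0

/-! ### Expectation of polynomials and integration by parts. -/

section gaussianExpectation

variable {ι : Type*} [Fintype ι]

theorem gaussianExpectation_monomial (m : ι ⊕ ι →₀ ℕ) (c : ℂ) :
    gaussianExpectation ι (MvPolynomial.monomial m c) =
      c * ∏ i, if m (Sum.inl i) = m (Sum.inr i) then ((m (Sum.inl i)).factorial : ℂ) else 0 := by
  have : MvPolynomial.monomial m c = c • MvPolynomial.basisMonomials (ι ⊕ ι) ℂ m := by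
    simp [MvPolynomial.smul_monomial]
  rw [this, map_smul, gaussianExpectation, Module.Basis.constr_basis, smul_eq_mul]

theorem gaussianExpectation_C (c : ℂ) : gaussianExpectation ι (MvPolynomial.C c) = c := by
  rw [← MvPolynomial.monomial_zero', gaussianExpectation_monomial]
  simp

/-- Gaussian integration by parts. -/
theorem gaussianExpectation_X_inr_mul (i : ι) (p : MvPolynomial (ι ⊕ ι) ℂ) :
    gaussianExpectation ι (MvPolynomial.X (Sum.inr i) * p) =
      gaussianExpectation ι (MvPolynomial.pderiv (Sum.inl i) p) := by
  classical
  induction p using MvPolynomial.induction_on' with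
  | add p q hp hq => rw [mul_add, map_add, map_add, map_add, hp, hq]
  | monomial m c =>
    rw [MvPolynomial.pderiv_monomial, ← pow_one (MvPolynomial.X _),
      ← MvPolynomial.monomial_single_add, gaussianExpectation_monomial,
      gaussianExpectation_monomial, ← Finset.mul_prod_erase _ _ (Finset.mem_univ i),
      ← Finset.mul_prod_erase _ _ (Finset.mem_univ i), mul_assoc c, ← mul_assoc (m _ : ℂ)]
    congr 2
    · simp only [Finsupp.add_apply, Finsupp.tsub_apply, Finsupp.single_eq_same]
      rw [Finsupp.single_eq_of_ne (by simp)]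
      -- Differentiation lowers the holomorphic exponent from `a+1` to `a`; the two sides match
      -- because `(a+1)! = (a+1) · a!`.
      rcases h : m (Sum.inl i) with _ | a
      · rw [if_neg (by omega)]
        simp
      · by_cases h2 : m (Sum.inr i) = a
        · simp [h2, add_comm, Nat.factorial_succ]
        · have : ¬ (a + 1 = 1 + m (Sum.inr i)) := by omega
          simp [this, Ne.symm h2]
    · refine Finset.prod_congr rfl fun j hj => ?_
      have hj' : j ≠ i := Finset.ne_of_mem_erase hj
      simp [hj'.symm]

theorem integrable_pow_mul_conj_pow (a b : ℕ) :
    Integrable (fun z : ℂ => z ^ a * conj z ^ b) stdComplexGaussian := by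
  refine (integrable_norm_pow_stdComplexGaussian (a + b)).mono'
    (by fun_prop) (Eventually.of_forall fun z => ?_)
  simp [pow_add]

theorem eval_monomial_sum_elim_conj (m : ι ⊕ ι →₀ ℕ) (c : ℂ) (z : ι → ℂ) :
    MvPolynomial.eval (Sum.elim z (fun i => conj (z i))) (MvPolynomial.monomial m c) =
      c * ∏ i, z i ^ m (Sum.inl i) * conj (z i) ^ m (Sum.inr i) := by
  rw [MvPolynomial.eval_monomial, Finsupp.prod_fintype _ _ (by simp), Fintype.prod_sum_type,
    Finset.prod_mul_distrib]
  rfl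

theorem integrable_eval_pi_stdComplexGaussian (p : MvPolynomial (ι ⊕ ι) ℂ) :
    Integrable (fun z : ι → ℂ => MvPolynomial.eval (Sum.elim z (fun i => conj (z i))) p)
      (Measure.pi fun _ => stdComplexGaussian) := by
  induction p using MvPolynomial.induction_on' with
  | add p q hp hq =>
    simp only [map_add]
    exact hp.add hq
  | monomial m c =>
    simp_rw [eval_monomial_sum_elim_conj]
    exact (Integrable.fintype_prod (fun i => integrable_pow_mul_conj_pow _ _)).const_mul c

theorem gaussianExpectation_eq_integral (p : MvPolynomial (ι ⊕ ι) ℂ) :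
    gaussianExpectation ι p = ∫ z : ι → ℂ, MvPolynomial.eval (Sum.elim z (fun i => conj (z i))) p
      ∂(Measure.pi fun _ => stdComplexGaussian) := by
  induction p using MvPolynomial.induction_on' with
  | add p q hp hq =>
    simp only [map_add]
    rw [integral_add (integrable_eval_pi_stdComplexGaussian p)
      (integrable_eval_pi_stdComplexGaussian q), hp, hq]
  | monomial m c =>
    simp_rw [eval_monomial_sum_elim_conj, gaussianExpectation_monomial]
    rw [integral_const_mul, integral_fintype_prod_eq_prod
      (f := fun i (z : ℂ) => z ^ m (Sum.inl i) * conj z ^ m (Sum.inr i))]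
    simp_rw [stdComplexGaussian_moment]

theorem integrable_eval_gaussianEntries (N : ℕ)
    (p : MvPolynomial ((Fin N × Fin N) ⊕ (Fin N × Fin N)) ℂ) :
    Integrable (fun g : Fin N → Fin N → ℂ => MvPolynomial.eval
      (Sum.elim (fun a => g a.1 a.2) (fun a => conj (g a.1 a.2))) p) (gaussianEntries N) := by
  induction p using MvPolynomial.induction_on' with
  | add p q hp hq =>
    simp only [map_add]
    exact hp.add hq
  | monomial m c =>
    have (g : Fin N → Fin N → ℂ) := eval_monomial_sum_elim_conj m c (fun a => g a.1 a.2)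
    simp_rw [this, Fintype.prod_prod_type]
    refine Integrable.const_mul ?_ c
    exact Integrable.fintype_prod (f := fun i (r : Fin N → ℂ) =>
      ∏ j, r j ^ m (Sum.inl (i, j)) * conj (r j) ^ m (Sum.inr (i, j)))
      fun i => Integrable.fintype_prod
        (f := fun j (z : ℂ) => z ^ m (Sum.inl (i, j)) * conj z ^ m (Sum.inr (i, j)))
        fun j => integrable_pow_mul_conj_pow _ _

/-- `gaussianEntries` is a product of products rather than a product over pairs, so each monomial is
integrated first over rows and then over the entries of a row. -/
theorem gaussianExpectation_eq_integral_gaussianEntries (N : ℕ)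
    (p : MvPolynomial ((Fin N × Fin N) ⊕ (Fin N × Fin N)) ℂ) :
    gaussianExpectation (Fin N × Fin N) p = ∫ g, MvPolynomial.eval
      (Sum.elim (fun a => g a.1 a.2) (fun a => conj (g a.1 a.2))) p ∂(gaussianEntries N) := by
  induction p using MvPolynomial.induction_on' with
  | add p q hp hq =>
    simp only [map_add]
    rw [integral_add (integrable_eval_gaussianEntries N p)
      (integrable_eval_gaussianEntries N q), hp, hq]
  | monomial m c =>
    have (g : Fin N → Fin N → ℂ) := eval_monomial_sum_elim_conj m c (fun a => g a.1 a.2)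
    simp_rw [this, gaussianExpectation_monomial, Fintype.prod_prod_type]
    rw [integral_const_mul, gaussianEntries, integral_fintype_prod_eq_prod
      (f := fun i (r : Fin N → ℂ) =>
        ∏ j, r j ^ m (Sum.inl (i, j)) * conj (r j) ^ m (Sum.inr (i, j)))]
    congr 1
    refine Finset.prod_congr rfl fun i _ => ?_
    rw [integral_fintype_prod_eq_prod
      (f := fun j (z : ℂ) => z ^ m (Sum.inl (i, j)) * conj z ^ m (Sum.inr (i, j)))]
    simp_rw [stdComplexGaussian_moment]

end gaussianExpectation

/-! ### Derivations of products and determinants. -/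

theorem Derivation.map_finset_prod {R A σ : Type*} [CommSemiring R] [CommRing A] [Algebra R A]
    [DecidableEq σ] (D : Derivation R A A) (s : Finset σ) (f : σ → A) :
    D (∏ i ∈ s, f i) = ∑ i ∈ s, (∏ j ∈ s.erase i, f j) * D (f i) := by
  induction s using Finset.induction_on with
  | empty => simp
  | insert a s ha ih =>
    rw [Finset.prod_insert ha, D.leibniz, ih, Finset.sum_insert ha, Finset.erase_insert ha,
      smul_eq_mul, smul_eq_mul, add_comm, Finset.mul_sum]
    congr 1
    refine Finset.sum_congr rfl fun i hi => ?_
    have hia : a ≠ i := fun h => ha (h ▸ hi)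
    rw [Finset.erase_insert_of_ne hia, Finset.prod_insert (by simp [ha]), mul_assoc]

/-- Jacobi's formula: the Leibniz rule differentiates one column at a time, and Cramer's rule
expresses the determinant with a replaced column through the adjugate. -/
theorem Derivation.map_matrix_det {R A n : Type*} [CommRing R] [CommRing A] [Algebra R A]
    [Fintype n] [DecidableEq n] (D : Derivation R A A) (M : Matrix n n A) :
    D M.det = ∑ i, ∑ j, M.adjugate j i * D (M i j) := by
  have h1 : D M.det = ∑ j, (M.updateCol j fun i => D (M i j)).det := by
    simp_rw [Matrix.det_apply', map_sum]
    rw [Finset.sum_comm]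
    refine Finset.sum_congr rfl fun σ _ => ?_
    rw [D.leibniz, D.map_intCast, smul_zero, add_zero, D.map_finset_prod, smul_eq_mul,
      Finset.mul_sum]
    refine Finset.sum_congr rfl fun j _ => ?_
    rw [← Finset.mul_prod_erase _ _ (Finset.mem_univ j), mul_comm (∏ _ ∈ _, _)]
    simp only [Matrix.updateCol_self]
    congr 2
    refine Finset.prod_congr rfl fun i hi => ?_
    rw [Matrix.updateCol_ne (Finset.ne_of_mem_erase hi)]
  rw [h1, Finset.sum_comm]
  refine Finset.sum_congr rfl fun j _ => ?_
  rw [← Matrix.cramer_apply, Matrix.cramer_eq_adjugate_mulVec]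
  rfl

/-! ### Gaussian averages of products of quadratic forms. -/

section RankOne

open MvPolynomial

variable {n : Type*} [Fintype n]

/-- The form `∑ A a b * conj (ξ a) * ξ b` as a polynomial in `ξ` and `conj ξ`. -/
noncomputable def hermitianQuadForm (A : Matrix n n ℂ) : MvPolynomial (n ⊕ n) ℂ :=
  ∑ a, ∑ b, C (A a b) * (X (Sum.inr a) * X (Sum.inl b))

theorem hermitianQuadForm_sub (A B : Matrix n n ℂ) :
    hermitianQuadForm (A - B) = hermitianQuadForm A - hermitianQuadForm B := by
  simp only [hermitianQuadForm, Matrix.sub_apply, C_sub, sub_mul, Finset.sum_sub_distrib]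

theorem hermitianQuadForm_smul (c : ℂ) (A : Matrix n n ℂ) :
    hermitianQuadForm (c • A) = C c * hermitianQuadForm A := by
  simp only [hermitianQuadForm, Matrix.smul_apply, smul_eq_mul, C_mul, mul_assoc, Finset.mul_sum]

/-- The derivation `∑ A a b ξ b ∂/∂(ξ a)`. -/
noncomputable def linearVectorField (A : Matrix n n ℂ) :
    Derivation ℂ (MvPolynomial (n ⊕ n) ℂ) (MvPolynomial (n ⊕ n) ℂ) :=
  ∑ a, ∑ b, (C (A a b) * X (Sum.inl b) : MvPolynomial (n ⊕ n) ℂ) • pderiv (Sum.inl a)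

theorem linearVectorField_apply (A : Matrix n n ℂ) (F : MvPolynomial (n ⊕ n) ℂ) :
    linearVectorField A F =
      ∑ a, ∑ b, C (A a b) * X (Sum.inl b) * pderiv (Sum.inl a) F := by
  have h (D : n → n → Derivation ℂ (MvPolynomial (n ⊕ n) ℂ) (MvPolynomial (n ⊕ n) ℂ)) :
      (∑ a, ∑ b, D a b) F = ∑ a, ∑ b, D a b F := by
    have := congrFun (map_sum (Derivation.coeFnAddMonoidHom (R := ℂ)
      (A := MvPolynomial (n ⊕ n) ℂ) (M := MvPolynomial (n ⊕ n) ℂ)) (fun a => ∑ b, D a b)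
      Finset.univ) F
    rw [Derivation.coeFnAddMonoidHom_apply] at this
    rw [this, Finset.sum_apply]
    refine Finset.sum_congr rfl fun a _ => ?_
    have := congrFun (map_sum (Derivation.coeFnAddMonoidHom (R := ℂ)
      (A := MvPolynomial (n ⊕ n) ℂ) (M := MvPolynomial (n ⊕ n) ℂ)) (fun b => D a b)
      Finset.univ) F
    rw [this, Finset.sum_apply]
    rfl
  rw [linearVectorField, h]
  simp only [Derivation.smul_apply, smul_eq_mul]

theorem gaussianExpectation_C_mul (c : ℂ) (p : MvPolynomial (n ⊕ n) ℂ) :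
    gaussianExpectation n (C c * p) = c * gaussianExpectation n p := by
  rw [C_mul', map_smul, smul_eq_mul]

variable [DecidableEq n]

/-- The vector field substitutes `Aξ` for the holomorphic `ξ` and does not touch `conj ξ`. -/
theorem linearVectorField_hermitianQuadForm (A B : Matrix n n ℂ) :
    linearVectorField A (hermitianQuadForm B) = hermitianQuadForm (B * A) := by
  have h (a : n) : pderiv (Sum.inl a) (hermitianQuadForm B) =
      ∑ c, C (B c a) * X (Sum.inr c) := by
    simp only [hermitianQuadForm, map_sum, Derivation.leibniz, pderiv_X, pderiv_C, smul_eq_mul]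
    refine Finset.sum_congr rfl fun c _ => ?_
    simp [Pi.single_apply]
  rw [linearVectorField_apply]
  simp only [h]
  simp only [hermitianQuadForm, Matrix.mul_apply, map_sum, C_mul, Finset.sum_mul, Finset.mul_sum]
  rw [Finset.sum_comm]
  refine Eq.trans ?_ Finset.sum_comm
  refine Finset.sum_congr rfl fun b _ => Finset.sum_comm.trans ?_
  refine Finset.sum_congr rfl fun c _ => Finset.sum_congr rfl fun a _ => ?_
  ring

/-- Integrate by parts in each `conj ξ_a`: the derivative hitting the explicit `ξ_b` produces the
trace, and the derivative hitting `F` produces the vector field. -/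
theorem gaussianExpectation_hermitianQuadForm_mul (A : Matrix n n ℂ)
    (F : MvPolynomial (n ⊕ n) ℂ) :
    gaussianExpectation n (hermitianQuadForm A * F) =
      A.trace * gaussianExpectation n F + gaussianExpectation n (linearVectorField A F) := by
  have h (a b : n) : gaussianExpectation n (C (A a b) * (X (Sum.inr a) * X (Sum.inl b)) * F) =
      (if a = b then A a b * gaussianExpectation n F else 0) +
      gaussianExpectation n (C (A a b) * X (Sum.inl b) * pderiv (Sum.inl a) F) := by
    rw [mul_assoc, mul_assoc, mul_assoc, gaussianExpectation_C_mul, gaussianExpectation_C_mul,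
      gaussianExpectation_X_inr_mul, Derivation.leibniz, pderiv_X, map_add, mul_add, add_comm]
    congr 1
    by_cases hab : a = b
    · subst hab; simp
    · simp [hab]
  rw [linearVectorField_apply, hermitianQuadForm]
  simp only [Finset.sum_mul, map_sum, h, Finset.sum_add_distrib, Matrix.trace, Matrix.diag]
  congr 1
  simp

theorem gaussianExpectation_hermitianQuadForm_mul_prod {m : ℕ} (s : ℂ) (A : Matrix n n ℂ)
    (R : Fin m → Matrix n n ℂ) :
    gaussianExpectation n
        (hermitianQuadForm A * ∏ j, (1 - C s * hermitianQuadForm (R j))) =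
      A.trace * gaussianExpectation n (∏ j, (1 - C s * hermitianQuadForm (R j))) -
      s * ∑ i, gaussianExpectation n ((∏ j ∈ Finset.univ.erase i,
        (1 - C s * hermitianQuadForm (R j))) * hermitianQuadForm (R i * A)) := by
  rw [gaussianExpectation_hermitianQuadForm_mul, Derivation.map_finset_prod, map_sum,
    sub_eq_add_neg, Finset.mul_sum, ← Finset.sum_neg_distrib]
  congr 1
  refine Finset.sum_congr rfl fun i _ => ?_
  rw [map_sub, Derivation.map_one_eq_zero, C_mul', Derivation.map_smul,
    linearVectorField_hermitianQuadForm, zero_sub, mul_neg, map_neg, mul_smul_comm, map_smul,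
    smul_eq_mul]

/-- The expectation of `∏ (1 - s ξ* R_j ξ)`. -/
noncomputable def quadFormCorrelation (s : ℂ) (R : ℂ → Matrix n n ℂ) {m : ℕ} (x : Fin m → ℂ) : ℂ :=
  gaussianExpectation n (∏ j, (1 - C s * hermitianQuadForm (R (x j))))

/-- Integration by parts creates forms with matrix `R(x_i) R(y)`. The resolvent identity `hR` turns
each into a difference quotient, that is, into the same correlation with `x_i` replaced by `y`. The
recursion in the number of points therefore closes. -/
theorem quadFormCorrelation_snoc (s : ℂ) (R : ℂ → Matrix n n ℂ) {m : ℕ} (x : Fin m → ℂ) (y : ℂ)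
    (hR : ∀ i, (y - x i) • (R (x i) * R y) = R (x i) - R y) (hxy : ∀ i, y ≠ x i) :
    quadFormCorrelation s R (Fin.snoc x y : Fin (m + 1) → ℂ) =
      (1 - s * (R y).trace) * quadFormCorrelation s R x +
      s * ∑ i, (quadFormCorrelation s R (Function.update x i y) - quadFormCorrelation s R x) /
        (y - x i) := by
  have h1 (i : Fin m) : quadFormCorrelation s R (Function.update x i y) -
      quadFormCorrelation s R x = s * (y - x i) *
      gaussianExpectation n ((∏ j ∈ Finset.univ.erase i,
        (1 - C s * hermitianQuadForm (R (x j)))) * hermitianQuadForm (R (x i) * R y)) := by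
    rw [quadFormCorrelation, quadFormCorrelation, ← map_sub,
      ← Finset.mul_prod_erase _ _ (Finset.mem_univ i),
      ← Finset.mul_prod_erase _ _ (Finset.mem_univ i), Function.update_self,
      Finset.prod_congr rfl fun j hj =>
        by rw [Function.update_of_ne (Finset.ne_of_mem_erase hj)], ← sub_mul]
    have : (1 - C s * hermitianQuadForm (R y)) - (1 - C s * hermitianQuadForm (R (x i))) =
        C (s * (y - x i)) * hermitianQuadForm (R (x i) * R y) := by
      rw [C_mul, mul_assoc, ← hermitianQuadForm_smul (y - x i), hR, hermitianQuadForm_sub]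
      ring
    rw [this, mul_assoc, gaussianExpectation_C_mul, mul_comm (hermitianQuadForm _)]
  have h2 (i : Fin m) : (quadFormCorrelation s R (Function.update x i y) -
      quadFormCorrelation s R x) / (y - x i) = s *
      gaussianExpectation n ((∏ j ∈ Finset.univ.erase i,
        (1 - C s * hermitianQuadForm (R (x j)))) * hermitianQuadForm (R (x i) * R y)) := by
    rw [h1, div_eq_iff (sub_ne_zero.2 (hxy i))]
    ring
  simp_rw [h2]
  have h3 := gaussianExpectation_hermitianQuadForm_mul_prod s (R y) (fun i => R (x i))
  rw [quadFormCorrelation, Fin.prod_univ_castSucc]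
  simp only [Fin.snoc_castSucc, Fin.snoc_last]
  rw [mul_sub, mul_one, map_sub, mul_comm (∏ _, _), mul_assoc, gaussianExpectation_C_mul, h3,
    ← Finset.mul_sum, quadFormCorrelation]
  ring

end RankOne

/-! ### The same recursion for a determinant of first order functionals. -/

section DetRecursion

/-- Laplace expansion along the last column, with each minor reordered by the transposition of row
`i` and the last row. The alternating signs all become `-1`, and the minor is the corner block with
row `i` replaced by the last row, the shape `update x i y` needed in the recursion. -/
theorem Matrix.det_eq_lastCol_expansion {R : Type*} [CommRing R] {m : ℕ}
    (A : Matrix (Fin (m + 1)) (Fin (m + 1)) R) :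
    A.det = A (Fin.last m) (Fin.last m) * (A.submatrix Fin.castSucc Fin.castSucc).det -
      ∑ i : Fin m, A i.castSucc (Fin.last m) *
        (A.submatrix (Function.update Fin.castSucc i (Fin.last m)) Fin.castSucc).det := by
  have hlast (B : Matrix (Fin (m + 1)) (Fin (m + 1)) R) :
      (B.updateCol (Fin.last m) (Pi.single (Fin.last m) 1)).det =
        (B.submatrix Fin.castSucc Fin.castSucc).det := by
    rw [Matrix.det_succ_column _ (Fin.last m), Fin.sum_univ_castSucc]
    simp only [Matrix.updateCol_self]
    have (i : Fin m) : (Pi.single (Fin.last m) 1 : Fin (m + 1) → R) i.castSucc = 0 :=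
      Pi.single_eq_of_ne (Fin.castSucc_lt_last i).ne _
    simp only [this, mul_zero, zero_mul, Finset.sum_const_zero, zero_add, Pi.single_eq_same,
      mul_one, Fin.succAbove_last]
    rw [Even.neg_one_pow ⟨_, rfl⟩, one_mul]
    congr 1
    ext i j
    simp [(Fin.castSucc_lt_last j).ne]
  have hi (i : Fin m) : (A.updateCol (Fin.last m) (Pi.single i.castSucc 1)).det =
      -(A.submatrix (Function.update Fin.castSucc i (Fin.last m)) Fin.castSucc).det := by
    have hne : i.castSucc ≠ Fin.last m := (Fin.castSucc_lt_last i).ne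
    have h := Matrix.det_permute (Equiv.swap i.castSucc (Fin.last m))
      (A.updateCol (Fin.last m) (Pi.single i.castSucc 1))
    rw [Equiv.Perm.sign_swap hne] at h
    have h2 : (A.updateCol (Fin.last m) (Pi.single i.castSucc 1)).submatrix
        (Equiv.swap i.castSucc (Fin.last m)) id =
        (A.submatrix (Equiv.swap i.castSucc (Fin.last m)) id).updateCol (Fin.last m)
          (Pi.single (Fin.last m) 1) := by
      ext a b
      by_cases hb : b = Fin.last m
      · subst hb
        simp only [Matrix.submatrix_apply, id, Matrix.updateCol_self, Pi.single_apply]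
        congr 1
        rw [Equiv.swap_apply_eq_iff, Equiv.swap_apply_left]
      · simp [hb]
    rw [h2, hlast, Matrix.submatrix_submatrix] at h
    have h3 : (⇑(Equiv.swap i.castSucc (Fin.last m)) ∘ Fin.castSucc) =
        Function.update Fin.castSucc i (Fin.last m) := by
      ext1 j
      by_cases hj : j = i
      · subst hj; simp
      · rw [Function.update_of_ne hj, Function.comp_apply, Equiv.swap_apply_of_ne_of_ne]
        · simpa using hj
        · exact (Fin.castSucc_lt_last j).ne
    rw [h3] at h
    simp only [Function.id_comp, Units.val_neg, Units.val_one, Int.cast_neg, Int.cast_one,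
      neg_mul, one_mul] at h
    rw [h, neg_neg]
  have hA : A = A.updateCol (Fin.last m) (∑ i, A i (Fin.last m) • Pi.single i 1) := by
    rw [← pi_eq_sum_univ']
    exact (Matrix.updateCol_eq_self A _).symm
  conv_lhs => rw [hA]
  rw [← Matrix.cramer_apply, map_sum, Finset.sum_apply]
  simp only [Matrix.cramer_apply, Matrix.det_updateCol_smul]
  rw [Fin.sum_univ_castSucc, hlast, add_comm, sub_eq_add_neg, ← Finset.sum_neg_distrib]
  simp only [hi, mul_neg]

open Polynomial

/-- The change of basis from monomials to monic polynomials of the same degrees is unitriangular. -/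
theorem det_functional_monic {R : Type*} [CommRing R] [Nontrivial R] {m : ℕ} (l : Fin m → R[X] →ₗ[R] R)
    (p : Fin m → R[X]) (hdeg : ∀ i, (p i).natDegree = i) (hp : ∀ i, (p i).Monic) :
    (Matrix.of fun i j => l i (p j)).det =
      (Matrix.of fun i (j : Fin m) => l i (X ^ (j : ℕ))).det := by
  have h : (Matrix.of fun i j => l i (p j)) =
      (Matrix.of fun i (j : Fin m) => l i (X ^ (j : ℕ))) *
        (Matrix.of fun (i j : Fin m) => (p j).coeff i) := by
    ext i j
    rw [Matrix.mul_apply, Matrix.of_apply]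
    conv_lhs => rw [(p j).as_sum_range_C_mul_X_pow' (n := m) (by rw [hdeg]; exact j.2)]
    rw [map_sum, Finset.sum_range]
    refine Finset.sum_congr rfl fun a _ => ?_
    rw [← smul_eq_C_mul, map_smul, smul_eq_mul, Matrix.of_apply, Matrix.of_apply, mul_comm]
  rw [h, Matrix.det_mul, Matrix.det_matrixOfPolynomials p hdeg hp, mul_one]

/-- The functional `p ↦ c p(y) - s p'(y)`. -/
noncomputable def firstOrderFunctional (s c y : ℂ) : ℂ[X] →ₗ[ℂ] ℂ :=
  c • leval y - s • (leval y ∘ₗ derivative)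

theorem firstOrderFunctional_apply (s c y : ℂ) (p : ℂ[X]) :
    firstOrderFunctional s c y p = c * p.eval y - s * (derivative p).eval y := rfl

/-- The determinant `det (ℓ_j (X ^ a))` for first order functionals `ℓ_j` at the points `x j`. -/
noncomputable def firstOrderDet (s : ℂ) (c : ℂ → ℂ) {m : ℕ} (x : Fin m → ℂ) : ℂ :=
  (Matrix.of fun i (j : Fin m) => firstOrderFunctional s (c (x i)) (x i) (X ^ (j : ℕ))).det

/-- The top monomial may be replaced by the nodal polynomial of `x`. It vanishes at every `x_i`, so
only the derivative part of the functionals at the old points survives in the last column. -/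
theorem firstOrderDet_snoc (s : ℂ) (c : ℂ → ℂ) {m : ℕ} (x : Fin m → ℂ) (y : ℂ) :
    firstOrderDet s c (Fin.snoc x y : Fin (m + 1) → ℂ) =
      firstOrderFunctional s (c y) y (Lagrange.nodal Finset.univ x) * firstOrderDet s c x +
      s * ∑ i, (∏ j ∈ Finset.univ.erase i, (x i - x j)) *
        firstOrderDet s c (Function.update x i y) := by
  set p : Fin (m + 1) → ℂ[X] := Fin.snoc (fun i : Fin m => X ^ (i : ℕ))
    (Lagrange.nodal Finset.univ x) with hp
  have hdeg (i : Fin (m + 1)) : (p i).natDegree = i := by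
    refine Fin.lastCases ?_ (fun i => ?_) i
    · simp [hp, Lagrange.natDegree_nodal]
    · simp [hp]
  have hmonic (i : Fin (m + 1)) : (p i).Monic := by
    refine Fin.lastCases ?_ (fun i => ?_) i
    · simpa [hp] using Lagrange.nodal_monic
    · simp [hp, monic_X_pow]
  have h := det_functional_monic (fun i : Fin (m + 1) => firstOrderFunctional s
    (c ((Fin.snoc x y : Fin (m + 1) → ℂ) i)) ((Fin.snoc x y : Fin (m + 1) → ℂ) i)) p hdeg hmonic
  rw [firstOrderDet, ← h, Matrix.det_eq_lastCol_expansion, sub_eq_add_neg, Finset.mul_sum,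
    ← Finset.sum_neg_distrib]
  congr 1
  · simp only [Matrix.of_apply, Fin.snoc_last, hp, firstOrderDet]
    congr 2
    ext i j
    simp
  · refine Finset.sum_congr rfl fun i _ => ?_
    have h1 : (Matrix.of fun i j => firstOrderFunctional s
        (c ((Fin.snoc x y : Fin (m + 1) → ℂ) i)) ((Fin.snoc x y : Fin (m + 1) → ℂ) i) (p j))
        i.castSucc (Fin.last m) = - s * ∏ j ∈ Finset.univ.erase i, (x i - x j) := by
      simp only [Matrix.of_apply, Fin.snoc_castSucc, Fin.snoc_last, hp]
      rw [firstOrderFunctional_apply, Lagrange.eval_nodal_at_node (Finset.mem_univ i),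
        Lagrange.eval_nodal_derivative_eval_node_eq (Finset.mem_univ i), Lagrange.eval_nodal]
      ring
    rw [h1, neg_mul, neg_mul, neg_neg, mul_assoc]
    congr 2
    rw [firstOrderDet]
    congr 1
    ext a b
    by_cases ha : a = i
    · subst ha; simp [hp]
    · simp [hp, ha]

theorem firstOrderDet_zero_one {m : ℕ} (x : Fin m → ℂ) :
    firstOrderDet 0 1 x = (Matrix.vandermonde x).det := by
  rw [firstOrderDet]
  congr 1
  ext i j
  simp [firstOrderFunctional_apply, Matrix.vandermonde_apply]

theorem det_vandermonde_snoc {m : ℕ} (x : Fin m → ℂ) (y : ℂ) :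
    (Matrix.vandermonde (Fin.snoc x y : Fin (m + 1) → ℂ)).det =
      (∏ i, (y - x i)) * (Matrix.vandermonde x).det := by
  rw [← firstOrderDet_zero_one, firstOrderDet_snoc, firstOrderDet_zero_one]
  simp [firstOrderFunctional_apply, Lagrange.eval_nodal]

/-- Replacing `x_i` by `y` and then appending `x_i` is a transposition of appending `y` to `x`;
compare the two factorisations. -/
theorem det_vandermonde_update {m : ℕ} (x : Fin m → ℂ) (y : ℂ) (i : Fin m) (h : y ≠ x i) :
    (∏ j ∈ Finset.univ.erase i, (x i - x j)) *
        (Matrix.vandermonde (Function.update x i y)).det =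
      (∏ j, (y - x j)) * (Matrix.vandermonde x).det / (y - x i) := by
  have h1 := det_vandermonde_snoc (Function.update x i y) (x i)
  have hprod : ∏ j ∈ Finset.univ.erase i, (x i - Function.update x i y j) =
      ∏ j ∈ Finset.univ.erase i, (x i - x j) :=
    Finset.prod_congr rfl fun j hj => by rw [Function.update_of_ne (Finset.ne_of_mem_erase hj)]
  have h2 : Matrix.vandermonde (Fin.snoc (Function.update x i y) (x i) : Fin (m + 1) → ℂ) =
      (Matrix.vandermonde (Fin.snoc x y : Fin (m + 1) → ℂ)).submatrix
        (Equiv.swap i.castSucc (Fin.last m)) id := by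
    ext a b
    simp only [Matrix.vandermonde_apply, Matrix.submatrix_apply, id]
    congr 1
    refine Fin.lastCases ?_ (fun a => ?_) a
    · simp
    · by_cases ha : a = i
      · subst ha; simp
      · rw [Equiv.swap_apply_of_ne_of_ne (by simpa using ha) (Fin.castSucc_lt_last a).ne]
        simp [ha]
  rw [h2, Matrix.det_permute, Equiv.Perm.sign_swap (Fin.castSucc_lt_last i).ne,
    det_vandermonde_snoc, ← Finset.mul_prod_erase _ (fun j => x i - Function.update x i y j)
      (Finset.mem_univ i), Function.update_self, hprod] at h1
  rw [eq_div_iff (sub_ne_zero.2 h)]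
  simp only [Units.val_neg, Units.val_one, Int.cast_neg, Int.cast_one] at h1
  linear_combination h1

/-- Both sides satisfy one recursion when a point is appended. The logarithmic derivative `∑ 1/(y -
x_i)` of the nodal polynomial supplies the subtracted terms of the difference quotients. -/
theorem firstOrderDet_eq_vandermonde_mul_quadFormCorrelation {n : Type*} [Fintype n]
    [DecidableEq n] (s : ℂ) (R : ℂ → Matrix n n ℂ) (S : Set ℂ)
    (hR : ∀ x ∈ S, ∀ y ∈ S, (y - x) • (R x * R y) = R x - R y) {m : ℕ} (x : Fin m → ℂ)
    (hx : Function.Injective x) (hxS : ∀ i, x i ∈ S) :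
    firstOrderDet s (fun y => 1 - s * (R y).trace) x =
      (Matrix.vandermonde x).det * quadFormCorrelation s R x := by
  induction m with
  | zero =>
    have h := gaussianExpectation_C (ι := n) 1
    rw [MvPolynomial.C_1] at h
    simp [firstOrderDet, quadFormCorrelation, h]
  | succ m ih =>
    obtain ⟨x, y, rfl⟩ : ∃ (x' : Fin m → ℂ) (y : ℂ), x = Fin.snoc x' y :=
      ⟨Fin.init x, x (Fin.last m), (Fin.snoc_init_self x).symm⟩
    have hx' : Function.Injective x := fun a b hab => by
      have := @hx a.castSucc b.castSucc (by simpa using hab)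
      simpa using this
    have hxS' (i : Fin m) : x i ∈ S := by simpa using hxS i.castSucc
    have hyS : y ∈ S := by simpa using hxS (Fin.last m)
    have hxy (i : Fin m) : y ≠ x i := fun h => by
      have := @hx (Fin.last m) i.castSucc (by simpa using h)
      exact (Fin.castSucc_lt_last i).ne this.symm
    have hupd (i : Fin m) := ih (Function.update x i y)
      (by
        intro a b hab
        by_cases ha : a = i <;> by_cases hb : b = i
        · rw [ha, hb]
        · subst ha; simp [hb] at hab; exact absurd hab (hxy b)
        · subst hb; simp [ha] at hab; exact absurd hab.symm (hxy a)
        · simp [ha, hb] at hab; exact hx' hab)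
      (by
        intro a
        by_cases ha : a = i
        · subst ha; simpa using hyS
        · simpa [ha] using hxS' a)
    rw [firstOrderDet_snoc, ih x hx' hxS', quadFormCorrelation_snoc s R x y
      (fun i => hR _ (hxS' i) _ hyS) hxy, det_vandermonde_snoc]
    simp only [hupd]
    have h1 (i : Fin m) : (∏ j ∈ Finset.univ.erase i, (x i - x j)) *
        ((Matrix.vandermonde (Function.update x i y)).det *
          quadFormCorrelation s R (Function.update x i y)) =
        (∏ j, (y - x j)) * (Matrix.vandermonde x).det *
          (quadFormCorrelation s R (Function.update x i y) / (y - x i)) := by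
      rw [← mul_assoc, det_vandermonde_update x y i (hxy i)]
      ring
    simp only [h1, ← Finset.mul_sum]
    have h2 : (derivative (Lagrange.nodal Finset.univ x)).eval y =
        (∏ j, (y - x j)) * ∑ i, 1 / (y - x i) := by
      rw [Lagrange.derivative_nodal, eval_finsetSum, Finset.mul_sum]
      refine Finset.sum_congr rfl fun i _ => ?_
      rw [Lagrange.eval_nodal, ← Finset.mul_prod_erase _ _ (Finset.mem_univ i)]
      field_simp [sub_ne_zero.2 (hxy i)]
    rw [firstOrderFunctional_apply, h2, Lagrange.eval_nodal]
    simp only [sub_div, Finset.sum_sub_distrib, div_eq_mul_one_div (quadFormCorrelation s R x),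
      ← Finset.mul_sum]
    ring

end DetRecursion

/-! ### Rank one perturbations acting on characteristic polynomials. -/

section CharpolyDet

open Polynomial

/-- A linear functional on `ℂ[X]` applied to a polynomial with coefficients in a `ℂ`-algebra. -/
noncomputable def coeffFunctional (A : Type*) [CommRing A] [Algebra ℂ A] (l : ℂ[X] →ₗ[ℂ] ℂ) :
    A[X] →ₗ[A] A :=
  Polynomial.lsum fun m => algebraMap ℂ A (l (X ^ m)) • LinearMap.id

variable {A B : Type*} [CommRing A] [Algebra ℂ A] [CommRing B] [Algebra ℂ B]

theorem coeffFunctional_monomial (l : ℂ[X] →ₗ[ℂ] ℂ) (m : ℕ) (a : A) :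
    coeffFunctional A l (monomial m a) = algebraMap ℂ A (l (X ^ m)) * a := by
  simp [coeffFunctional, Algebra.smul_def]

theorem coeffFunctional_map (l : ℂ[X] →ₗ[ℂ] ℂ) (φ : A →ₐ[ℂ] B) (p : A[X]) :
    coeffFunctional B l (p.map (φ : A →+* B)) = φ (coeffFunctional A l p) := by
  induction p using Polynomial.induction_on' with
  | add p q hp hq => rw [Polynomial.map_add, map_add, map_add, map_add, hp, hq]
  | monomial m a => simp [coeffFunctional_monomial]

theorem coeffFunctional_self (l : ℂ[X] →ₗ[ℂ] ℂ) (p : ℂ[X]) : coeffFunctional ℂ l p = l p := by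
  induction p using Polynomial.induction_on' with
  | add p q hp hq => rw [map_add, map_add, hp, hq]
  | monomial m a =>
    rw [coeffFunctional_monomial, ← mul_one a, ← smul_eq_mul a 1, ← smul_monomial, map_smul,
      ← X_pow_eq_monomial]
    simp [mul_comm]

theorem coeffFunctional_leval (x : ℂ) (p : A[X]) :
    coeffFunctional A (leval x) p = p.eval (algebraMap ℂ A x) := by
  induction p using Polynomial.induction_on' with
  | add p q hp hq => rw [map_add, eval_add, hp, hq]
  | monomial m a => simp [coeffFunctional_monomial, mul_comm]

theorem coeffFunctional_congr (l l' : ℂ[X] →ₗ[ℂ] ℂ) (p : A[X]) (D : ℕ) (hp : p.natDegree < D)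
    (h : ∀ m < D, l (X ^ m) = l' (X ^ m)) : coeffFunctional A l p = coeffFunctional A l' p := by
  rw [p.as_sum_range' D hp, map_sum, map_sum]
  refine Finset.sum_congr rfl fun m hm => ?_
  rw [coeffFunctional_monomial, coeffFunctional_monomial, h m (Finset.mem_range.1 hm)]

/-- `coeffFunctional` as a linear function of the functional. -/
noncomputable def coeffFunctionalHom (p : A[X]) : (ℂ[X] →ₗ[ℂ] ℂ) →ₗ[ℂ] A where
  toFun l := coeffFunctional A l p
  map_add' l l' := by
    induction p using Polynomial.induction_on' with
    | add p q hp hq => rw [map_add, map_add, map_add, hp, hq]; ring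
    | monomial m a => simp only [coeffFunctional_monomial, LinearMap.add_apply, map_add]; ring
  map_smul' c l := by
    induction p using Polynomial.induction_on' with
    | add p q hp hq => rw [map_add, map_add, hp, hq, smul_add]
    | monomial m a =>
      simp only [coeffFunctional_monomial, LinearMap.smul_apply, map_mul, smul_eq_mul,
        RingHom.id_apply, Algebra.smul_def]
      ring

variable {n : Type*} [Fintype n] [DecidableEq n] {k : ℕ}

/-- `det (ℓ_j (X ^ a χ_M))`, where `χ_M` is the characteristic polynomial of `M`; for evaluations
`ℓ_j` at `x_j` this is the Vandermonde determinant of `x` times `∏ χ_M(x_j)`. -/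
noncomputable def charpolyDet (l : Fin k → ℂ[X] →ₗ[ℂ] ℂ) (M : Matrix n n A) : A :=
  (Matrix.of fun i (j : Fin k) => coeffFunctional A (l i) (X ^ (j : ℕ) * M.charpoly)).det

theorem charpolyDet_map (l : Fin k → ℂ[X] →ₗ[ℂ] ℂ) (φ : A →ₐ[ℂ] B) (M : Matrix n n A) :
    charpolyDet l (M.map φ) = φ (charpolyDet l M) := by
  rw [charpolyDet, charpolyDet, AlgHom.map_det]
  congr 1
  ext i j
  rw [Matrix.of_apply, AlgHom.mapMatrix_apply, Matrix.map_apply, Matrix.of_apply,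
    ← coeffFunctional_map, Polynomial.map_mul, Polynomial.map_pow, Polynomial.map_X,
    ← Matrix.charpoly_map]
  rfl

theorem charpolyDet_leval (x : Fin k → ℂ) (M : Matrix n n A) :
    charpolyDet (fun i => leval (x i)) M = algebraMap ℂ A (Matrix.vandermonde x).det *
      ∏ i, (Matrix.scalar n (algebraMap ℂ A (x i)) - M).det := by
  have h : (Matrix.of fun i (j : Fin k) => coeffFunctional A (leval (x i))
      (X ^ (j : ℕ) * M.charpoly)) = Matrix.of fun i j =>
      (Matrix.scalar n (algebraMap ℂ A (x i)) - M).det *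
        (Matrix.vandermonde x).map (algebraMap ℂ A) i j := by
    ext i j
    simp [coeffFunctional_leval, Matrix.eval_charpoly, Matrix.vandermonde_apply, mul_comm]
  rw [charpolyDet, h, Matrix.det_mul_column, RingHom.map_det, mul_comm]
  rfl

/-- Every polynomial `X^j χ_M` with `j < k` has degree below `card n + k`. Only finitely many values
of the functionals matter, so they may be replaced by interpolating combinations of evaluations. -/
theorem charpolyDet_congr (l l' : Fin k → ℂ[X] →ₗ[ℂ] ℂ) (M : Matrix n n A)
    (h : ∀ i, ∀ m < Fintype.card n + k, l i (X ^ m) = l' i (X ^ m)) :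
    charpolyDet l M = charpolyDet l' M := by
  rw [charpolyDet, charpolyDet]
  congr 1
  ext i j
  refine coeffFunctional_congr _ _ _ _ ?_ (h i)
  have hM : M.charpoly.natDegree ≤ Fintype.card n := by
    rcases subsingleton_or_nontrivial A with hA | hA
    · rw [Polynomial.natDegree_of_subsingleton]
      exact Nat.zero_le _
    · rw [M.charpoly_natDegree_eq_dim]
  have h1 := natDegree_mul_le (p := (X : A[X]) ^ (j : ℕ)) (q := M.charpoly)
  have h2 := natDegree_X_pow_le (R := A) (j : ℕ)
  have h3 := j.2
  omega

/-- `charpolyDet` as a multilinear function of the functionals. -/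
noncomputable def charpolyDetMultilinear (k : ℕ) (M : Matrix n n A) :
    MultilinearMap ℂ (fun _ : Fin k => ℂ[X] →ₗ[ℂ] ℂ) A :=
  ((Matrix.detRowAlternating (n := Fin k) (R := A)).toMultilinearMap.restrictScalars ℂ).compLinearMap
    fun _ => LinearMap.pi fun j : Fin k => coeffFunctionalHom (X ^ (j : ℕ) * M.charpoly)

theorem charpolyDet_eq_zero_of_eq (M : Matrix n n A) (l : Fin k → ℂ[X] →ₗ[ℂ] ℂ) {i j : Fin k}
    (hij : i ≠ j) (h : l i = l j) : charpolyDet l M = 0 :=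
  Matrix.det_zero_of_row_eq hij (by ext a; simp [h])

/-- Precomposition of a functional on polynomials with `1 - s d/dX`. -/
noncomputable def subDeriv (s : ℂ) : (ℂ[X] →ₗ[ℂ] ℂ) →ₗ[ℂ] (ℂ[X] →ₗ[ℂ] ℂ) :=
  LinearMap.lcomp ℂ ℂ (1 - s • (derivative : ℂ[X] →ₗ[ℂ] ℂ[X]))

theorem subDeriv_apply (s : ℂ) (l : ℂ[X] →ₗ[ℂ] ℂ) (p : ℂ[X]) :
    subDeriv s l p = l (p - s • derivative p) := rfl

theorem eval_derivative_charpoly (G : Matrix n n ℂ) (x : ℂ) (hx : G.charpoly.eval x ≠ 0) :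
    (derivative G.charpoly).eval x = G.charpoly.eval x * ((Matrix.scalar n x - G)⁻¹).trace := by
  have h := Derivation.map_matrix_det (Polynomial.derivative' (R := ℂ)) G.charmatrix
  have h2 : (derivative G.charpoly).eval x = ((Matrix.scalar n x - G).adjugate).trace := by
    have h3 : derivative G.charpoly = Polynomial.derivative' (R := ℂ) G.charmatrix.det := rfl
    rw [h3, h, eval_finsetSum]
    simp only [eval_finsetSum, eval_mul]
    have h4 (i j : n) : (Polynomial.derivative' (R := ℂ) (G.charmatrix i j)) =
        if i = j then 1 else 0 := by
      by_cases hij : i = j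
      · subst hij; simp
      · simp [hij]
    have h5 (i : n) : (G.charmatrix.adjugate i i).eval x = (Matrix.scalar n x - G).adjugate i i := by
      have := congrFun (congrFun (RingHom.map_adjugate (evalRingHom x) G.charmatrix) i) i
      rw [RingHom.mapMatrix_apply, Matrix.map_apply] at this
      refine this.trans ?_
      congr 2
      ext a b
      simp [Matrix.charmatrix_apply, Matrix.diagonal_apply, apply_ite]
    simp only [h4, apply_ite (eval x), eval_one, eval_zero, mul_ite, mul_one, mul_zero,
      Finset.sum_ite_eq, Finset.mem_univ, if_true, h5]
    rfl
  rw [h2, Matrix.inv_def, Matrix.trace_smul, ← Matrix.eval_charpoly, Ring.inverse_eq_inv',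
    smul_eq_mul, mul_inv_cancel_left₀ hx]

/-- The matrix `G + s ξ ξ*` over the polynomial ring in `ξ` and `conj ξ`. -/
noncomputable def rankOnePerturbation (s : ℂ) (G : Matrix n n ℂ) :
    Matrix n n (MvPolynomial (n ⊕ n) ℂ) :=
  Matrix.of fun a b => MvPolynomial.C (G a b) +
    MvPolynomial.C s * (MvPolynomial.X (Sum.inl a) * MvPolynomial.X (Sum.inr b))

/-- The matrix determinant lemma for a rank one update; `hx` makes the resolvent exist. -/
theorem det_scalar_sub_rankOnePerturbation (s : ℂ) (G : Matrix n n ℂ) (x : ℂ)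
    (hx : G.charpoly.eval x ≠ 0) :
    (Matrix.scalar n (MvPolynomial.C x) - rankOnePerturbation s G).det =
      MvPolynomial.C (G.charpoly.eval x) *
        (1 - MvPolynomial.C s * hermitianQuadForm (Matrix.scalar n x - G)⁻¹) := by
  let u : n → MvPolynomial (n ⊕ n) ℂ := fun a => - MvPolynomial.C s * MvPolynomial.X (Sum.inl a)
  let v : n → MvPolynomial (n ⊕ n) ℂ := fun b => MvPolynomial.X (Sum.inr b)
  have h1 : Matrix.scalar n (MvPolynomial.C x) - rankOnePerturbation s G =
      (Matrix.scalar n x - G).map (MvPolynomial.C (σ := n ⊕ n)) +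
      (Matrix.replicateCol Unit u : Matrix n Unit (MvPolynomial (n ⊕ n) ℂ)) *
        (Matrix.replicateRow Unit v : Matrix Unit n (MvPolynomial (n ⊕ n) ℂ)) := by
    ext1 a b
    simp only [rankOnePerturbation, Matrix.sub_apply, Matrix.of_apply, Matrix.add_apply,
      Matrix.map_apply, Matrix.mul_apply, Matrix.replicateCol_apply, Matrix.replicateRow_apply,
      Finset.univ_unique, Finset.sum_singleton, Matrix.scalar_apply, Matrix.diagonal_apply, u, v]
    split_ifs <;> simp <;> ring
  have h2 : ((Matrix.scalar n x - G).map (MvPolynomial.C (σ := n ⊕ n))).det =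
      MvPolynomial.C (G.charpoly.eval x) := by
    rw [Matrix.eval_charpoly, RingHom.map_det]
    rfl
  have hu : IsUnit ((Matrix.scalar n x - G).map (MvPolynomial.C (σ := n ⊕ n))).det := by
    rw [h2]
    exact (IsUnit.mk0 _ hx).map MvPolynomial.C
  have hinv : ((Matrix.scalar n x - G).map (MvPolynomial.C (σ := n ⊕ n)))⁻¹ =
      ((Matrix.scalar n x - G)⁻¹).map (MvPolynomial.C (σ := n ⊕ n)) := by
    refine Matrix.inv_eq_right_inv ?_
    rw [← Matrix.map_mul, Matrix.mul_nonsing_inv]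
    · ext1 a b; simp [Matrix.one_apply, apply_ite]
    · rw [← Matrix.eval_charpoly]; exact IsUnit.mk0 _ hx
  rw [h1, Matrix.det_add_replicateCol_mul_replicateRow hu, h2, hinv, Matrix.det_unique]
  congr 1
  simp only [Matrix.add_apply, Matrix.one_apply_eq, Matrix.mul_apply, Matrix.replicateRow_apply,
    Matrix.replicateCol_apply, Matrix.map_apply, hermitianQuadForm, sub_eq_add_neg, u, v]
  congr 1
  rw [Finset.mul_sum, ← Finset.sum_neg_distrib, Finset.sum_congr rfl fun b _ => Finset.sum_mul ..,
    Finset.sum_comm]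
  refine Finset.sum_congr rfl fun a _ => ?_
  rw [Finset.mul_sum, ← Finset.sum_neg_distrib]
  refine Finset.sum_congr rfl fun b _ => ?_
  ring

/-- By Leibniz and `χ' = χ · tr R`, applying `1 - s d/dX` to `X^j χ` at `x_i` gives `χ(x_i)` times
the first order functional with coefficient `1 - s tr R(x_i)`. Factoring `χ(x_i)` out of row `i`
reduces the claim to the quadratic form recursion. -/
theorem gaussianExpectation_charpolyDet_leval (s : ℂ) (G : Matrix n n ℂ) (x : Fin k → ℂ)
    (hx : Function.Injective x) (hG : ∀ i, G.charpoly.eval (x i) ≠ 0) :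
    gaussianExpectation n (charpolyDet (fun i => leval (x i)) (rankOnePerturbation s G)) =
      charpolyDet (fun i => subDeriv s (leval (x i))) G := by
  have hR : ∀ a ∈ {a : ℂ | G.charpoly.eval a ≠ 0}, ∀ b ∈ {a : ℂ | G.charpoly.eval a ≠ 0},
      (b - a) • ((Matrix.scalar n a - G)⁻¹ * (Matrix.scalar n b - G)⁻¹) =
        (Matrix.scalar n a - G)⁻¹ - (Matrix.scalar n b - G)⁻¹ := by
    intro a ha b hb
    have ha' : IsUnit (Matrix.scalar n a - G).det := by
      rw [← Matrix.eval_charpoly]; exact IsUnit.mk0 _ ha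
    have hb' : IsUnit (Matrix.scalar n b - G).det := by
      rw [← Matrix.eval_charpoly]; exact IsUnit.mk0 _ hb
    have h : (b - a) • (1 : Matrix n n ℂ) =
        (Matrix.scalar n b - G) - (Matrix.scalar n a - G) := by
      ext i j
      by_cases hij : i = j
      · subst hij; simp
      · simp [hij]
    calc _ = (Matrix.scalar n a - G)⁻¹ * ((b - a) • (1 : Matrix n n ℂ)) *
          (Matrix.scalar n b - G)⁻¹ := by simp
      _ = _ := by
        rw [h, mul_sub, sub_mul, Matrix.nonsing_inv_mul _ ha', mul_assoc,
          Matrix.mul_nonsing_inv _ hb', mul_one, one_mul]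
  have h1 := firstOrderDet_eq_vandermonde_mul_quadFormCorrelation s
    (fun y => (Matrix.scalar n y - G)⁻¹) _ hR x hx hG
  rw [charpolyDet_leval]
  simp only [MvPolynomial.algebraMap_eq, det_scalar_sub_rankOnePerturbation s G _ (hG _),
    Finset.prod_mul_distrib]
  rw [← map_prod, gaussianExpectation_C_mul, gaussianExpectation_C_mul]
  change _ * (_ * quadFormCorrelation s (fun y => (Matrix.scalar n y - G)⁻¹) x) = _
  rw [mul_left_comm, ← h1, firstOrderDet, ← Matrix.det_mul_column, charpolyDet]
  congr 1
  ext i j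
  simp only [Matrix.of_apply, coeffFunctional_self, subDeriv_apply, firstOrderFunctional_apply,
    leval_apply, eval_sub, eval_smul, derivative_mul, eval_add, eval_mul, smul_eq_mul,
    eval_derivative_charpoly G _ (hG i)]
  ring

theorem exists_injective_eval_ne_zero (p : ℂ[X]) (hp : p ≠ 0) (D : ℕ) :
    ∃ t : Fin D → ℂ, Function.Injective t ∧ ∀ i, p.eval (t i) ≠ 0 := by
  have h : {a : ℂ | p.eval a ≠ 0}.Infinite := by
    have := (Polynomial.finite_setOfPred_isRoot hp).infinite_compl
    exact this
  obtain ⟨f⟩ : Nonempty (ℕ ↪ {a : ℂ | p.eval a ≠ 0}) := ⟨h.natEmbedding _⟩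
  exact ⟨fun i => f i, fun a b hab => Fin.ext (f.injective (Subtype.ext hab)), fun i => (f i).2⟩

/-- Averaging over a rank one perturbation acts on `charpolyDet` through `1 - s d/dX`. -/
theorem gaussianExpectation_charpolyDet (s : ℂ) (G : Matrix n n ℂ) (l : Fin k → ℂ[X] →ₗ[ℂ] ℂ) :
    gaussianExpectation n (charpolyDet l (rankOnePerturbation s G)) =
      charpolyDet (fun i => subDeriv s (l i)) G := by
  obtain ⟨t, ht, htG⟩ := exists_injective_eval_ne_zero G.charpoly G.charpoly_monic.ne_zero
    (Fintype.card n + k)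
  set f : MultilinearMap ℂ (fun _ : Fin k => ℂ[X] →ₗ[ℂ] ℂ) ℂ :=
    (gaussianExpectation n).compMultilinearMap (charpolyDetMultilinear k (rankOnePerturbation s G))
  set g : MultilinearMap ℂ (fun _ : Fin k => ℂ[X] →ₗ[ℂ] ℂ) ℂ :=
    (charpolyDetMultilinear k G).compLinearMap fun _ => subDeriv s
  -- Lagrange interpolation at nodes that avoid the eigenvalues of `G`: on the relevant degrees each
  -- functional is a combination of evaluations for which the resolvents exist.
  set l' : Fin k → ℂ[X] →ₗ[ℂ] ℂ := fun i =>
    ∑ j, l i (Lagrange.basis Finset.univ t j) • leval (t j) with hl'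
  have hll (i : Fin k) (p : ℂ[X]) (hp : p.degree < (Fintype.card n + k : ℕ)) :
      l i p = l' i p := by
    have h := Lagrange.eq_interpolate (s := Finset.univ) (v := t) (f := p) ht.injOn
      (by simpa using hp)
    conv_lhs => rw [h]
    simp only [Lagrange.interpolate_apply, map_sum, hl', LinearMap.sum_apply, LinearMap.smul_apply,
      leval_apply, smul_eq_mul, ← smul_eq_C_mul, map_smul]
    exact Finset.sum_congr rfl fun _ _ => mul_comm _ _
  have e1 : charpolyDet l (rankOnePerturbation s G) = charpolyDet l' (rankOnePerturbation s G) :=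
    charpolyDet_congr _ _ _ fun i m hm => hll i _ (by rw [degree_X_pow]; exact_mod_cast hm)
  have e2 : charpolyDet (fun i => subDeriv s (l i)) G =
      charpolyDet (fun i => subDeriv s (l' i)) G := by
    refine charpolyDet_congr _ _ _ fun i m hm => ?_
    rw [subDeriv_apply, subDeriv_apply]
    refine hll i _ ((degree_sub_le _ _).trans_lt (max_lt (by rw [degree_X_pow]; exact_mod_cast hm) ?_))
    refine (degree_smul_le _ _).trans_lt (degree_derivative_le.trans_lt (by rw [degree_X_pow]; exact_mod_cast hm))
  rw [e1, e2]
  change f l' = g l'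
  simp only [hl', MultilinearMap.map_sum, MultilinearMap.map_smul_univ]
  refine Finset.sum_congr rfl fun v _ => ?_
  congr 1
  -- After multilinear expansion, terms with a repeated node vanish on both sides because two rows
  -- agree.
  by_cases hv : Function.Injective v
  · exact gaussianExpectation_charpolyDet_leval s G _ (ht.comp hv) fun i => htG _
  · obtain ⟨i, j, hij, hne⟩ := Function.not_injective_iff.1 hv
    have h1 : f (fun i => leval (t (v i))) = gaussianExpectation n 0 :=
      congrArg (gaussianExpectation n) (charpolyDet_eq_zero_of_eq (rankOnePerturbation s G) _ hne
        (congrArg (fun c => leval (t c)) hij))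
    have h2 : g (fun i => leval (t (v i))) = 0 :=
      charpolyDet_eq_zero_of_eq _ _ hne (congrArg (fun c => subDeriv s (leval (t c))) hij)
    rw [h1, h2, map_zero]

end CharpolyDet

/-! ### Iterated Gaussian expectations. -/

section Fubini

open MvPolynomial

variable {α β : Type*} [Fintype α] [Fintype β]

/-- Gaussian expectations over a disjoint union of index sets can be taken iteratively. -/
theorem gaussianExpectation_sum (P : MvPolynomial ((α ⊕ β) ⊕ (α ⊕ β)) ℂ)
    (q : MvPolynomial (α ⊕ α) ℂ)
    (h : ∀ z : α → ℂ, eval (Sum.elim z fun a => conj (z a)) q =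
      gaussianExpectation β (aeval (Sum.elim (Sum.elim (fun a => C (z a)) fun b => X (Sum.inl b))
        (Sum.elim (fun a => C (conj (z a))) fun b => X (Sum.inr b))) P)) :
    gaussianExpectation (α ⊕ β) P = gaussianExpectation α q := by
  rw [gaussianExpectation_eq_integral, gaussianExpectation_eq_integral]
  have hmp := measurePreserving_sumPiEquivProdPi_symm
    (X := fun _ : α ⊕ β => ℂ) (fun _ : α ⊕ β => stdComplexGaussian)
  have hint := integrable_eval_pi_stdComplexGaussian P
  rw [← hmp.integral_comp (MeasurableEquiv.measurableEmbedding _)]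
  have hint2 := (hmp.integrable_comp_emb (MeasurableEquiv.measurableEmbedding _)).2 hint
  refine (integral_prod _ hint2).trans ?_
  refine integral_congr_ae (Eventually.of_forall fun z => ?_)
  simp only [h z, gaussianExpectation_eq_integral]
  refine integral_congr_ae (Eventually.of_forall fun w => ?_)
  simp only [Function.comp_apply, ← coe_aeval_eq_eval, RingHom.coe_coe]
  rw [← AlgHom.comp_apply (aeval _), comp_aeval]
  congr 2
  funext i
  rcases i with (a | b) | (a | b) <;> simp [MeasurableEquiv.sumPiEquivProdPi,
    Equiv.sumPiEquivProdPi]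

end Fubini

/-! ### The adjoint of averaging over rank one perturbations. -/

section Pairing

open MvPolynomial

variable {n : Type*}

/-- The pairing `E (f (g) h (conj g))` of polynomials in Gaussian variables. -/
noncomputable def gaussianPairing [Fintype n] (f h : MvPolynomial n ℂ) : ℂ :=
  gaussianExpectation n (rename Sum.inl f * rename Sum.inr h)

/-- `f` evaluated at the matrix `g + c ξ ξ*` with `g` and `ξ` Gaussian. -/
noncomputable def perturbedEval (c : ℂ) :
    MvPolynomial (n × n) ℂ →ₐ[ℂ] MvPolynomial ((n × n ⊕ n) ⊕ (n × n ⊕ n)) ℂ :=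
  aeval fun p => X (Sum.inl (Sum.inl p)) +
    C c * (X (Sum.inl (Sum.inr p.1)) * X (Sum.inr (Sum.inr p.2)))

/-- `h` evaluated at the matrix `conj g`. -/
noncomputable def conjEval :
    MvPolynomial (n × n) ℂ →ₐ[ℂ] MvPolynomial ((n × n ⊕ n) ⊕ (n × n ⊕ n)) ℂ :=
  rename fun p => Sum.inr (Sum.inl p)

theorem pderiv_inl_conjEval (i : n × n ⊕ n) (h : MvPolynomial (n × n) ℂ) :
    pderiv (Sum.inl i) (conjEval h) = 0 := by
  classical
  induction h using MvPolynomial.induction_on with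
  | C a => simp [conjEval]
  | add p q hp hq => rw [map_add, map_add, hp, hq, add_zero]
  | mul_X p j hp =>
    rw [map_mul, Derivation.leibniz, hp]
    simp [conjEval, pderiv_X]

theorem pderiv_entry_perturbedEval (c : ℂ) (p : n × n) (f : MvPolynomial (n × n) ℂ) :
    pderiv (Sum.inl (Sum.inl p)) (perturbedEval c f) = perturbedEval c (pderiv p f) := by
  classical
  induction f using MvPolynomial.induction_on with
  | C a => simp [perturbedEval]
  | add p q hp hq => simp only [map_add, hp, hq]
  | mul_X q j hq =>
    rw [map_mul, Derivation.leibniz, hq, Derivation.leibniz, map_add]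
    simp only [smul_eq_mul, map_mul, perturbedEval, aeval_X, map_add, pderiv_X, Derivation.leibniz,
      pderiv_C, Pi.single_apply]
    by_cases h : j = p
    · subst h; simp
    · simp [h]

variable [Fintype n]

theorem pderiv_vector_perturbedEval (c : ℂ) (a : n) (f : MvPolynomial (n × n) ℂ) :
    pderiv (Sum.inl (Sum.inr a)) (perturbedEval c f) =
      C c * ∑ b, X (Sum.inr (Sum.inr b)) * perturbedEval c (pderiv (a, b) f) := by
  classical
  induction f using MvPolynomial.induction_on with
  | C a => simp [perturbedEval]
  | add p q hp hq => simp only [map_add, hp, hq, mul_add, Finset.sum_add_distrib]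
  | mul_X q j hq =>
    obtain ⟨j1, j2⟩ := j
    rw [map_mul, Derivation.leibniz, hq]
    have h1 : pderiv (Sum.inl (Sum.inr a)) (perturbedEval c (X (j1, j2) : MvPolynomial (n × n) ℂ)) =
        if j1 = a then C c * X (Sum.inr (Sum.inr j2)) else 0 := by
      simp only [perturbedEval, aeval_X, map_add, pderiv_X, Derivation.leibniz, pderiv_C,
        Pi.single_apply]
      by_cases h : j1 = a
      · subst h; simp
      · simp [h]
    have h2 (b : n) : perturbedEval c (pderiv (a, b) (q * X (j1, j2))) =
        (if (j1, j2) = (a, b) then perturbedEval c q else 0) +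
          perturbedEval c (X (j1, j2)) * perturbedEval c (pderiv (a, b) q) := by
      rw [Derivation.leibniz, map_add, smul_eq_mul, smul_eq_mul, map_mul, map_mul, pderiv_X]
      congr 1
      by_cases h : (j1, j2) = (a, b)
      · rw [if_pos h, h]; simp
      · rw [if_neg h]; simp [Ne.symm h]
    rw [h1]
    simp only [h2, mul_add, Finset.sum_add_distrib, smul_eq_mul, Prod.mk.injEq, mul_ite, mul_zero]
    congr 1
    · by_cases h : j1 = a
      · simp only [h, true_and, if_true, Finset.sum_ite_eq, Finset.mem_univ]
        ring
      · simp [h]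
    · simp only [Finset.mul_sum]
      exact Finset.sum_congr rfl fun b _ => by ring

variable [DecidableEq n]

/-- Integration by parts in `conj g_p`: the derivative in `g_p` sees only `f`, because the other
factors do not contain the holomorphic entries. -/
theorem gaussianExpectation_perturbedEval_entry (c : ℂ) (d b : n) (p : n × n)
    (f h : MvPolynomial (n × n) ℂ) :
    gaussianExpectation _ (X (Sum.inl (Sum.inr d)) * X (Sum.inr (Sum.inr b)) *
        (perturbedEval c f * conjEval (X p * h))) =
      gaussianExpectation _ (X (Sum.inl (Sum.inr d)) * X (Sum.inr (Sum.inr b)) *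
        (perturbedEval c (pderiv p f) * conjEval h)) := by
  have h1 : X (Sum.inl (Sum.inr d)) * X (Sum.inr (Sum.inr b)) *
        (perturbedEval c f * conjEval (X p * h)) = X (Sum.inr (Sum.inl p)) *
      (X (Sum.inl (Sum.inr d)) * X (Sum.inr (Sum.inr b)) * (perturbedEval c f * conjEval h)) := by
    rw [map_mul]
    have : conjEval (X p : MvPolynomial (n × n) ℂ) = X (Sum.inr (Sum.inl p)) := rename_X _ _
    rw [this]
    ring
  rw [h1, gaussianExpectation_X_inr_mul]
  congr 1
  simp only [Derivation.leibniz, pderiv_inl_conjEval, pderiv_entry_perturbedEval, pderiv_X]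
  simp
  ring

/-- Integrate by parts in `conj ξ_a`. Hitting `ξ_d` gives the Kronecker term; hitting `f` gives `c ∑
conj ξ_b ∂_ab f`, and each `∂_ab` is traded back for multiplication by `conj g_ab`. -/
theorem gaussianExpectation_perturbedEval_vector (c : ℂ) (d a : n)
    (f h : MvPolynomial (n × n) ℂ) :
    gaussianExpectation _ (X (Sum.inl (Sum.inr d)) * X (Sum.inr (Sum.inr a)) *
        (perturbedEval c f * conjEval h)) =
      (if d = a then gaussianExpectation _ (perturbedEval c f * conjEval h) else 0) +
      c * ∑ b, gaussianExpectation _ (X (Sum.inl (Sum.inr d)) * X (Sum.inr (Sum.inr b)) *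
        (perturbedEval c f * conjEval (X (a, b) * h))) := by
  simp only [gaussianExpectation_perturbedEval_entry]
  have h1 : X (Sum.inl (Sum.inr d)) * X (Sum.inr (Sum.inr a)) *
        (perturbedEval c f * conjEval h) = X (Sum.inr (Sum.inr a)) *
      (X (Sum.inl (Sum.inr d)) * (perturbedEval c f * conjEval h)) := by ring
  rw [h1, gaussianExpectation_X_inr_mul]
  simp only [Derivation.leibniz, pderiv_inl_conjEval, pderiv_vector_perturbedEval, pderiv_X,
    smul_eq_mul, mul_zero, zero_add]
  rw [map_add, add_comm]
  congr 1
  · by_cases h : d = a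
    · subst h; simp
    · simp [h]
  · rw [← smul_eq_mul c, Finset.smul_sum]
    simp only [Finset.mul_sum, map_sum]
    refine Finset.sum_congr rfl fun b _ => ?_
    rw [← map_smul, smul_eq_C_mul]
    congr 1
    ring

/-- The previous relation is a linear system with matrix `M` for the expectations weighted by `ξ_d
conj ξ_b`; the adjugate solves it, as in Cramer's rule. -/
theorem gaussianExpectation_perturbedEval_det (c : ℂ) (d e : n)
    (f h : MvPolynomial (n × n) ℂ) (M : Matrix n n (MvPolynomial (n × n) ℂ))
    (hM : M = 1 - (C c : MvPolynomial (n × n) ℂ) • Matrix.mvPolynomialX n n ℂ) :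
    gaussianExpectation _ (X (Sum.inl (Sum.inr d)) * X (Sum.inr (Sum.inr e)) *
        (perturbedEval c f * conjEval (M.det * h))) =
      gaussianExpectation _ (perturbedEval c f * conjEval (M.adjugate e d * h)) := by
  set Λ : n → MvPolynomial (n × n) ℂ →ₗ[ℂ] ℂ := fun b =>
    gaussianExpectation _ ∘ₗ LinearMap.mulLeft ℂ (X (Sum.inl (Sum.inr d)) * X (Sum.inr (Sum.inr b)))
      ∘ₗ LinearMap.mulLeft ℂ (perturbedEval c f) ∘ₗ conjEval.toLinearMap with hΛ
  have key (a : n) (h : MvPolynomial (n × n) ℂ) : ∑ b, Λ b (M a b * h) =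
      if d = a then gaussianExpectation _ (perturbedEval c f * conjEval h) else 0 := by
    have h1 := gaussianExpectation_perturbedEval_vector c d a f h
    change Λ a h = _ + c * ∑ b, Λ b (X (a, b) * h) at h1
    rw [← sub_eq_iff_eq_add] at h1
    rw [← h1]
    have h2 (b : n) : Λ b (M a b * h) = (if a = b then Λ b h else 0) - c * Λ b (X (a, b) * h) := by
      rw [← smul_eq_mul c, ← map_smul, smul_eq_C_mul, hM]
      by_cases hab : a = b
      · subst hab
        rw [if_pos rfl, ← map_sub]
        congr 1
        simp; ring
      · rw [if_neg hab, zero_sub, ← map_neg]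
        congr 1
        simp [hab]; ring
    simp only [h2, Finset.sum_sub_distrib, Finset.sum_ite_eq, Finset.mem_univ, if_true,
      Finset.mul_sum]
  change Λ e (M.det * h) = _
  have h3 : ∑ a, ∑ b, Λ b (M a b * (M.adjugate e a * h)) = Λ e (M.det * h) := by
    rw [Finset.sum_comm]
    have h4 (b : n) : ∑ a, Λ b (M a b * (M.adjugate e a * h)) =
        if e = b then Λ b (M.det * h) else 0 := by
      rw [← map_sum]
      have := congrFun (congrFun M.adjugate_mul e) b
      rw [Matrix.mul_apply, Matrix.smul_apply, Matrix.one_apply] at this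
      rw [Finset.sum_congr rfl fun a _ => show M a b * (M.adjugate e a * h) =
        (M.adjugate e a * M a b) * h by ring, ← Finset.sum_mul, this]
      by_cases hb : e = b <;> simp [hb]
    simp only [h4, Finset.sum_ite_eq, Finset.mem_univ, if_true]
  rw [← h3]
  simp only [key, Finset.sum_ite_eq, Finset.mem_univ, if_true]

/-- The family of matrices `1 - s M` has the determinant with derivative `-∑ adj_{ji} M_{ij}`. -/
theorem eval_derivative_det_one_sub {Q : Type*} [CommRing Q] (M : Matrix n n Q) (c : Q) :
    (Polynomial.derivative (1 - (Polynomial.X : Polynomial Q) • M.map Polynomial.C).det).eval c =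
      -∑ i, ∑ j, (1 - c • M).adjugate j i * M i j := by
  have h := Derivation.map_matrix_det (Polynomial.derivative' (R := Q))
    (1 - (Polynomial.X : Polynomial Q) • M.map Polynomial.C)
  change Polynomial.derivative (1 - (Polynomial.X : Polynomial Q) • M.map Polynomial.C).det = _ at h
  rw [h, Polynomial.eval_finsetSum, ← Finset.sum_neg_distrib]
  refine Finset.sum_congr rfl fun i _ => ?_
  rw [Polynomial.eval_finsetSum, ← Finset.sum_neg_distrib]
  refine Finset.sum_congr rfl fun j _ => ?_
  have h1 : (Polynomial.evalRingHom c).mapMatrix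
      (1 - (Polynomial.X : Polynomial Q) • M.map Polynomial.C) = 1 - c • M := by
    ext a b
    by_cases hab : a = b <;> simp [hab] <;> exact mul_comm _ _
  have h2 : ((1 - (Polynomial.X : Polynomial Q) • M.map Polynomial.C).adjugate j i).eval c =
      (1 - c • M).adjugate j i := by
    rw [← h1, ← RingHom.map_adjugate]
    rfl
  rw [Polynomial.eval_mul, h2, neg_mul_eq_mul_neg]
  congr 1
  by_cases hij : i = j
  · subst hij; simp
  · simp [hij]

theorem eval_det_one_sub {Q : Type*} [CommRing Q] (M : Matrix n n Q) (c : Q) :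
    ((1 - (Polynomial.X : Polynomial Q) • M.map Polynomial.C).det).eval c =
      (1 - c • M).det := by
  have h1 : (Polynomial.evalRingHom c).mapMatrix
      (1 - (Polynomial.X : Polynomial Q) • M.map Polynomial.C) = 1 - c • M := by
    ext a b
    by_cases hab : a = b <;> simp [hab] <;> exact mul_comm _ _
  rw [← h1, ← RingHom.map_det]
  rfl

/-- `perturbedEval` with the parameter as a polynomial variable. -/
noncomputable def perturbedEvalPoly :
    MvPolynomial (n × n) ℂ →ₐ[ℂ]
      Polynomial (MvPolynomial ((n × n ⊕ n) ⊕ (n × n ⊕ n)) ℂ) :=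
  aeval fun p => Polynomial.C (X (Sum.inl (Sum.inl p))) +
    Polynomial.X * Polynomial.C (X (Sum.inl (Sum.inr p.1)) * X (Sum.inr (Sum.inr p.2)))

omit [Fintype n] [DecidableEq n] in
theorem eval_perturbedEvalPoly (c : ℂ) (f : MvPolynomial (n × n) ℂ) :
    (perturbedEvalPoly f).eval (C c) = perturbedEval c f := by
  induction f using MvPolynomial.induction_on with
  | C a => simp [perturbedEval, perturbedEvalPoly, Polynomial.algebraMap_apply]
  | add p q hp hq => simp only [map_add, Polynomial.eval_add, hp, hq]
  | mul_X q j hq =>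
    rw [map_mul, Polynomial.eval_mul, hq, map_mul]
    simp [perturbedEval, perturbedEvalPoly]

theorem eval_derivative_perturbedEvalPoly (c : ℂ) (f : MvPolynomial (n × n) ℂ) :
    (Polynomial.derivative (perturbedEvalPoly f)).eval (C c) =
      ∑ a, ∑ b, X (Sum.inl (Sum.inr a)) * X (Sum.inr (Sum.inr b)) *
        perturbedEval c (pderiv (a, b) f) := by
  induction f using MvPolynomial.induction_on with
  | C a => simp [perturbedEvalPoly, Polynomial.algebraMap_apply]
  | add p q hp hq =>
    simp only [map_add, Polynomial.eval_add, hp, hq, mul_add, Finset.sum_add_distrib]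
  | mul_X q j hq =>
    obtain ⟨j1, j2⟩ := j
    rw [map_mul, Polynomial.derivative_mul, Polynomial.eval_add, Polynomial.eval_mul, hq,
      Polynomial.eval_mul, eval_perturbedEvalPoly, eval_perturbedEvalPoly]
    have h1 : (Polynomial.derivative (perturbedEvalPoly (X (j1, j2)))).eval
        (C c : MvPolynomial ((n × n ⊕ n) ⊕ (n × n ⊕ n)) ℂ) =
        X (Sum.inl (Sum.inr j1)) * X (Sum.inr (Sum.inr j2)) := by
      simp [perturbedEvalPoly]
    have h2 (a b : n) : perturbedEval c (pderiv (a, b) (q * X (j1, j2))) =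
        (if (j1, j2) = (a, b) then perturbedEval c q else 0) +
          perturbedEval c (X (j1, j2)) * perturbedEval c (pderiv (a, b) q) := by
      rw [Derivation.leibniz, map_add, smul_eq_mul, smul_eq_mul, map_mul, map_mul, pderiv_X]
      congr 1
      by_cases h : (j1, j2) = (a, b)
      · rw [if_pos h, h]; simp
      · rw [if_neg h]; simp [Ne.symm h]
    rw [h1]
    have h3 : ∑ a, ∑ b, X (Sum.inl (Sum.inr a)) * X (Sum.inr (Sum.inr b)) *
        (if (j1, j2) = (a, b) then perturbedEval c q else 0) =
        X (Sum.inl (Sum.inr j1)) * X (Sum.inr (Sum.inr j2)) * perturbedEval c q := by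
      rw [Finset.sum_eq_single j1 _ (by simp), Finset.sum_eq_single j2 _ (by simp), if_pos rfl]
      · intro b _ hb; rw [if_neg fun h => hb (Prod.ext_iff.1 h).2.symm, mul_zero]
      · intro a _ ha
        refine Finset.sum_eq_zero fun b _ => ?_
        rw [if_neg fun h => ha (Prod.ext_iff.1 h).1.symm, mul_zero]
    simp only [h2, mul_add, Finset.sum_add_distrib, h3]
    rw [add_comm, mul_comm (perturbedEval c q)]
    congr 1
    simp only [Finset.sum_mul]
    exact Finset.sum_congr rfl fun a _ => Finset.sum_congr rfl fun b _ => by ring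

/-- Differentiating under the Gaussian expectation in the strength of the perturbation. -/
theorem gaussianExpectation_perturbedEval_const (c : ℂ) (f h : MvPolynomial (n × n) ℂ) :
    gaussianExpectation _ (perturbedEval c f *
        conjEval ((1 - (C c : MvPolynomial (n × n) ℂ) • Matrix.mvPolynomialX n n ℂ).det * h)) =
      gaussianExpectation _ (perturbedEval 0 f * conjEval h) := by
  -- The strength `c` is promoted to a polynomial variable, so that differentiation in it is formal.
  set D : Polynomial (MvPolynomial (n × n) ℂ) :=
    (1 - (Polynomial.X : Polynomial (MvPolynomial (n × n) ℂ)) •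
      (Matrix.mvPolynomialX n n ℂ).map Polynomial.C).det with hD
  set P : Polynomial (MvPolynomial ((n × n ⊕ n) ⊕ (n × n ⊕ n)) ℂ) :=
    perturbedEvalPoly f * (D.map (conjEval : _ →ₐ[ℂ] _).toRingHom * Polynomial.C (conjEval h))
    with hP
  have hDmap (E : Polynomial (MvPolynomial (n × n) ℂ)) (c : ℂ) :
      (E.map (conjEval (n := n)).toRingHom).eval (C c) = conjEval (E.eval (C c)) := by
    have : (C c : MvPolynomial ((n × n ⊕ n) ⊕ (n × n ⊕ n)) ℂ) =
      (conjEval (n := n)).toRingHom (C c) := by simp [conjEval]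
    rw [this, Polynomial.eval_map_apply]
    rfl
  have hPc (c : ℂ) : P.eval (C c) = perturbedEval c f *
      conjEval ((1 - (C c : MvPolynomial (n × n) ℂ) • Matrix.mvPolynomialX n n ℂ).det * h) := by
    rw [hP, Polynomial.eval_mul, eval_perturbedEvalPoly, Polynomial.eval_mul, hDmap, hD,
      eval_det_one_sub, Polynomial.eval_C, map_mul]
  have hP' (c : ℂ) : gaussianExpectation _ ((Polynomial.derivative P).eval (C c)) = 0 := by
    rw [hP, Polynomial.derivative_mul, Polynomial.derivative_mul, Polynomial.derivative_C,
      mul_zero, add_zero, Polynomial.derivative_map]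
    simp only [Polynomial.eval_add, Polynomial.eval_mul, hDmap, Polynomial.eval_C,
      eval_perturbedEvalPoly, eval_derivative_perturbedEvalPoly]
    rw [hD, eval_derivative_det_one_sub, eval_det_one_sub]
    set M := 1 - (C c : MvPolynomial (n × n) ℂ) • Matrix.mvPolynomialX n n ℂ with hM
    rw [← map_mul, ← map_mul, map_add, Finset.sum_mul, map_sum]
    simp only [neg_mul, Finset.sum_mul, map_neg, mul_neg, map_sum, Finset.mul_sum]
    rw [← sub_eq_add_neg, sub_eq_zero]
    -- The `c`-derivative of `f(g + cξξ*)` is `∑ ξ_a conj ξ_b ∂_ab f`, that of the determinant is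
    -- `-∑ adj(M)_ba g_ab` read at `conj g`. They cancel for each `(a, b)` separately.
    refine Finset.sum_congr rfl fun a _ => Finset.sum_congr rfl fun b _ => ?_
    rw [mul_assoc, ← gaussianExpectation_perturbedEval_entry, mul_left_comm (X (a, b)),
      gaussianExpectation_perturbedEval_det c a b f _ M hM, Matrix.mvPolynomialX_apply, mul_assoc]
  -- The expectation as a scalar polynomial in `c`; its derivative vanishes everywhere, so its value
  -- at `c` is its value at `0`.
  set B : Polynomial ℂ := ∑ m ∈ Finset.range (P.natDegree + 1),
    Polynomial.monomial m (gaussianExpectation _ (P.coeff m)) with hB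
  have hBc (c : ℂ) : B.eval c = gaussianExpectation _ (P.eval (C c)) := by
    rw [hB, Polynomial.eval_finsetSum, Polynomial.eval_eq_sum_range, map_sum]
    refine Finset.sum_congr rfl fun m _ => ?_
    rw [Polynomial.eval_monomial, mul_comm, ← smul_eq_mul, ← map_smul, smul_eq_C_mul, map_pow,
      mul_comm]
  have hB'c (c : ℂ) : (Polynomial.derivative B).eval c = 0 := by
    rw [← hP' c, hB, Polynomial.derivative_sum, Polynomial.eval_finsetSum]
    conv_rhs => rw [P.as_sum_range]
    rw [Polynomial.derivative_sum, Polynomial.eval_finsetSum, map_sum]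
    refine Finset.sum_congr rfl fun m _ => ?_
    rw [Polynomial.derivative_monomial, Polynomial.derivative_monomial, Polynomial.eval_monomial,
      Polynomial.eval_monomial, mul_assoc, mul_comm, ← smul_eq_mul, ← map_smul, smul_eq_C_mul]
    congr 1
    simp only [map_mul, map_pow, map_natCast]
    ring
  have hB' : Polynomial.derivative B = 0 := Polynomial.funext fun c => by simp [hB'c]
  have hconst := Polynomial.eq_C_of_derivative_eq_zero hB'
  have h0 := hPc 0
  rw [C_0 (σ := n × n), zero_smul, sub_zero, Matrix.det_one, one_mul] at h0
  rw [← hPc, ← h0, ← hBc, ← hBc, hconst]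
  simp

/-- If `fT` is the average of `f` over rank one perturbations `G + c ξ ξ*`, then pairing `fT` with
`det (1 - c X) h` is pairing `f` with `h`. -/
theorem gaussianPairing_det_mul (c : ℂ) (f fT h : MvPolynomial (n × n) ℂ)
    (hT : ∀ G : Matrix n n ℂ, eval (fun p => G p.1 p.2) fT =
      gaussianExpectation n (aeval (fun p => rankOnePerturbation c G p.1 p.2) f)) :
    gaussianPairing fT
        ((1 - (C c : MvPolynomial (n × n) ℂ) • Matrix.mvPolynomialX n n ℂ).det * h) =
      gaussianPairing f h := by
  have e1 := gaussianExpectation_perturbedEval_const c f h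
  set K := (1 - (C c : MvPolynomial (n × n) ℂ) • Matrix.mvPolynomialX n n ℂ).det * h
  have hconj (K : MvPolynomial (n × n) ℂ) (z : n × n → ℂ) :
      aeval (Sum.elim (Sum.elim (fun a => C (z a)) fun b => X (Sum.inl b))
        (Sum.elim (fun a => C (conj (z a))) fun b => X (Sum.inr b))) (conjEval K) =
      (C (eval (fun p => conj (z p)) K) : MvPolynomial (n ⊕ n) ℂ) := by
    rw [conjEval, aeval_rename, ← coe_aeval_eq_eval]
    have := comp_aeval_apply (f := fun p => conj (z p)) (Algebra.ofId ℂ (MvPolynomial (n ⊕ n) ℂ)) K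
    exact this.symm
  have hpert (c : ℂ) (z : n × n → ℂ) :
      aeval (Sum.elim (Sum.elim (fun a => C (z a)) fun b => X (Sum.inl b))
        (Sum.elim (fun a => C (conj (z a))) fun b => X (Sum.inr b))) (perturbedEval c f) =
      aeval (fun p => rankOnePerturbation c (Matrix.of fun a b => z (a, b)) p.1 p.2) f := by
    rw [perturbedEval, comp_aeval_apply]
    congr 2
    funext p
    simp [rankOnePerturbation]
  have hpair (f h : MvPolynomial (n × n) ℂ) (z : n × n → ℂ) :
      eval (Sum.elim z fun a => conj (z a)) (rename Sum.inl f * rename Sum.inr h) =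
        eval z f * eval (fun p => conj (z p)) h := by
    rw [map_mul, eval_rename, eval_rename]
    rfl
  rw [gaussianExpectation_sum (perturbedEval c f * conjEval K)
    (rename Sum.inl fT * rename Sum.inr K), gaussianExpectation_sum (perturbedEval 0 f * conjEval h)
    (rename Sum.inl f * rename Sum.inr h)] at e1
  · exact e1
  · intro z
    rw [hpair, map_mul, hconj, hpert, mul_comm, mul_comm (aeval _ f), gaussianExpectation_C_mul]
    congr 1
    have : aeval (fun p => rankOnePerturbation 0 (Matrix.of fun a b => z (a, b)) p.1 p.2) f =
        (C (eval z f) : MvPolynomial (n ⊕ n) ℂ) := by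
      rw [← coe_aeval_eq_eval]
      have := comp_aeval_apply (f := z) (Algebra.ofId ℂ (MvPolynomial (n ⊕ n) ℂ)) f
      refine Eq.trans ?_ this.symm
      congr 2
      funext p
      simp [rankOnePerturbation]
    rw [this, gaussianExpectation_C]
  · intro z
    rw [hpair, map_mul (aeval _), hconj, hpert, mul_comm, mul_comm (aeval _ f),
      gaussianExpectation_C_mul, ← hT (Matrix.of fun a b => z (a, b))]
    rfl

end Pairing

/-! ### Inverting `1 - c d/dX` and partial fractions. -/

section DifferentialOperators

open Polynomial

/-- The partial sum of order `n` of the exponential series. -/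
noncomputable def expPartialSum (n : ℕ) (x : ℂ) : ℂ :=
  ∑ m ∈ Finset.range (n + 1), x ^ m / (m.factorial : ℂ)

/-- The polynomial `p` in the differentiation operator. -/
noncomputable def diffOp : ℂ[X] →ₐ[ℂ] Module.End ℂ ℂ[X] :=
  aeval (derivative : ℂ[X] →ₗ[ℂ] ℂ[X])

theorem diffOp_mul (p q r : ℂ[X]) : diffOp (p * q) r = diffOp p (diffOp q r) := by
  rw [map_mul]; rfl

theorem diffOp_X_pow (d : ℕ) (p : ℂ[X]) : diffOp (X ^ d) p = derivative^[d] p := by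
  simp [diffOp, Module.End.pow_apply]

theorem diffOp_C_mul (c : ℂ) (p q : ℂ[X]) : diffOp (C c * p) q = c • diffOp p q := by
  rw [← smul_eq_C_mul, map_smul]; rfl

theorem diffOp_sum {ι : Type*} (s : Finset ι) (f : ι → ℂ[X]) (p : ℂ[X]) :
    diffOp (∑ i ∈ s, f i) p = ∑ i ∈ s, diffOp (f i) p := by
  rw [map_sum, LinearMap.sum_apply]

theorem diffOp_one_sub (c : ℂ) (p : ℂ[X]) : diffOp (1 - C c * X) p = p - c • derivative p := by
  rw [map_sub, map_one, LinearMap.sub_apply, diffOp_C_mul, ← pow_one (X : ℂ[X]), diffOp_X_pow]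
  rfl

/-- The derivative of order `n+1` kills polynomials of degree at most `n`, so truncated geometric
series are genuine inverses there. -/
theorem diffOp_prod_one_sub_pow {ι : Type*} (s : Finset ι) (c : ι → ℂ) (n : ℕ) (p : ℂ[X])
    (hp : p.natDegree ≤ n) : diffOp (∏ i ∈ s, (1 - (C (c i) * X) ^ (n + 1))) p = p := by
  classical
  induction s using Finset.induction_on with
  | empty => rw [Finset.prod_empty, map_one]; rfl
  | insert a s ha ih =>
    rw [Finset.prod_insert ha, diffOp_mul, ih, map_sub, map_one, LinearMap.sub_apply, mul_pow,
      ← C_pow, diffOp_C_mul, diffOp_X_pow, iterate_derivative_eq_zero (by omega), smul_zero,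
      sub_zero]
    rfl

/-- The truncated geometric series `∑_{r ≤ n} (c X)^r`. -/
noncomputable def geomPoly (n : ℕ) (c : ℂ) : ℂ[X] := ∑ r ∈ Finset.range (n + 1), (C c * X) ^ r

theorem geomPoly_mul_one_sub (n : ℕ) (c : ℂ) :
    geomPoly n c * (1 - C c * X) = 1 - (C c * X) ^ (n + 1) := geom_sum_mul_neg _ _

/-- The term `y^{-r} D^r X^n` is `n!/(n-r)! · y^{-r} X^{n-r}`; put `m = n - r`. -/
theorem eval_diffOp_geomPoly (n : ℕ) (y x : ℂ) (hy : y ≠ 0) :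
    (diffOp (geomPoly n y⁻¹) (X ^ n)).eval x =
      n.factorial * y⁻¹ ^ n * expPartialSum n (x * y) := by
  rw [geomPoly, diffOp_sum, eval_finsetSum, expPartialSum, Finset.mul_sum,
    ← Finset.sum_range_reflect]
  refine Finset.sum_congr rfl fun m hm => ?_
  have hm' : m ≤ n := Nat.lt_succ_iff.1 (Finset.mem_range.1 hm)
  rw [mul_pow, ← C_pow, diffOp_C_mul, diffOp_X_pow, iterate_derivative_X_pow_eq_smul, eval_smul,
    eval_smul, eval_pow, eval_X, smul_eq_mul, smul_eq_mul]
  have h1 : n - (n + 1 - 1 - m) = m := by omega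
  have h2 : n + 1 - 1 - m = n - m := by omega
  have h3 := Nat.factorial_mul_descFactorial (n := n) (k := n - m) (by omega)
  rw [h2] at h1 ⊢
  rw [h1] at h3 ⊢
  rw [← h3]
  have h4 : (m.factorial : ℂ) ≠ 0 := Nat.cast_ne_zero.2 m.factorial_ne_zero
  obtain ⟨r, rfl⟩ := Nat.exists_eq_add_of_le hm'
  push_cast
  rw [Nat.add_sub_cancel_left, inv_pow, inv_pow, pow_add, mul_pow]
  field_simp

variable {k : ℕ}

/-- The product of the reciprocals of `1 - y_i / y_m` for `m ≠ i`. -/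
noncomputable def lagrangeWeight (y : Fin k → ℂ) (i : Fin k) : ℂ :=
  ∏ m ∈ ({i}ᶜ : Finset (Fin k)), (1 - (y m)⁻¹ * y i)⁻¹

/-- Lagrange interpolation of `X^d` at the nodes `y`, valid since `d < k`. Divided by `∏ (1 -
X/y_m)` it is the partial fraction expansion. -/
theorem sum_lagrangeWeight (y : Fin k → ℂ) (hy : Function.Injective y) (hy0 : ∀ i, y i ≠ 0)
    (d : ℕ) (hd : d < k) :
    ∑ l, C (lagrangeWeight y l * y l ^ d) *
      ∏ m ∈ ({l}ᶜ : Finset (Fin k)), (1 - C (y m)⁻¹ * X) = X ^ d := by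
  refine Polynomial.eq_of_degrees_lt_of_eval_index_eq (v := y) Finset.univ hy.injOn ?_ ?_ ?_
  · refine (degree_sum_le _ _).trans_lt ?_
    rw [Finset.sup_lt_iff (by rw [Finset.card_univ, Fintype.card_fin]; exact WithBot.bot_lt_coe k)]
    intro l _
    rw [Finset.card_univ, Fintype.card_fin, degree_lt_iff_coeff_zero]
    intro m hm
    refine coeff_eq_zero_of_natDegree_lt ((natDegree_C_mul_le _ _).trans_lt ?_)
    refine (natDegree_prod_le _ _).trans_lt ?_
    have : ∀ m ∈ ({l}ᶜ : Finset (Fin k)), (1 - C (y m)⁻¹ * X : ℂ[X]).natDegree ≤ 1 := by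
      intro m _
      compute_degree
    refine (Finset.sum_le_sum this).trans_lt ?_
    rw [Finset.sum_const, Finset.card_compl, Fintype.card_fin, Finset.card_singleton, smul_eq_mul]
    have := l.2
    omega
  · rw [degree_X_pow, Finset.card_univ, Fintype.card_fin]
    exact_mod_cast hd
  · intro i _
    rw [eval_finsetSum, Finset.sum_eq_single i]
    · rw [eval_mul, eval_C, eval_prod, lagrangeWeight, eval_pow, eval_X, mul_right_comm,
        ← Finset.prod_mul_distrib, Finset.prod_eq_one, one_mul]
      intro m hm
      have hne : y m ≠ y i := fun h => by simp [hy h] at hm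
      simp only [eval_sub, eval_one, eval_mul, eval_C, eval_X]
      refine inv_mul_cancel₀ fun h => hne ?_
      rw [sub_eq_zero, eq_comm, inv_mul_eq_one₀ (hy0 m)] at h
      exact h
    · intro l _ hl
      rw [eval_mul, eval_prod, Finset.prod_eq_zero (i := i) (by simp [hl.symm]), mul_zero]
      simp [hy0 i]
    · simp

/-- `X^(n-d)` is a multiple of `D^d X^n`. Expanding `D^d` by partial fractions cancels all geometric
series but one in each summand, up to powers `D^(n+1)` that annihilate `X^n`. -/
theorem eval_diffOp_prod_geomPoly (y : Fin k → ℂ) (hy : Function.Injective y) (hy0 : ∀ i, y i ≠ 0)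
    (n d : ℕ) (hd : d < k) (hdn : d ≤ n) (x : ℂ) :
    (diffOp (∏ l, geomPoly n (y l)⁻¹) (X ^ (n - d))).eval x = (n - d).factorial *
      ∑ l, lagrangeWeight y l * (y l)⁻¹ ^ n * expPartialSum n (x * y l) * y l ^ d := by
  have h1 : (diffOp ((∏ l, geomPoly n (y l)⁻¹) * X ^ d) (X ^ n)).eval x = n.factorial *
      ∑ l, lagrangeWeight y l * (y l)⁻¹ ^ n * expPartialSum n (x * y l) * y l ^ d := by
    rw [← sum_lagrangeWeight y hy hy0 d hd, Finset.mul_sum, diffOp_sum, eval_finsetSum,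
      Finset.mul_sum]
    refine Finset.sum_congr rfl fun l _ => ?_
    have h2 : (∏ l, geomPoly n (y l)⁻¹) * (C (lagrangeWeight y l * y l ^ d) *
        ∏ m ∈ ({l}ᶜ : Finset (Fin k)), (1 - C (y m)⁻¹ * X)) =
        C (lagrangeWeight y l * y l ^ d) * (geomPoly n (y l)⁻¹ *
          ∏ m ∈ ({l}ᶜ : Finset (Fin k)), (1 - (C (y m)⁻¹ * X) ^ (n + 1))) := by
      rw [Fintype.prod_eq_mul_prod_compl l]
      simp only [← geomPoly_mul_one_sub]
      rw [Finset.prod_mul_distrib]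
      ring
    rw [h2, diffOp_C_mul, diffOp_mul, diffOp_prod_one_sub_pow _ _ _ _ (natDegree_X_pow_le n),
      eval_smul, eval_diffOp_geomPoly _ _ _ (hy0 l), smul_eq_mul]
    ring
  rw [diffOp_mul, diffOp_X_pow, iterate_derivative_X_pow_eq_smul, map_smul, eval_smul,
    smul_eq_mul] at h1
  have h3 := Nat.factorial_mul_descFactorial hdn
  have h4 : (n.descFactorial d : ℂ) ≠ 0 := by
    rw [Nat.cast_ne_zero]
    exact (Nat.descFactorial_pos.2 hdn).ne'
  refine mul_left_cancel₀ h4 (h1.trans ?_)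
  rw [← h3]
  push_cast
  ring

/-- The weights multiply to `(∏ y)^(k-1) / ∏_{i≠m} (y_m - y_i)`, and this denominator is the product
of the ordinary and the reversed Vandermonde determinants. -/
theorem prod_lagrangeWeight_mul_det (y : Fin k → ℂ) (hy : Function.Injective y)
    (hy0 : ∀ i, y i ≠ 0) :
    (∏ l, lagrangeWeight y l) * (Matrix.of fun l (b : Fin k) => y l ^ (b.rev : ℕ)).det *
      (Matrix.vandermonde y).det = (∏ l, y l) ^ (k - 1) := by
  have h1 : (Matrix.of fun l (b : Fin k) => y l ^ (b.rev : ℕ)) = Matrix.projVandermonde 1 y := by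
    ext l b
    simp [Matrix.projVandermonde_apply]
  have h2 : ∏ l, lagrangeWeight y l =
      (∏ l, y l) ^ (k - 1) * (∏ i, ∏ m ∈ ({i}ᶜ : Finset (Fin k)), (y m - y i))⁻¹ := by
    have h3 : (∏ l, y l) ^ (k - 1) = ∏ i, ∏ m ∈ ({i}ᶜ : Finset (Fin k)), y m := by
      rw [← Finset.prod_pow]
      have := Finset.prod_comm' (s := (Finset.univ : Finset (Fin k))) (t := fun i => {i}ᶜ)
        (t' := Finset.univ) (s' := fun i : Fin k => {i}ᶜ) (f := fun _ m => y m)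
        (by intro x y; simp [eq_comm])
      rw [this]
      refine Finset.prod_congr rfl fun m _ => ?_
      rw [Finset.prod_const, Finset.card_compl, Fintype.card_fin, Finset.card_singleton]
    rw [h3, ← Finset.prod_inv_distrib, ← Finset.prod_mul_distrib]
    refine Finset.prod_congr rfl fun i _ => ?_
    rw [← Finset.prod_inv_distrib, ← Finset.prod_mul_distrib]
    refine Finset.prod_congr rfl fun m _ => ?_
    rw [show y m - y i = y m * (1 - (y m)⁻¹ * y i) by
      rw [mul_sub, mul_one, mul_inv_cancel_left₀ (hy0 m)], mul_inv, mul_inv_cancel_left₀ (hy0 m)]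
  have h4 : (∏ i, ∏ m ∈ ({i}ᶜ : Finset (Fin k)), (y m - y i)) =
      (Matrix.projVandermonde 1 y).det * (Matrix.vandermonde y).det := by
    rw [← Finset.prod_prod_Ioi_mul_eq_prod_prod_off_diag (fun a b => y a - y b),
      Matrix.det_vandermonde, Matrix.det_projVandermonde, ← Finset.prod_mul_distrib]
    refine Finset.prod_congr rfl fun i _ => ?_
    rw [← Finset.prod_mul_distrib]
    refine Finset.prod_congr rfl fun j _ => ?_
    simp [mul_comm]
  have h5 : (∏ i, ∏ m ∈ ({i}ᶜ : Finset (Fin k)), (y m - y i)) ≠ 0 :=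
    Finset.prod_ne_zero_iff.2 fun i _ => Finset.prod_ne_zero_iff.2 fun m hm =>
      sub_ne_zero.2 fun h => by simp [hy h] at hm
  rw [h1, mul_assoc, ← h4, h2, inv_mul_cancel_right₀ h5]

end DifferentialOperators

/-! ### The exact correlation formula at finite size. -/

section ExactFormula

open Polynomial

variable {n : Type*} [Fintype n] [DecidableEq n] {k : ℕ}

theorem gaussianPairing_charpolyDet_subDeriv (c : ℂ) (l : Fin k → ℂ[X] →ₗ[ℂ] ℂ)
    (h : MvPolynomial (n × n) ℂ) :
    gaussianPairing (charpolyDet (fun i => subDeriv c (l i)) (Matrix.mvPolynomialX n n ℂ))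
        ((1 - (MvPolynomial.C c : MvPolynomial (n × n) ℂ) • Matrix.mvPolynomialX n n ℂ).det * h) =
      gaussianPairing (charpolyDet l (Matrix.mvPolynomialX n n ℂ)) h := by
  refine gaussianPairing_det_mul c _ _ h fun G => ?_
  rw [← MvPolynomial.coe_aeval_eq_eval, RingHom.coe_coe, ← charpolyDet_map, ← charpolyDet_map]
  have h1 := Matrix.mvPolynomialX_mapMatrix_aeval ℂ G
  have h2 := Matrix.mvPolynomialX_mapMatrix_aeval ℂ (rankOnePerturbation c G)
  rw [AlgHom.mapMatrix_apply] at h1 h2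
  rw [h1, h2, gaussianExpectation_charpolyDet]

theorem gaussianPairing_charpolyDet_prod {ι : Type*} (s : Finset ι) (c : ι → ℂ)
    (l : Fin k → ℂ[X] →ₗ[ℂ] ℂ) :
    gaussianPairing (charpolyDet (fun i => l i ∘ₗ diffOp (∏ m ∈ s, (1 - C (c m) * X)))
        (Matrix.mvPolynomialX n n ℂ))
        (∏ m ∈ s, (1 - (MvPolynomial.C (c m) : MvPolynomial (n × n) ℂ) •
          Matrix.mvPolynomialX n n ℂ).det) =
      gaussianPairing (charpolyDet l (Matrix.mvPolynomialX n n ℂ)) 1 := by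
  classical
  induction s using Finset.induction_on with
  | empty => simp only [Finset.prod_empty, map_one]; rfl
  | insert a s ha ih =>
    rw [← ih, Finset.prod_insert ha, Finset.prod_insert ha]
    refine Eq.trans ?_ (gaussianPairing_charpolyDet_subDeriv (c a)
      (fun i => l i ∘ₗ diffOp (∏ m ∈ s, (1 - C (c m) * X))) _)
    congr 2
    funext i
    refine LinearMap.ext fun p => ?_
    rw [subDeriv_apply, ← diffOp_one_sub, mul_comm]
    simp only [LinearMap.comp_apply, diffOp_mul]

theorem gaussianExpectation_rename_inl {ι : Type*} [Fintype ι] (f : MvPolynomial ι ℂ) :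
    gaussianExpectation ι (MvPolynomial.rename Sum.inl f) = MvPolynomial.eval 0 f := by
  induction f using MvPolynomial.induction_on' with
  | add p q hp hq => rw [map_add, map_add, map_add, hp, hq]
  | monomial m a =>
    rw [MvPolynomial.rename_monomial, gaussianExpectation_monomial, MvPolynomial.eval_monomial,
      Finsupp.prod_fintype _ _ (by simp)]
    congr 1
    refine Finset.prod_congr rfl fun i _ => ?_
    rw [Finsupp.mapDomain_apply Sum.inl_injective, Finsupp.mapDomain_of_notMem_range _ _ (by simp)]
    rcases Nat.eq_zero_or_pos (m i) with h | h
    · simp [h]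
    · simp [h.ne']

/-- A polynomial in `g` alone has expectation equal to its value at `g = 0`, and the zero matrix has
characteristic polynomial `X^n`. -/
theorem gaussianPairing_charpolyDet_one (l : Fin k → ℂ[X] →ₗ[ℂ] ℂ) :
    gaussianPairing (charpolyDet l (Matrix.mvPolynomialX n n ℂ)) 1 =
      (Matrix.of fun i (j : Fin k) => l i (X ^ (Fintype.card n + j))).det := by
  rw [gaussianPairing, map_one, mul_one, gaussianExpectation_rename_inl,
    ← MvPolynomial.coe_aeval_eq_eval, RingHom.coe_coe, ← charpolyDet_map]
  have h1 := Matrix.mvPolynomialX_mapMatrix_aeval ℂ (0 : Matrix n n ℂ)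
  rw [AlgHom.mapMatrix_apply] at h1
  have h2 : (fun p : n × n => (0 : Matrix n n ℂ) p.1 p.2) = 0 := rfl
  rw [h2] at h1
  rw [h1, charpolyDet]
  congr 1
  ext i j
  rw [Matrix.of_apply, Matrix.of_apply, coeffFunctional_self, Matrix.charpoly_zero, ← pow_add,
    add_comm]

/-- The pairing of products of characteristic polynomials. -/
theorem gaussianPairing_charpolyDet_leval (x y : Fin k → ℂ) (hy : Function.Injective y)
    (hy0 : ∀ i, y i ≠ 0) :
    gaussianPairing (charpolyDet (fun i => leval (x i)) (Matrix.mvPolynomialX n n ℂ))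
        (∏ m, (1 - (MvPolynomial.C (y m)⁻¹ : MvPolynomial (n × n) ℂ) •
          Matrix.mvPolynomialX n n ℂ).det) * (∏ l, y l) ^ Fintype.card n *
        (Matrix.vandermonde y).det =
      (∏ b : Fin k, ((Fintype.card n + b).factorial : ℂ)) *
        (Matrix.of fun i j => expPartialSum (Fintype.card n + k - 1) (x i * y j)).det := by
  set N := Fintype.card n with hN
  set S : ℂ[X] := ∏ l, geomPoly (N + k - 1) (y l)⁻¹ with hS
  -- Insert the inverse of `∏ (1 - D/y_m)`, exact on degrees up to `N+k-1`, so that all the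
  -- determinants in `conj g` can be stripped off.
  have h1 : charpolyDet (fun i => leval (x i)) (Matrix.mvPolynomialX n n ℂ) =
      charpolyDet (fun i => (leval (x i) ∘ₗ diffOp S) ∘ₗ diffOp (∏ m, (1 - C (y m)⁻¹ * X)))
        (Matrix.mvPolynomialX n n ℂ) := by
    refine charpolyDet_congr _ _ _ fun i m hm => ?_
    rw [LinearMap.comp_apply, LinearMap.comp_apply, ← diffOp_mul, hS, ← Finset.prod_mul_distrib]
    simp only [geomPoly_mul_one_sub]
    rw [diffOp_prod_one_sub_pow]
    exact (natDegree_X_pow_le m).trans (by omega)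
  -- Up to column factors `(N+j)!`, the matrix is the truncated exponential kernel with scaled
  -- columns times a reversed Vandermonde matrix.
  have h2 : (Matrix.of fun i (j : Fin k) => (leval (x i) ∘ₗ diffOp S) (X ^ (N + j))) =
      Matrix.of fun i (j : Fin k) => ((N + j).factorial : ℂ) *
        ((Matrix.of fun i l => lagrangeWeight y l * (y l)⁻¹ ^ (N + k - 1) *
            (Matrix.of fun i j => expPartialSum (N + k - 1) (x i * y j)) i l) *
          (Matrix.of fun l (b : Fin k) => y l ^ (b.rev : ℕ))) i j := by
    ext i j
    have hj := j.2
    have h3 : N + j = N + k - 1 - j.rev := by rw [Fin.val_rev]; omega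
    rw [Matrix.of_apply, Matrix.of_apply, h3, LinearMap.comp_apply, leval_apply, hS,
      eval_diffOp_prod_geomPoly y hy hy0 _ _ j.rev.2 (by rw [Fin.val_rev]; omega)]
    rfl
  rw [h1, gaussianPairing_charpolyDet_prod, gaussianPairing_charpolyDet_one, h2,
    Matrix.det_mul_row, Matrix.det_mul, Matrix.det_mul_row, Finset.prod_mul_distrib]
  have h4 := prod_lagrangeWeight_mul_det y hy hy0
  have h5 : (∏ l, (y l)⁻¹ ^ (N + k - 1)) * (∏ l, y l) ^ (k - 1) * (∏ l, y l) ^ N = 1 := by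
    rw [Finset.prod_pow, Finset.prod_inv_distrib, mul_assoc, ← pow_add]
    rcases Nat.eq_zero_or_pos k with rfl | hk
    · simp
    · rw [show k - 1 + N = N + k - 1 by omega, ← mul_pow, inv_mul_cancel₀, one_pow]
      exact Finset.prod_ne_zero_iff.2 fun i _ => hy0 i
  linear_combination (∏ b : Fin k, ((N + b).factorial : ℂ)) *
    (Matrix.of fun i j => expPartialSum (N + k - 1) (x i * y j)).det *
    ((∏ l, (y l)⁻¹ ^ (N + k - 1)) * (∏ l, y l) ^ N * h4 + h5)

theorem gaussianPairing_eq_integral (N : ℕ) (f h : MvPolynomial (Fin N × Fin N) ℂ) :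
    gaussianPairing f h = ∫ g, MvPolynomial.eval (fun a => g a.1 a.2) f *
      MvPolynomial.eval (fun a => conj (g a.1 a.2)) h ∂(gaussianEntries N) := by
  rw [gaussianPairing, gaussianExpectation_eq_integral_gaussianEntries]
  refine integral_congr_ae (Eventually.of_forall fun g => ?_)
  simp only [map_mul, MvPolynomial.eval_rename]
  rfl

/-- The correlation functions of the characteristic polynomials of a Gaussian matrix. -/
theorem integral_prod_det_scalar_sub (N : ℕ) (x y : Fin k → ℂ) (hy : Function.Injective y)
    (hy0 : ∀ i, y i ≠ 0) :
    (∫ g, ∏ j, (Matrix.scalar (Fin N) (x j) - Matrix.of g).det *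
        (Matrix.scalar (Fin N) (y j) - (Matrix.of g).conjTranspose).det ∂(gaussianEntries N)) *
        ((Matrix.vandermonde x).det * (Matrix.vandermonde y).det) =
      (∏ b : Fin k, ((N + b).factorial : ℂ)) *
        (Matrix.of fun i j => expPartialSum (N + k - 1) (x i * y j)).det := by
  have h := gaussianPairing_charpolyDet_leval (n := Fin N) x y hy hy0
  rw [Fintype.card_fin] at h
  rw [← h, mul_comm (Matrix.vandermonde x).det, ← mul_assoc, mul_right_comm]
  congr 1
  rw [gaussianPairing_eq_integral, ← integral_mul_const, ← integral_mul_const]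
  refine integral_congr_ae (Eventually.of_forall fun g => ?_)
  beta_reduce
  have e1 : MvPolynomial.eval (fun a : Fin N × Fin N => g a.1 a.2)
      (charpolyDet (fun i => leval (x i)) (Matrix.mvPolynomialX (Fin N) (Fin N) ℂ)) =
      (Matrix.vandermonde x).det * ∏ j, (Matrix.scalar (Fin N) (x j) - Matrix.of g).det := by
    rw [← MvPolynomial.coe_aeval_eq_eval, RingHom.coe_coe, ← charpolyDet_map]
    have h1 := Matrix.mvPolynomialX_mapMatrix_aeval ℂ (Matrix.of g)
    rw [AlgHom.mapMatrix_apply] at h1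
    rw [show (fun a : Fin N × Fin N => g a.1 a.2) = fun p => Matrix.of g p.1 p.2 from rfl, h1,
      charpolyDet_leval]
    rfl
  have e2 (c : ℂ) (hc : c ≠ 0) : MvPolynomial.eval (fun a : Fin N × Fin N => conj (g a.1 a.2))
      (1 - (MvPolynomial.C c⁻¹ : MvPolynomial (Fin N × Fin N) ℂ) •
          Matrix.mvPolynomialX (Fin N) (Fin N) ℂ).det * c ^ N =
      (Matrix.scalar (Fin N) c - (Matrix.of g).conjTranspose).det := by
    rw [RingHom.map_det, ← Matrix.det_transpose (Matrix.scalar (Fin N) c - _), mul_comm]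
    have hs (M : Matrix (Fin N) (Fin N) ℂ) : c ^ N * M.det = (c • M).det := by
      rw [Matrix.det_smul, Fintype.card_fin]
    rw [hs]
    congr 1
    ext i j
    by_cases hij : i = j
    · subst hij; simp; field_simp
    · simp [hij, Ne.symm hij]; field_simp
  rw [e1, map_prod, Finset.prod_mul_distrib]
  simp only [← fun j => e2 (y j) (hy0 j)]
  rw [Finset.prod_mul_distrib, Finset.prod_pow]
  ring

end ExactFormula

/-! ### Asymptotics of the truncated exponential at the edge. -/

section EdgeKernel

theorem integrableOn_pow_mul_exp_neg (n : ℕ) :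
    IntegrableOn (fun t : ℝ => (t : ℂ) ^ n * Complex.exp (-t)) (Set.Ioi 0) := by
  have h := Complex.GammaIntegral_convergent (s := n + 1) (by simp; positivity)
  refine h.congr_fun (fun t _ => ?_) measurableSet_Ioi
  simp [mul_comm]

theorem integral_pow_mul_exp_neg (n : ℕ) :
    ∫ t in Set.Ioi (0 : ℝ), (t : ℂ) ^ n * Complex.exp (-t) = n.factorial := by
  have h := Complex.Gamma_eq_integral (s := n + 1) (by simp; positivity)
  rw [Complex.Gamma_nat_eq_factorial, Complex.GammaIntegral] at h
  rw [h]
  refine setIntegral_congr_fun measurableSet_Ioi fun t _ => ?_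
  simp [mul_comm]

theorem integral_add_pow_mul_exp_neg (n : ℕ) (x : ℂ) :
    ∫ t in Set.Ioi (0 : ℝ), (x + t) ^ n * Complex.exp (-t) =
      n.factorial * expPartialSum n x := by
  have h (t : ℝ) : (x + t) ^ n * Complex.exp (-t) = ∑ m ∈ Finset.range (n + 1),
      x ^ m * (n.choose m : ℂ) * ((t : ℂ) ^ (n - m) * Complex.exp (-t)) := by
    rw [add_pow, Finset.sum_mul]
    exact Finset.sum_congr rfl fun m _ => by ring
  simp_rw [h]
  rw [integral_finsetSum _ fun m _ => (integrableOn_pow_mul_exp_neg (n - m)).const_mul _,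
    expPartialSum, Finset.mul_sum]
  refine Finset.sum_congr rfl fun m hm => ?_
  have hm' : m ≤ n := Nat.lt_succ_iff.1 (Finset.mem_range.1 hm)
  rw [integral_const_mul, integral_pow_mul_exp_neg, ← Nat.choose_mul_factorial_mul_factorial hm']
  have := Nat.cast_ne_zero (R := ℂ).2 m.factorial_ne_zero
  push_cast
  field_simp

theorem integral_rescaled_add_pow_mul_exp_neg (n : ℕ) (x : ℂ) (q : ℝ) (hq : 0 < q) :
    (q : ℂ) ^ (2 * n + 1) * ∫ t in Set.Ioi (0 : ℝ), (x + t / q) ^ n * Complex.exp (-(q * t)) =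
      n.factorial * expPartialSum n (q ^ 2 * x) := by
  have hq' : (q : ℂ) ≠ 0 := Complex.ofReal_ne_zero.2 hq.ne'
  have h := integral_comp_mul_left_Ioi (fun t : ℝ => (q ^ 2 * x + t) ^ n * Complex.exp (-t)) 0 hq
  rw [mul_zero, integral_add_pow_mul_exp_neg, eq_inv_smul_iff₀ hq.ne', Complex.real_smul] at h
  rw [← h, pow_succ', mul_assoc, ← integral_const_mul]
  congr 1
  refine setIntegral_congr_fun measurableSet_Ioi fun t _ => ?_
  simp only [Complex.ofReal_mul]
  rw [pow_mul, ← mul_assoc, ← mul_pow]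
  congr 2
  field_simp

/-- The integrand of the rescaled kernel of the correlation functions at the edge. -/
noncomputable def edgeIntegrand (m N : ℕ) (u w : ℂ) (t : ℝ) : ℂ :=
  ((1 - u / (Real.sqrt N : ℂ)) * (1 - w / (Real.sqrt N : ℂ)) + t / (Real.sqrt N : ℂ)) ^ (N + m) *
    Complex.exp ((Real.sqrt N : ℂ) * (u + w) - (Real.sqrt N : ℂ) * t)

theorem continuous_edgeIntegrand (m N : ℕ) (u w : ℂ) : Continuous (edgeIntegrand m N u w) := by
  unfold edgeIntegrand
  fun_prop

/-- An elementary bound for the growth of the integrand. -/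
theorem pow_mul_exp_le (m N : ℕ) (q A α R t : ℝ) (hq : q ^ 2 = N) (hqm : (m : ℝ) + 1 ≤ q)
    (hA0 : 0 ≤ A) (hA : A ≤ 1 - α / q + R ^ 2 / q ^ 2) (ht : 0 ≤ t) (hα : |α| ≤ 2 * R) :
    (A + t / q) ^ (N + m) * Real.exp (q * α - q * t) ≤
      Real.exp ((((m : ℝ) + 1) ^ 2 + R ^ 2) * (1 + m) + (2 * m + 1) * (2 * R)) *
        Real.exp (-(t / 2)) := by
  set L : ℝ := m + 1 with hL
  have hm0 : (0 : ℝ) ≤ m := Nat.cast_nonneg m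
  have hL1 : 1 ≤ L := by linarith
  have hq1 : 1 ≤ q := by linarith
  have hq0 : 0 < q := by linarith
  have hn : ((N + m : ℕ) : ℝ) = q ^ 2 + m := by push_cast; rw [hq]
  -- Apply `1 + x ≤ exp x` to `s` and to `(A + t/q)/s - 1` rather than to the base directly. The
  -- tilt by `s` leaves `t` with coefficient `(m - qL)/(q + L) ≤ -1/2`, giving decay uniform in `N`.
  set s : ℝ := 1 + L / q with hs
  have hs0 : 0 < s := by positivity
  have hR : 0 ≤ R := by have := abs_nonneg α; linarith
  set n : ℝ := q ^ 2 + m with hn'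
  have hn0 : 0 ≤ n := by positivity
  have h1 : (A + t / q) ^ (N + m) ≤
      Real.exp (n * (L / q) + n * ((A + t / q) / s - 1)) := by
    have hB0 : 0 ≤ A + t / q := by positivity
    have h2 : A + t / q ≤ Real.exp (L / q + ((A + t / q) / s - 1)) := by
      rw [Real.exp_add]
      calc A + t / q = s * ((A + t / q) / s) := by field_simp
        _ ≤ Real.exp (L / q) * Real.exp ((A + t / q) / s - 1) := by
          have h3 := Real.add_one_le_exp (L / q)
          have h4 := Real.add_one_le_exp ((A + t / q) / s - 1)
          have h5 : (0 : ℝ) ≤ (A + t / q) / s := by positivity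
          exact mul_le_mul (by linarith) (by linarith) h5 (Real.exp_pos _).le
    calc (A + t / q) ^ (N + m) ≤ (Real.exp (L / q + ((A + t / q) / s - 1))) ^ (N + m) :=
          pow_le_pow_left₀ hB0 h2 _
      _ = _ := by rw [← Real.exp_nat_mul, hn, mul_add]
  refine (mul_le_mul_of_nonneg_right h1 (Real.exp_pos _).le).trans ?_
  rw [← Real.exp_add, ← Real.exp_add, Real.exp_le_exp]
  have hqs : q * s = q + L := by rw [hs]; field_simp
  have e1 : n * (L / q) + n * ((A + t / q) / s - 1) + (q * α - q * t) =
      (n * (L ^ 2 / q ^ 2 + (A - 1)) + q * α + L * α) / s + t * ((m - q * L) / (q + L)) := by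
    rw [← hqs]
    have : L = q * s - q := by linarith
    rw [this, hn']
    field_simp
    ring
  rw [e1]
  refine add_le_add ?_ ?_
  · have hs1 : 1 ≤ s := by
      have : 0 ≤ L / q := by positivity
      linarith
    have h2 : n * (L ^ 2 / q ^ 2 + (A - 1)) + q * α + L * α ≤
        (L ^ 2 + R ^ 2) * (1 + m) + (2 * m + 1) * (2 * R) := by
      have h3 : n * (L ^ 2 / q ^ 2 + (A - 1)) ≤ n * ((L ^ 2 + R ^ 2) / q ^ 2 - α / q) := by
        refine mul_le_mul_of_nonneg_left ?_ hn0
        rw [add_div]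
        linarith
      have h4 : n * ((L ^ 2 + R ^ 2) / q ^ 2 - α / q) =
          (L ^ 2 + R ^ 2) * (1 + m / q ^ 2) - q * α - m * (α / q) := by
        rw [hn']; field_simp; ring
      have h5 : (m : ℝ) / q ^ 2 ≤ m := div_le_self hm0 (one_le_pow₀ hq1)
      have h6 : -(m * (α / q)) ≤ m * (2 * R) := by
        rw [← mul_neg]
        refine mul_le_mul_of_nonneg_left ?_ hm0
        refine (neg_le_abs _).trans ?_
        rw [abs_div, abs_of_pos hq0]
        exact (div_le_self (abs_nonneg α) hq1).trans hα
      have h7 : L * α ≤ L * (2 * R) :=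
        mul_le_mul_of_nonneg_left ((le_abs_self α).trans hα) (by linarith)
      have h8 : (L ^ 2 + R ^ 2) * (1 + m / q ^ 2) ≤ (L ^ 2 + R ^ 2) * (1 + m) :=
        mul_le_mul_of_nonneg_left (by linarith) (by positivity)
      rw [h4] at h3
      have h9 : L * (2 * R) = m * (2 * R) + 2 * R := by rw [hL]; ring
      linarith
    have h3 : 0 ≤ (L ^ 2 + R ^ 2) * (1 + m) + (2 * m + 1) * (2 * R) := by positivity
    exact (div_le_div_of_nonneg_right h2 hs0.le).trans (div_le_self h3 hs1)
  · have h2 : (m - q * L) / (q + L) ≤ -(1 / 2) := by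
      rw [div_le_iff₀ (by linarith)]
      have : (m : ℝ) = L - 1 := by rw [hL]; ring
      nlinarith
    nlinarith

/-- By the arithmetic–geometric mean inequality `|1 - u/q| |1 - w/q|` is at most `1 - Re(u+w)/q +
R²/q²`; the linear term is compensated by `exp(q(u+w))`. -/
theorem norm_edgeIntegrand_le (m N : ℕ) (R : ℝ) (u w : ℂ) (hu : ‖u‖ ≤ R) (hw : ‖w‖ ≤ R)
    (hN : (m : ℝ) + 1 ≤ Real.sqrt N) (t : ℝ) (ht : 0 ≤ t) :
    ‖edgeIntegrand m N u w t‖ ≤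
      Real.exp ((((m : ℝ) + 1) ^ 2 + R ^ 2) * (1 + m) + (2 * m + 1) * (2 * R)) *
        Real.exp (-(t / 2)) := by
  set q := Real.sqrt N with hq
  have hm0 : (0 : ℝ) ≤ m := Nat.cast_nonneg m
  have hq0 : 0 < q := by linarith
  have hR : 0 ≤ R := (norm_nonneg u).trans hu
  have hnorm (u : ℂ) (hu : ‖u‖ ≤ R) :
      ‖1 - u / (q : ℂ)‖ ^ 2 ≤ 1 - 2 * u.re / q + R ^ 2 / q ^ 2 := by
    have h1 : 1 - u / (q : ℂ) = 1 - ((q⁻¹ : ℝ) : ℂ) * u := by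
      rw [Complex.ofReal_inv, div_eq_inv_mul]
    have h2 : ‖u‖ ^ 2 ≤ R ^ 2 := pow_le_pow_left₀ (norm_nonneg _) hu 2
    rw [← Complex.normSq_eq_norm_sq, Complex.normSq_apply] at h2
    rw [h1, ← Complex.normSq_eq_norm_sq, Complex.normSq_apply]
    simp only [Complex.sub_re, Complex.one_re, Complex.re_ofReal_mul, Complex.sub_im,
      Complex.one_im, Complex.im_ofReal_mul]
    have h3 : (1 - q⁻¹ * u.re) * (1 - q⁻¹ * u.re) + (0 - q⁻¹ * u.im) * (0 - q⁻¹ * u.im) =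
        1 - 2 * u.re / q + (u.re * u.re + u.im * u.im) / q ^ 2 := by
      field_simp; ring
    rw [h3]
    gcongr
  set A := ‖1 - u / (q : ℂ)‖ * ‖1 - w / (q : ℂ)‖ with hA
  have hA1 : A ≤ 1 - (u + w).re / q + R ^ 2 / q ^ 2 := by
    have h1 := two_mul_le_add_sq ‖1 - u / (q : ℂ)‖ ‖1 - w / (q : ℂ)‖
    have h2 := hnorm u hu
    have h3 := hnorm w hw
    have h4 : (u + w).re / q = u.re / q + w.re / q := by rw [Complex.add_re, add_div]
    have h5 (a : ℝ) : 2 * a / q = 2 * (a / q) := by ring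
    rw [h5] at h2 h3
    rw [h4]
    linarith
  have hα : |(u + w).re| ≤ 2 * R := by
    refine (Complex.abs_re_le_norm _).trans ((norm_add_le _ _).trans ?_)
    linarith
  refine le_trans ?_ (pow_mul_exp_le m N q A (u + w).re R t (Real.sq_sqrt (Nat.cast_nonneg N)) hN
    (by positivity) hA1 ht hα)
  rw [edgeIntegrand, norm_mul, norm_pow, Complex.norm_exp, ← hq]
  have h1 : ((q : ℂ) * (u + w) - (q : ℂ) * (t : ℂ)).re = q * (u + w).re - q * t := by
    rw [Complex.sub_re, Complex.re_ofReal_mul, Complex.re_ofReal_mul, Complex.ofReal_re]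
  rw [h1]
  refine mul_le_mul_of_nonneg_right (pow_le_pow_left₀ (norm_nonneg _) ?_ _) (Real.exp_pos _).le
  refine (norm_add_le _ _).trans ?_
  rw [norm_mul, norm_div, Complex.norm_real, Complex.norm_real, Real.norm_of_nonneg ht,
    Real.norm_of_nonneg hq0.le]

/-- The factor `exp(-bh)` cancels the linear term, leaving the second order Taylor coefficient. With
`h = 1/√N` this is what survives in an `N`-th power. -/
theorem tendsto_second_order (b c : ℂ) :
    Tendsto (fun h : ℂ => ((1 + b * h + c * h ^ 2) * Complex.exp (-(b * h)) - 1) / h ^ 2)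
      (𝓝[≠] 0) (𝓝 (c - b ^ 2 / 2)) := by
  have h1 := Complex.exp_sub_sum_range_isBigO_pow 3
  have h2 : Tendsto (fun h : ℂ => -(b * h)) (𝓝 0) (𝓝 0) := by
    have : Continuous fun h : ℂ => -(b * h) := by fun_prop
    simpa using this.tendsto 0
  have h3 : (fun h : ℂ => Complex.exp (-(b * h)) - (1 - b * h + (b * h) ^ 2 / 2)) =O[𝓝 0]
      fun h => h ^ 3 := by
    refine ((h1.comp_tendsto h2).congr_left fun h => ?_).trans ?_
    · simp [Finset.sum_range_succ]
      ring
    · refine Asymptotics.IsBigO.of_bound (‖b‖ ^ 3) (Eventually.of_forall fun h => ?_)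
      simp [mul_pow]
  have h4 : Tendsto (fun h : ℂ => (Complex.exp (-(b * h)) - (1 - b * h + (b * h) ^ 2 / 2)) / h ^ 2)
      (𝓝[≠] 0) (𝓝 0) := by
    have : (fun h : ℂ => h ^ 3) =o[𝓝 0] fun h : ℂ => h ^ 2 :=
      Asymptotics.isLittleO_pow_pow (by norm_num)
    exact ((h3.trans_isLittleO this).tendsto_div_nhds_zero).mono_left nhdsWithin_le_nhds
  have h5 : Tendsto (fun h : ℂ => c - b ^ 2 / 2 + h * (b ^ 3 / 2 - b * c) + h ^ 2 * (c * b ^ 2 / 2))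
      (𝓝[≠] 0) (𝓝 (c - b ^ 2 / 2)) := by
    have : Continuous fun h : ℂ =>
      c - b ^ 2 / 2 + h * (b ^ 3 / 2 - b * c) + h ^ 2 * (c * b ^ 2 / 2) := by fun_prop
    simpa using (this.tendsto 0).mono_left nhdsWithin_le_nhds
  have h6 : Tendsto (fun h : ℂ => 1 + b * h + c * h ^ 2) (𝓝[≠] 0) (𝓝 1) := by
    have : Continuous fun h : ℂ => 1 + b * h + c * h ^ 2 := by fun_prop
    simpa using (this.tendsto 0).mono_left nhdsWithin_le_nhds
  have h7 := h5.add (h6.mul h4)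
  rw [mul_zero, add_zero] at h7
  refine h7.congr' ?_
  filter_upwards [self_mem_nhdsWithin] with h hh
  have hh' : h ≠ 0 := hh
  field_simp
  ring

/-- The base is `1 + b/√N + uw/N` with `b = t - (u+w)`, and the exponential is the `N`-th power of
`exp(-b/√N)`. The extra `m` powers of the base tend to one. -/
theorem tendsto_edgeIntegrand (m : ℕ) (u w : ℂ) (t : ℝ) :
    Tendsto (fun N => edgeIntegrand m N u w t) atTop
      (𝓝 (Complex.exp (u * w - (t - (u + w)) ^ 2 / 2))) := by
  have hq : Tendsto (fun N : ℕ => (Real.sqrt N : ℂ)⁻¹) atTop (𝓝[≠] 0) := by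
    refine tendsto_nhdsWithin_iff.2 ⟨?_, ?_⟩
    · have h : Tendsto (fun N : ℕ => (Real.sqrt N)⁻¹) atTop (𝓝 0) :=
        (Real.tendsto_sqrt_atTop.comp tendsto_natCast_atTop_atTop).inv_tendsto_atTop
      have := (Complex.continuous_ofReal.tendsto 0).comp h
      simpa [Function.comp_def] using this
    · filter_upwards [eventually_gt_atTop 0] with N hN
      have : (0 : ℝ) < Real.sqrt N := Real.sqrt_pos.2 (Nat.cast_pos.2 hN)
      simp [this.ne']
  set b : ℂ := t - (u + w) with hb
  have h1 := (tendsto_second_order b (u * w)).comp hq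
  have h2 := Complex.tendsto_one_add_pow_exp_of_tendsto
    (g := fun N : ℕ => (1 + b * (Real.sqrt N : ℂ)⁻¹ + u * w * ((Real.sqrt N : ℂ)⁻¹) ^ 2) *
      Complex.exp (-(b * (Real.sqrt N : ℂ)⁻¹)) - 1) (t := u * w - b ^ 2 / 2) (by
    refine h1.congr fun N => ?_
    simp only [Function.comp_apply]
    rw [inv_pow, div_inv_eq_mul, ← Complex.ofReal_pow, Real.sq_sqrt (Nat.cast_nonneg N), mul_comm]
    simp)
  have h3 : Tendsto (fun N : ℕ => (1 + b * (Real.sqrt N : ℂ)⁻¹ +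
      u * w * ((Real.sqrt N : ℂ)⁻¹) ^ 2) ^ m) atTop (𝓝 1) := by
    have hq' := tendsto_nhds_of_tendsto_nhdsWithin hq
    have := (((hq'.const_mul b).const_add 1).add ((hq'.pow 2).const_mul (u * w))).pow m
    simpa using this
  have h4 := h2.mul h3
  rw [mul_one] at h4
  refine h4.congr' ?_
  filter_upwards [eventually_gt_atTop 0] with N hN
  have hq0 : (Real.sqrt N : ℂ) ≠ 0 :=
    Complex.ofReal_ne_zero.2 (Real.sqrt_pos.2 (Nat.cast_pos.2 hN)).ne'
  have hqN : (Real.sqrt N : ℂ) ^ 2 = N := by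
    rw [← Complex.ofReal_pow, Real.sq_sqrt (Nat.cast_nonneg N)]; simp
  have h5 : (1 - u / (Real.sqrt N : ℂ)) * (1 - w / (Real.sqrt N : ℂ)) + t / (Real.sqrt N : ℂ) =
      1 + b * (Real.sqrt N : ℂ)⁻¹ + u * w * ((Real.sqrt N : ℂ)⁻¹) ^ 2 := by
    rw [hb]; field_simp; ring
  rw [edgeIntegrand, h5, add_sub_cancel, mul_pow, ← Complex.exp_nat_mul, pow_add, mul_right_comm]
  congr 2
  rw [← hqN, hb]
  field_simp
  ring

/-- The rescaled kernel of the correlation functions at the edge. -/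
noncomputable def edgeKernel (m N : ℕ) (u w : ℂ) : ℂ :=
  Complex.exp (-((u ^ 2 + w ^ 2) / 2)) * ∫ t in Set.Ioi (0 : ℝ), edgeIntegrand m N u w t

/-- The limit of the rescaled kernels. -/
noncomputable def edgeLimitKernel (u w : ℂ) : ℂ :=
  Complex.exp (-((u ^ 2 + w ^ 2) / 2)) *
    ∫ t in Set.Ioi (0 : ℝ), Complex.exp (u * w - (t - (u + w)) ^ 2 / 2)

theorem integrableOn_exp_neg_half : IntegrableOn (fun t : ℝ => Real.exp (-(t / 2))) (Set.Ioi 0) := by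
  have := exp_neg_integrableOn_Ioi 0 (b := 1 / 2) (by norm_num)
  refine this.congr_fun (fun t _ => ?_) measurableSet_Ioi
  ring_nf

theorem exists_norm_edgeKernel_le (m : ℕ) (R : ℝ) : ∃ C : ℝ, ∀ N : ℕ, (m : ℝ) + 1 ≤ Real.sqrt N →
    ∀ u w : ℂ, ‖u‖ ≤ R → ‖w‖ ≤ R → ‖edgeKernel m N u w‖ ≤ C := by
  refine ⟨Real.exp (R ^ 2) * ∫ t in Set.Ioi (0 : ℝ), Real.exp ((((m : ℝ) + 1) ^ 2 + R ^ 2) *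
    (1 + m) + (2 * m + 1) * (2 * R)) * Real.exp (-(t / 2)), fun N hN u w hu hw => ?_⟩
  rw [edgeKernel, norm_mul]
  refine mul_le_mul ?_ ?_ (norm_nonneg _) (Real.exp_pos _).le
  · refine (Complex.norm_exp_le_exp_norm _).trans (Real.exp_le_exp.2 ?_)
    rw [norm_neg, norm_div, Complex.norm_two, div_le_iff₀ two_pos]
    refine (norm_add_le _ _).trans ?_
    rw [norm_pow, norm_pow]
    have h1 := pow_le_pow_left₀ (norm_nonneg _) hu 2
    have h2 := pow_le_pow_left₀ (norm_nonneg _) hw 2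
    linarith
  · refine norm_integral_le_of_norm_le (integrableOn_exp_neg_half.const_mul _) ?_
    refine (ae_restrict_mem measurableSet_Ioi).mono fun t ht => ?_
    exact norm_edgeIntegrand_le m N R u w hu hw hN t (le_of_lt ht)

theorem tendsto_edgeKernel (m : ℕ) (u w : ℂ) :
    Tendsto (fun N => edgeKernel m N u w) atTop (𝓝 (edgeLimitKernel u w)) := by
  refine Tendsto.const_mul _ ?_
  set R := max ‖u‖ ‖w‖ with hR
  have hN : ∀ᶠ N : ℕ in atTop, (m : ℝ) + 1 ≤ Real.sqrt N :=
    (Real.tendsto_sqrt_atTop.comp tendsto_natCast_atTop_atTop).eventually_ge_atTop _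
  refine tendsto_integral_filter_of_dominated_convergence (fun t =>
    Real.exp ((((m : ℝ) + 1) ^ 2 + R ^ 2) * (1 + m) + (2 * m + 1) * (2 * R)) *
      Real.exp (-(t / 2))) ?_ ?_ (integrableOn_exp_neg_half.const_mul _) ?_
  · exact Eventually.of_forall fun N => (continuous_edgeIntegrand m N u w).aestronglyMeasurable
  · filter_upwards [hN] with N hN
    refine (ae_restrict_mem measurableSet_Ioi).mono fun t ht => ?_
    exact norm_edgeIntegrand_le m N R u w (le_max_left _ _) (le_max_right _ _) hN t (le_of_lt ht)
  · exact Eventually.of_forall fun t => tendsto_edgeIntegrand m u w t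

end EdgeKernel

/-! ### Holomorphic dependence on parameters. -/

section FamiliesOfPolynomials

open MvPolynomial

variable {E σ : Type*} [NormedAddCommGroup E] [NormedSpace ℂ E]

/-- A family of polynomials which is a finite combination of fixed polynomials with
differentiable coefficients. -/
def IsDifferentiableFamily (P : E → MvPolynomial σ ℂ) : Prop :=
  ∃ (r : ℕ) (a : Fin r → E → ℂ) (Q : Fin r → MvPolynomial σ ℂ),
    (∀ i, Differentiable ℂ (a i)) ∧ ∀ p, P p = ∑ i, a i p • Q i

theorem IsDifferentiableFamily.of_fintype {ι : Type*} [Fintype ι] {P : E → MvPolynomial σ ℂ}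
    (a : ι → E → ℂ) (Q : ι → MvPolynomial σ ℂ) (ha : ∀ i, Differentiable ℂ (a i))
    (h : ∀ p, P p = ∑ i, a i p • Q i) : IsDifferentiableFamily P := by
  refine ⟨Fintype.card ι, fun i => a ((Fintype.equivFin ι).symm i),
    fun i => Q ((Fintype.equivFin ι).symm i), fun i => ha _, fun p => ?_⟩
  rw [h]
  exact ((Fintype.equivFin ι).symm.sum_comp fun i => a i p • Q i).symm

theorem IsDifferentiableFamily.const (Q : MvPolynomial σ ℂ) :
    IsDifferentiableFamily fun _ : E => Q :=
  .of_fintype (ι := Unit) (fun _ _ => 1) (fun _ => Q) (fun _ => differentiable_const _) (by simp)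

theorem IsDifferentiableFamily.C {a : E → ℂ} (ha : Differentiable ℂ a) :
    IsDifferentiableFamily fun p => (C (a p) : MvPolynomial σ ℂ) :=
  .of_fintype (ι := Unit) (fun _ => a) (fun _ => 1) (fun _ => ha) (by simp [smul_eq_C_mul])

theorem IsDifferentiableFamily.add {P Q : E → MvPolynomial σ ℂ} (hP : IsDifferentiableFamily P)
    (hQ : IsDifferentiableFamily Q) : IsDifferentiableFamily fun p => P p + Q p := by
  obtain ⟨r, a, A, ha, hA⟩ := hP
  obtain ⟨s, b, B, hb, hB⟩ := hQ
  refine .of_fintype (ι := Fin r ⊕ Fin s) (Sum.elim a b) (Sum.elim A B) ?_ fun p => ?_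
  · rintro (i | i)
    exacts [ha i, hb i]
  · rw [hA, hB, Fintype.sum_sum_type]
    rfl

theorem IsDifferentiableFamily.mul {P Q : E → MvPolynomial σ ℂ} (hP : IsDifferentiableFamily P)
    (hQ : IsDifferentiableFamily Q) : IsDifferentiableFamily fun p => P p * Q p := by
  obtain ⟨r, a, A, ha, hA⟩ := hP
  obtain ⟨s, b, B, hb, hB⟩ := hQ
  refine .of_fintype (ι := Fin r × Fin s) (fun i p => a i.1 p * b i.2 p)
    (fun i => A i.1 * B i.2) (fun i => (ha i.1).mul (hb i.2)) fun p => ?_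
  rw [hA, hB, Finset.sum_mul_sum, Fintype.sum_prod_type]
  exact Finset.sum_congr rfl fun i _ => Finset.sum_congr rfl fun j _ => smul_mul_smul_comm _ _ _ _

theorem IsDifferentiableFamily.sum {ι : Type*} (s : Finset ι) {P : ι → E → MvPolynomial σ ℂ}
    (hP : ∀ i ∈ s, IsDifferentiableFamily (P i)) :
    IsDifferentiableFamily fun p => ∑ i ∈ s, P i p := by
  classical
  induction s using Finset.induction_on with
  | empty => exact .const 0
  | insert a s ha ih =>
    simp only [Finset.sum_insert ha]
    exact (hP a (by simp)).add (ih fun i hi => hP i (by simp [hi]))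

theorem IsDifferentiableFamily.prod {ι : Type*} (s : Finset ι) {P : ι → E → MvPolynomial σ ℂ}
    (hP : ∀ i ∈ s, IsDifferentiableFamily (P i)) :
    IsDifferentiableFamily fun p => ∏ i ∈ s, P i p := by
  classical
  induction s using Finset.induction_on with
  | empty => exact .const 1
  | insert a s ha ih =>
    simp only [Finset.prod_insert ha]
    exact (hP a (by simp)).mul (ih fun i hi => hP i (by simp [hi]))

theorem IsDifferentiableFamily.det {n : Type*} [Fintype n] [DecidableEq n]
    {M : E → Matrix n n (MvPolynomial σ ℂ)}
    (hM : ∀ i j, IsDifferentiableFamily fun p => M p i j) :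
    IsDifferentiableFamily fun p => (M p).det := by
  simp only [Matrix.det_apply']
  exact .sum _ fun τ _ => (IsDifferentiableFamily.const _).mul (.prod _ fun i _ => hM _ _)

/-- A linear functional passes through the finite sum, so no differentiation under an integral is
needed. -/
theorem IsDifferentiableFamily.differentiable {P : E → MvPolynomial σ ℂ}
    (hP : IsDifferentiableFamily P) (L : MvPolynomial σ ℂ →ₗ[ℂ] ℂ) :
    Differentiable ℂ fun p => L (P p) := by
  obtain ⟨r, a, A, ha, hA⟩ := hP
  simp only [hA, map_sum, map_smul, smul_eq_mul]
  exact Differentiable.fun_sum fun i _ => (ha i).mul_const _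

end FamiliesOfPolynomials

/-! ### The normalised correlation as a ratio of determinants. -/

section Correlation

open MvPolynomial

variable {k : ℕ}

/-- The product of characteristic polynomials as a polynomial in the entries of the Gaussian
matrix and their conjugates. -/
noncomputable def charPolyProductPoly (N : ℕ) (x y : Fin k → ℂ) :
    MvPolynomial ((Fin N × Fin N) ⊕ (Fin N × Fin N)) ℂ :=
  ∏ j, ((Matrix.of fun a b => C (Real.sqrt N : ℂ)⁻¹ * X (Sum.inl (a, b))) -
      Matrix.scalar (Fin N) (C (x j))).det *
    ((Matrix.of fun a b => C (Real.sqrt N : ℂ)⁻¹ * X (Sum.inr (b, a))) -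
      Matrix.scalar (Fin N) (C (y j))).det

theorem eval_charPolyProductPoly (N : ℕ) (x y : Fin k → ℂ) (g : Fin N → Fin N → ℂ) :
    eval (Sum.elim (fun a => g a.1 a.2) (fun a => conj (g a.1 a.2)))
      (charPolyProductPoly N x fun j => conj (y j)) = charPolyProduct N x y g := by
  rw [charPolyProductPoly, charPolyProduct, map_prod]
  refine Finset.prod_congr rfl fun j _ => ?_
  rw [map_mul, RingHom.map_det, RingHom.map_det]
  congr 2
  · ext a b
    by_cases h : a = b
    · subst h; simp [ginibreMatrix]
    · simp [ginibreMatrix, h]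
  · ext a b
    by_cases h : a = b
    · subst h; simp [ginibreMatrix]
    · simp [ginibreMatrix, h]

theorem integrable_charPolyProduct (N : ℕ) (x y : Fin k → ℂ) :
    Integrable (charPolyProduct N x y) (gaussianEntries N) :=
  (integrable_eval_gaussianEntries N (charPolyProductPoly N x fun j => conj (y j))).congr
    (Eventually.of_forall fun g => eval_charPolyProductPoly N x y g)

theorem charPolyCorrelation_eq_gaussianExpectation (N : ℕ) (x y : Fin k → ℂ) :
    charPolyCorrelation N x y =
      gaussianExpectation _ (charPolyProductPoly N x fun j => conj (y j)) := by
  rw [gaussianExpectation_eq_integral_gaussianEntries, charPolyCorrelation]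
  exact integral_congr_ae (Eventually.of_forall fun g => (eval_charPolyProductPoly N x y g).symm)

theorem differentiable_gaussianExpectation_charPolyProductPoly {E : Type*} [NormedAddCommGroup E]
    [NormedSpace ℂ E] (N : ℕ) (x y : E → Fin k → ℂ) (hx : ∀ j, Differentiable ℂ fun p => x p j)
    (hy : ∀ j, Differentiable ℂ fun p => y p j) :
    Differentiable ℂ fun p => gaussianExpectation _ (charPolyProductPoly N (x p) (y p)) := by
  refine IsDifferentiableFamily.differentiable (P := fun p => charPolyProductPoly N (x p) (y p))
    (.prod _ fun j _ => .mul (.det fun a b => ?_) (.det fun a b => ?_)) _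
  · simp only [Matrix.sub_apply, sub_eq_add_neg, Matrix.scalar_apply, Matrix.diagonal_apply]
    refine .add (.const _) ?_
    split_ifs
    · simp only [← map_neg C]
      exact .C (hx j).neg
    · exact .const _
  · simp only [Matrix.sub_apply, sub_eq_add_neg, Matrix.scalar_apply, Matrix.diagonal_apply]
    refine .add (.const _) ?_
    split_ifs
    · simp only [← map_neg C]
      exact .C (hy j).neg
    · exact .const _

theorem det_ginibreMatrix_sub (N : ℕ) (hN : 0 < N) (g : Fin N → Fin N → ℂ) (x : ℂ) :
    (ginibreMatrix N g - Matrix.scalar (Fin N) x).det = (-(Real.sqrt N : ℂ)⁻¹) ^ N *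
      (Matrix.scalar (Fin N) ((Real.sqrt N : ℂ) * x) - Matrix.of g).det := by
  have hq0 : (Real.sqrt N : ℂ) ≠ 0 :=
    Complex.ofReal_ne_zero.2 (Real.sqrt_pos.2 (Nat.cast_pos.2 hN)).ne'
  have h : ginibreMatrix N g - Matrix.scalar (Fin N) x = (-(Real.sqrt N : ℂ)⁻¹) •
      (Matrix.scalar (Fin N) ((Real.sqrt N : ℂ) * x) - Matrix.of g) := by
    ext a b
    by_cases h : a = b
    · subst h; simp [ginibreMatrix]; field_simp; ring
    · simp [ginibreMatrix, h]
  rw [h, Matrix.det_smul, Fintype.card_fin]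

theorem det_conjTranspose_ginibreMatrix_sub (N : ℕ) (hN : 0 < N) (g : Fin N → Fin N → ℂ) (x : ℂ) :
    ((ginibreMatrix N g).conjTranspose - Matrix.scalar (Fin N) x).det =
      (-(Real.sqrt N : ℂ)⁻¹) ^ N *
      (Matrix.scalar (Fin N) ((Real.sqrt N : ℂ) * x) - (Matrix.of g).conjTranspose).det := by
  have hq0 : (Real.sqrt N : ℂ) ≠ 0 :=
    Complex.ofReal_ne_zero.2 (Real.sqrt_pos.2 (Nat.cast_pos.2 hN)).ne'
  have h : (ginibreMatrix N g).conjTranspose - Matrix.scalar (Fin N) x =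
      (-(Real.sqrt N : ℂ)⁻¹) • (Matrix.scalar (Fin N) ((Real.sqrt N : ℂ) * x) -
        (Matrix.of g).conjTranspose) := by
    ext a b
    by_cases h : a = b
    · subst h; simp [ginibreMatrix]; field_simp; ring
    · simp [ginibreMatrix, h]
  rw [h, Matrix.det_smul, Fintype.card_fin]

theorem charPolyCorrelation_mul_vandermonde (N : ℕ) (hN : 0 < N) (x y : Fin k → ℂ)
    (hy : Function.Injective y) (hy0 : ∀ i, y i ≠ 0) :
    charPolyCorrelation N x y * ((Matrix.vandermonde fun j => (Real.sqrt N : ℂ) * x j).det *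
        (Matrix.vandermonde fun j => (Real.sqrt N : ℂ) * conj (y j)).det) =
      ((N : ℂ)⁻¹ ^ N) ^ k * ((∏ b : Fin k, ((N + b).factorial : ℂ)) *
        (Matrix.of fun i j => expPartialSum (N + k - 1)
          ((Real.sqrt N : ℂ) * x i * ((Real.sqrt N : ℂ) * conj (y j)))).det) := by
  have hq0 : (Real.sqrt N : ℂ) ≠ 0 :=
    Complex.ofReal_ne_zero.2 (Real.sqrt_pos.2 (Nat.cast_pos.2 hN)).ne'
  have hqN : (Real.sqrt N : ℂ) ^ 2 = N := by
    rw [← Complex.ofReal_pow, Real.sq_sqrt (Nat.cast_nonneg N)]; simp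
  have h := integral_prod_det_scalar_sub N (fun j => (Real.sqrt N : ℂ) * x j)
    (fun j => (Real.sqrt N : ℂ) * conj (y j))
    (fun a b hab => hy (star_injective (mul_left_cancel₀ hq0 hab)))
    (fun i => mul_ne_zero hq0 ((map_ne_zero _).2 (hy0 i)))
  rw [← h, ← mul_assoc (((N : ℂ)⁻¹ ^ N) ^ k), charPolyCorrelation, ← integral_const_mul]
  congr 1
  refine integral_congr_ae (Eventually.of_forall fun g => ?_)
  simp only [charPolyProduct, det_ginibreMatrix_sub N hN, det_conjTranspose_ginibreMatrix_sub N hN]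
  rw [Finset.prod_congr rfl fun j _ => mul_mul_mul_comm _ _ _ _, Finset.prod_mul_distrib,
    Finset.prod_const, Finset.card_univ, Fintype.card_fin, ← mul_pow, neg_mul_neg, ← sq, inv_pow,
    hqN]

/-- The `N`-dependent constant of the correlation functions at the edge. -/
noncomputable def edgeConstant (k N : ℕ) : ℂ :=
  ∏ b : Fin k, ((N + b).factorial : ℂ) * (N : ℂ) ^ (b.rev : ℕ) / ((N + k - 1).factorial : ℂ)

theorem tendsto_factorial_mul_pow_div (b d : ℕ) :
    Tendsto (fun N : ℕ => ((N + b).factorial : ℂ) * (N : ℂ) ^ d / ((N + b + d).factorial : ℂ))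
      atTop (𝓝 1) := by
  induction d with
  | zero =>
    refine tendsto_const_nhds.congr fun N => ?_
    simp [Nat.factorial_ne_zero]
  | succ d ih =>
    have h := ih.mul (tendsto_natCast_div_add_atTop (𝕜 := ℂ) ((b : ℂ) + d + 1))
    rw [mul_one] at h
    refine h.congr fun N => ?_
    rw [← add_assoc (N + b), Nat.factorial_succ]
    have h1 : ((N + b + d).factorial : ℂ) ≠ 0 := Nat.cast_ne_zero.2 (Nat.factorial_ne_zero _)
    have h2 : ((N : ℂ) + (b + d + 1)) ≠ 0 := by
      have : ((N + (b + d + 1) : ℕ) : ℂ) ≠ 0 := Nat.cast_ne_zero.2 (by omega)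
      exact_mod_cast this
    push_cast
    rw [show (N : ℂ) + b + d + 1 = N + (b + d + 1) by ring]
    field_simp
    ring

theorem tendsto_edgeConstant (k : ℕ) : Tendsto (edgeConstant k) atTop (𝓝 1) := by
  have h : Tendsto (fun N : ℕ => ∏ b : Fin k, ((N + b).factorial : ℂ) * (N : ℂ) ^ (b.rev : ℕ) /
      ((N + b + b.rev).factorial : ℂ)) atTop (𝓝 (∏ b : Fin k, 1)) :=
    tendsto_finsetProd _ fun b _ => tendsto_factorial_mul_pow_div b b.rev
  rw [Finset.prod_const_one] at h
  refine h.congr fun N => Finset.prod_congr rfl fun b _ => ?_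
  have := b.2
  rw [show N + (b : ℕ) + b.rev = N + k - 1 by rw [Fin.val_rev]; omega]

/-- The factor by which the correlation functions are divided at the edge, as a function of
`u` and `w`. -/
noncomputable def edgeNormalization (N : ℕ) (u w : Fin k → ℂ) : ℂ :=
  Complex.exp (-(∑ j, ((Real.sqrt N : ℂ) * (u j + w j) - ((u j) ^ 2 + (w j) ^ 2) / 2)) +
    (k : ℂ) ^ 2 / 2 * (Real.log N : ℂ))

/-- The normalised correlation functions at the edge, as functions of `u` and `w`. -/
noncomputable def edgeCorrelation (z : ℂ) (N : ℕ) (u w : Fin k → ℂ) : ℂ :=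
  gaussianExpectation _ (charPolyProductPoly N (fun j => edgePoint z N (u j))
    fun j => conj z - w j / (z * (Real.sqrt N : ℂ))) / edgeNormalization N u w

theorem edgeCorrelation_conj (z : ℂ) (N : ℕ) (u v : Fin k → ℂ) :
    edgeCorrelation z N u (fun j => conj (v j)) =
      charPolyCorrelation N (fun j => edgePoint z N (u j)) (fun j => edgePoint z N (v j)) /
        edgePrefactor N u v := by
  rw [charPolyCorrelation_eq_gaussianExpectation, edgeCorrelation]
  congr 4
  funext j
  simp [edgePoint]

/-- With `w` as a free variable in place of `conj v` no conjugation of a parameter remains, and the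
normalisation is a nonvanishing exponential. This is what makes the maximum modulus principle
available. -/
theorem differentiable_edgeCorrelation (z : ℂ) (N : ℕ) :
    Differentiable ℂ fun p : (Fin k → ℂ) × (Fin k → ℂ) => edgeCorrelation z N p.1 p.2 := by
  have h3 : Differentiable ℂ fun p : (Fin k → ℂ) × (Fin k → ℂ) => edgeNormalization N p.1 p.2 := by
    unfold edgeNormalization
    fun_prop
  have h4 (p : (Fin k → ℂ) × (Fin k → ℂ)) : edgeNormalization N p.1 p.2 ≠ 0 :=
    Complex.exp_ne_zero _
  have h5 : Differentiable ℂ fun p : (Fin k → ℂ) × (Fin k → ℂ) =>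
      (edgeNormalization N p.1 p.2)⁻¹ := fun p => (h3 p).inv (h4 p)
  simp only [edgeCorrelation, div_eq_mul_inv (gaussianExpectation _ _)]
  exact (differentiable_gaussianExpectation_charPolyProductPoly N
    (fun (p : (Fin k → ℂ) × (Fin k → ℂ)) j => edgePoint z N (p.1 j))
    (fun p j => conj z - p.2 j / (z * (Real.sqrt N : ℂ)))
    (fun j => by simp only [edgePoint]; fun_prop) fun j => by fun_prop).mul h5

theorem exp_sq_div_two_mul_log (k N : ℕ) (hN : 0 < N) :
    Complex.exp ((k : ℂ) ^ 2 / 2 * (Real.log N : ℂ)) = (Real.sqrt N : ℂ) ^ (k ^ 2) := by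
  have hN' : (0 : ℝ) < N := Nat.cast_pos.2 hN
  have h1 : Real.log N = 2 * Real.log (Real.sqrt N) := by
    rw [Real.log_sqrt hN'.le]; ring
  have h2 : (Real.sqrt N : ℂ) = Complex.exp (Real.log (Real.sqrt N) : ℂ) := by
    rw [← Complex.ofReal_exp, Real.exp_log (Real.sqrt_pos.2 hN')]
  rw [h1]
  conv_rhs => rw [h2]
  rw [← Complex.exp_nat_mul]
  congr 1
  push_cast
  ring

/-- The divergent factors split into one depending on `u` and one depending on `w`, so they can be
taken out of the rows and columns of a determinant. -/
theorem expPartialSum_eq_edgeKernel (m N : ℕ) (hN : 0 < N) (u w : ℂ) :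
    expPartialSum (N + m) ((Real.sqrt N : ℂ) ^ 2 *
        ((1 - u / (Real.sqrt N : ℂ)) * (1 - w / (Real.sqrt N : ℂ)))) =
      Complex.exp (u ^ 2 / 2 - (Real.sqrt N : ℂ) * u) *
        ((Real.sqrt N : ℂ) ^ (2 * (N + m) + 1) / ((N + m).factorial : ℂ) *
          Complex.exp (w ^ 2 / 2 - (Real.sqrt N : ℂ) * w) * edgeKernel m N u w) := by
  have hf := Nat.cast_ne_zero (R := ℂ).2 (N + m).factorial_ne_zero
  have h := integral_rescaled_add_pow_mul_exp_neg (N + m)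
    ((1 - u / (Real.sqrt N : ℂ)) * (1 - w / (Real.sqrt N : ℂ))) (Real.sqrt N)
    (Real.sqrt_pos.2 (Nat.cast_pos.2 hN))
  have h2 : ∫ t in Set.Ioi (0 : ℝ), edgeIntegrand m N u w t =
      Complex.exp ((Real.sqrt N : ℂ) * (u + w)) * ∫ t in Set.Ioi (0 : ℝ),
        ((1 - u / (Real.sqrt N : ℂ)) * (1 - w / (Real.sqrt N : ℂ)) + t / (Real.sqrt N : ℂ)) ^
          (N + m) * Complex.exp (-((Real.sqrt N : ℂ) * t)) := by
    rw [← integral_const_mul]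
    refine setIntegral_congr_fun measurableSet_Ioi fun t _ => ?_
    simp only [edgeIntegrand]
    rw [sub_eq_add_neg (_ * _), Complex.exp_add]
    ring
  have h3 : Complex.exp (u ^ 2 / 2 - (Real.sqrt N : ℂ) * u) *
      Complex.exp (w ^ 2 / 2 - (Real.sqrt N : ℂ) * w) * Complex.exp (-((u ^ 2 + w ^ 2) / 2)) *
      Complex.exp ((Real.sqrt N : ℂ) * (u + w)) = 1 := by
    rw [← Complex.exp_add, ← Complex.exp_add, ← Complex.exp_add, ← Complex.exp_zero]
    congr 1
    ring
  rw [← mul_right_inj' hf, ← h, edgeKernel, h2]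
  set I := ∫ t in Set.Ioi (0 : ℝ),
    ((1 - u / (Real.sqrt N : ℂ)) * (1 - w / (Real.sqrt N : ℂ)) + t / (Real.sqrt N : ℂ)) ^
      (N + m) * Complex.exp (-((Real.sqrt N : ℂ) * t))
  linear_combination (-(((N + m).factorial : ℂ) * ((N + m).factorial : ℂ)⁻¹ *
    (Real.sqrt N : ℂ) ^ (2 * (N + m) + 1) * I)) * h3 -
    ((Real.sqrt N : ℂ) ^ (2 * (N + m) + 1) * I) * mul_inv_cancel₀ hf

/-- The normalised correlation functions at the edge as a ratio of determinants. -/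
theorem edgeCorrelation_mul_vandermonde (z : ℂ) (hz : ‖z‖ = 1) (N : ℕ) (hN : 0 < N)
    (u w : Fin k → ℂ) (hw : Function.Injective w) (hw0 : ∀ j, w j ≠ (Real.sqrt N : ℂ)) :
    edgeCorrelation z N u w * ((Matrix.vandermonde u).det * (Matrix.vandermonde w).det) =
      edgeConstant k N * (Matrix.of fun i j => edgeKernel (k - 1) N (u i) (w j)).det := by
  have hq0 : (Real.sqrt N : ℂ) ≠ 0 :=
    Complex.ofReal_ne_zero.2 (Real.sqrt_pos.2 (Nat.cast_pos.2 hN)).ne'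
  have hqN : (Real.sqrt N : ℂ) ^ 2 = N := by
    rw [← Complex.ofReal_pow, Real.sq_sqrt (Nat.cast_nonneg N)]; simp
  have hzz : z * conj z = 1 := by rw [Complex.mul_conj, Complex.normSq_eq_norm_sq, hz]; simp
  have hz0 : z ≠ 0 := fun h => by simp [h] at hz
  have hz0' : conj z ≠ 0 := (map_ne_zero _).2 hz0
  obtain ⟨v, rfl⟩ : ∃ v : Fin k → ℂ, w = fun j => conj (v j) := ⟨fun j => conj (w j), by simp⟩
  set q : ℂ := (Real.sqrt N : ℂ) with hq
  have hqc : conj q = q := Complex.conj_ofReal _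
  -- Since `|z| = 1`, the rescaled points are `z(√N - a)`; the phase cancels against its conjugate
  -- in the kernel and in the product of Vandermonde determinants.
  have hX (a : ℂ) : q * edgePoint z N a = z * (q - a) := by
    rw [edgePoint, ← hq]
    field_simp
    linear_combination a * hzz
  have hY (a : ℂ) : q * conj (edgePoint z N a) = conj z * (q - conj a) := by
    rw [← hqc, ← map_mul, hqc, hX, map_mul, map_sub, hqc]
  have hv : Function.Injective v := fun a b hab => hw (by simp [hab])
  have h := charPolyCorrelation_mul_vandermonde N hN (fun j => edgePoint z N (u j))
    (fun j => edgePoint z N (v j)) (fun a b hab => hv (by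
      have := congrArg (fun c => q * c) hab
      simp only [hX] at this
      exact sub_right_injective (mul_left_cancel₀ hz0 this)))
    (fun j hj => hw0 j (by
      have := hX (v j)
      rw [hj, mul_zero, eq_comm, mul_eq_zero, or_iff_right hz0, sub_eq_zero] at this
      simp only [← this, hqc]))
  have hVV : (Matrix.vandermonde fun j => q * edgePoint z N (u j)).det *
      (Matrix.vandermonde fun j => q * conj (edgePoint z N (v j))).det =
      (Matrix.vandermonde u).det * (Matrix.vandermonde fun j => conj (v j)).det := by
    simp only [hX, hY, Matrix.det_vandermonde]
    rw [← Finset.prod_mul_distrib, ← Finset.prod_mul_distrib]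
    refine Finset.prod_congr rfl fun i _ => ?_
    rw [← Finset.prod_mul_distrib, ← Finset.prod_mul_distrib]
    refine Finset.prod_congr rfl fun j _ => ?_
    linear_combination (u i - u j) * (conj (v i) - conj (v j)) * hzz
  have hM : (Matrix.of fun i j => expPartialSum (N + k - 1)
      (q * edgePoint z N (u i) * (q * conj (edgePoint z N (v j))))) =
      Matrix.of fun i j => Complex.exp (u i ^ 2 / 2 - q * u i) *
        (Matrix.of fun i j => (q ^ (2 * (N + (k - 1)) + 1) / ((N + (k - 1)).factorial : ℂ) *
          Complex.exp (conj (v j) ^ 2 / 2 - q * conj (v j))) *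
            (Matrix.of fun i j => edgeKernel (k - 1) N (u i) (conj (v j))) i j) i j := by
    ext i j
    have hi := i.2
    simp only [Matrix.of_apply]
    rw [hX, hY, show N + k - 1 = N + (k - 1) by omega, ← expPartialSum_eq_edgeKernel (k - 1) N hN]
    congr 1
    rw [← hq]
    field_simp
    linear_combination (q - u i) * (q - conj (v j)) * hzz
  have hpow : ∏ b : Fin k, (N : ℂ) ^ (b.rev : ℕ) = q ^ (k * (k - 1)) := by
    have hrev : ∑ b : Fin k, (b.rev : ℕ) = ∑ b : Fin k, (b : ℕ) :=
      Equiv.sum_comp Fin.revPerm fun b : Fin k => (b : ℕ)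
    rw [Finset.prod_pow_eq_pow_sum, ← hqN, ← pow_mul, hrev, Fin.sum_univ_eq_sum_range fun b => b, mul_comm, Finset.sum_range_id_mul_two]
  -- Power count in `√N`: `k(2(N+k-1)+1) - 2Nk = k(k-1) + k²`. The part `k(k-1)` goes into
  -- `edgeConstant`, and `k²` is the exponent of the prefactor. The case `k = 0` is separate because
  -- `k - 1` truncates.
  have hpow2 : ((N : ℂ)⁻¹ ^ N) ^ k * (q ^ (2 * (N + (k - 1)) + 1)) ^ k =
      q ^ (k * (k - 1)) * q ^ (k ^ 2) := by
    rw [← hqN, inv_pow, inv_pow, inv_mul_eq_iff_eq_mul₀ (by simp [hq0])]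
    rw [← pow_mul, ← pow_mul, ← pow_mul, ← pow_add, ← pow_add]
    congr 1
    rcases k with _ | k
    · simp
    · simp only [Nat.add_sub_cancel]; ring
  have hnorm : edgePrefactor N u v = (∏ j, Complex.exp (u j ^ 2 / 2 - q * u j)) *
      (∏ j, Complex.exp (conj (v j) ^ 2 / 2 - q * conj (v j))) * q ^ (k ^ 2) := by
    rw [edgePrefactor, Complex.exp_add, exp_sq_div_two_mul_log k N hN, ← Complex.exp_sum,
      ← Complex.exp_sum, ← Complex.exp_add, ← Finset.sum_add_distrib, ← Finset.sum_neg_distrib]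
    congr 3
    funext j
    ring
  have hconst : edgeConstant k N = (∏ b : Fin k, ((N + b).factorial : ℂ)) * q ^ (k * (k - 1)) /
      ((N + (k - 1)).factorial : ℂ) ^ k := by
    rw [← hpow, edgeConstant, Finset.prod_div_distrib, Finset.prod_mul_distrib, Finset.prod_const,
      Finset.card_univ, Fintype.card_fin]
    rcases k with _ | k
    · simp
    · rfl
  rw [hVV, hM, Matrix.det_mul_column, Matrix.det_mul_row, Finset.prod_mul_distrib,
    Finset.prod_const, Finset.card_univ, Fintype.card_fin, div_pow] at h
  rw [edgeCorrelation_conj, div_mul_eq_mul_div, div_eq_iff (show edgePrefactor N u v ≠ 0 from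
    Complex.exp_ne_zero _), h, hnorm,
    hconst]
  linear_combination (∏ b : Fin k, ((N + b).factorial : ℂ)) *
    (∏ j, Complex.exp (u j ^ 2 / 2 - q * u j)) *
      (∏ j, Complex.exp (conj (v j) ^ 2 / 2 - q * conj (v j))) *
    (Matrix.of fun i j => edgeKernel (k - 1) N (u i) (conj (v j))).det /
    ((N + (k - 1)).factorial : ℂ) ^ k * hpow2

end Correlation

/-! ### Maximum modulus on polydiscs. -/

section MaximumModulus

variable {ι : Type*} [Fintype ι]

/-- The maximum modulus principle on a polydisc: a bound on the distinguished boundary is a bound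
on the polydisc. -/
theorem norm_le_of_forall_norm_eq (f : (ι → ℂ) → ℂ) (hf : Differentiable ℂ f) (r : ι → ℝ)
    (hr : ∀ i, 0 < r i) (C : ℝ) (hC : ∀ x : ι → ℂ, (∀ i, ‖x i‖ = r i) → ‖f x‖ ≤ C) (x : ι → ℂ)
    (hx : ∀ i, ‖x i‖ ≤ r i) : ‖f x‖ ≤ C := by
  classical
  have key (s : Finset ι) : ∀ x : ι → ℂ, (∀ i ∈ s, ‖x i‖ ≤ r i) → (∀ i ∉ s, ‖x i‖ = r i) →
      ‖f x‖ ≤ C := by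
    induction s using Finset.induction_on with
    | empty => exact fun x _ hx => hC x fun i => hx i (by simp)
    | insert a s ha ih =>
      intro x hx hx'
      have hd : Differentiable ℂ fun t : ℂ => f (Function.update x a t) :=
        hf.comp fun t => (hasFDerivAt_update x t).differentiableAt
      have h := Complex.norm_le_of_forall_mem_frontier_norm_le (U := Metric.ball (0 : ℂ) (r a))
        (f := fun t : ℂ => f (Function.update x a t)) Metric.isBounded_ball hd.diffContOnCl (C := C)
        (fun t ht => ?_) (z := x a) ?_
      · simpa using h
      · rw [frontier_ball _ (hr a).ne', mem_sphere_zero_iff_norm] at ht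
        refine ih _ (fun i hi => ?_) fun i hi => ?_
        · rw [Function.update_of_ne (ne_of_mem_of_not_mem hi ha)]
          exact hx i (Finset.mem_insert_of_mem hi)
        · by_cases h : i = a
          · subst h; simpa using ht
          · rw [Function.update_of_ne h]
            exact hx' i (by simp [h, hi])
      · rw [closure_ball _ (hr a).ne', mem_closedBall_zero_iff]
        exact hx a (Finset.mem_insert_self a s)
  exact key Finset.univ x (fun i _ => hx i) (by simp)

theorem norm_le_of_forall_norm_eq_prod (F : (ι → ℂ) → (ι → ℂ) → ℂ)
    (hF : Differentiable ℂ fun p : (ι → ℂ) × (ι → ℂ) => F p.1 p.2) (r : ι → ℝ)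
    (hr : ∀ i, 0 < r i) (C : ℝ) (hC : ∀ u w : ι → ℂ, (∀ i, ‖u i‖ = r i) → (∀ i, ‖w i‖ = r i) →
      ‖F u w‖ ≤ C) (u w : ι → ℂ) (hu : ∀ i, ‖u i‖ ≤ r i) (hw : ∀ i, ‖w i‖ ≤ r i) :
    ‖F u w‖ ≤ C := by
  have h3 (w : ι → ℂ) : Differentiable ℂ fun u => F u w :=
    hF.comp (differentiable_id.prodMk (differentiable_const w))
  have h4 (u : ι → ℂ) : Differentiable ℂ fun w => F u w :=
    hF.comp ((differentiable_const u).prodMk differentiable_id)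
  refine norm_le_of_forall_norm_eq (fun u => F u w) (h3 w) r hr C (fun u hu => ?_) u hu
  exact norm_le_of_forall_norm_eq (F u) (h4 u) r hr C (fun w hw => hC u w hu hw) w hw

end MaximumModulus

/-! ### Separated tori and density of nondegenerate pairs. -/

section Degeneracies

variable {k : ℕ}

/-- The moduli differ by at least one, hence so do the points, and every factor has modulus at least
one. -/
theorem one_le_norm_det_vandermonde (r : ℝ) (u : Fin k → ℂ)
    (hu : ∀ i, ‖u i‖ = r + (i : ℕ)) : 1 ≤ ‖(Matrix.vandermonde u).det‖ := by
  have hmul (a b : ℝ) (ha : 1 ≤ a) (hb : 1 ≤ b) : 1 ≤ a * b := one_le_mul_of_one_le_of_one_le ha hb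
  rw [Matrix.det_vandermonde, norm_prod]
  refine Finset.prod_induction _ (fun x : ℝ => 1 ≤ x) hmul le_rfl fun i _ => ?_
  rw [norm_prod]
  refine Finset.prod_induction _ (fun x : ℝ => 1 ≤ x) hmul le_rfl fun j hj => ?_
  have h1 := norm_sub_norm_le (u j) (u i)
  rw [hu, hu] at h1
  have h2 : ((i : ℕ) : ℝ) + 1 ≤ (j : ℕ) := by
    have : i < j := Finset.mem_Ioi.1 hj
    have : (i : ℕ) < j := this
    exact_mod_cast this
  linarith

/-- Shift both vectors by `t(0, 1, 2, …)`: two entries collide for only finitely many nonzero `t`.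
-/
theorem mem_closure_nondegeneratePairs (p : (Fin k → ℂ) × (Fin k → ℂ)) :
    p ∈ closure (nondegeneratePairs k) := by
  set e : Fin k → ℂ := fun i => (i : ℕ) with he
  have hinj (u : Fin k → ℂ) : ∀ᶠ t : ℂ in 𝓝[≠] 0, Function.Injective (u + t • e) := by
    have hfin : (Set.range fun q : Fin k × Fin k => (u q.1 - u q.2) / (e q.2 - e q.1)).Finite :=
      Set.finite_range _
    have h1 : ∀ᶠ t : ℂ in 𝓝[≠] 0, t ∉
        (Set.range fun q : Fin k × Fin k => (u q.1 - u q.2) / (e q.2 - e q.1)) \ {0} := by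
      refine mem_nhdsWithin_of_mem_nhds ?_
      exact (hfin.subset Set.sdiff_subset).isClosed.isOpen_compl.mem_nhds (by simp)
    filter_upwards [h1, self_mem_nhdsWithin] with t ht ht0 a b hab
    by_contra hne
    refine ht ⟨⟨(a, b), ?_⟩, ht0⟩
    have hne' : e b - e a ≠ 0 := by
      rw [sub_ne_zero, he]
      simp only [ne_eq, Nat.cast_inj]
      exact fun h => hne (Fin.ext h).symm
    simp only [Pi.add_apply, Pi.smul_apply, smul_eq_mul] at hab
    rw [div_eq_iff hne']
    linear_combination hab
  have hcont : Tendsto (fun t : ℂ => (p.1 + t • e, p.2 + t • e)) (𝓝[≠] 0) (𝓝 p) := by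
    have : Continuous fun t : ℂ => (p.1 + t • e, p.2 + t • e) := by fun_prop
    simpa using (this.tendsto 0).mono_left nhdsWithin_le_nhds
  refine mem_closure_of_tendsto hcont ?_
  filter_upwards [hinj p.1, hinj p.2] with t h1 h2 using ⟨h1, h2⟩

end Degeneracies

/-! ### Extending pointwise limits from a dense set. -/

section EquiLipschitz

variable {E : Type*} [PseudoMetricSpace E]

/-- A locally equi-Lipschitz sequence of functions which converges pointwise on a dense set to `g`
converges everywhere, and its limit is the limit of `g`. -/
theorem exists_tendsto_of_locally_equiLipschitz (f : ℕ → E → ℂ) (g : E → ℂ) (S : Set E)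
    (hS : ∀ p, p ∈ closure S) (hg : ∀ p ∈ S, Tendsto (fun N => f N p) atTop (𝓝 (g p)))
    (hf : ∀ p, ∃ r > 0, ∃ L : ℝ, ∀ᶠ N in atTop, ∀ q ∈ Metric.ball p r,
      dist (f N q) (f N p) ≤ L * dist q p) (p : E) :
    ∃ l : ℂ, Tendsto (fun N => f N p) atTop (𝓝 l) ∧ Tendsto g (𝓝[S] p) (𝓝 l) := by
  obtain ⟨r, hr, L, hL⟩ := hf p
  have hM : 0 < max L 1 := lt_of_lt_of_le one_pos (le_max_right _ _)
  have hL' : ∀ᶠ N in atTop, ∀ q ∈ Metric.ball p r, dist (f N q) (f N p) ≤ max L 1 * dist q p := by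
    filter_upwards [hL] with N h q hq
    exact (h q hq).trans (mul_le_mul_of_nonneg_right (le_max_left _ _) dist_nonneg)
  have hcauchy : CauchySeq fun N => f N p := by
    rw [Metric.cauchySeq_iff]
    intro ε hε
    obtain ⟨q, hqS, hq⟩ := Metric.mem_closure_iff.1 (hS p) (min r (ε / 4 / max L 1))
      (lt_min hr (by positivity))
    rw [dist_comm, lt_min_iff, lt_div_iff₀' hM] at hq
    obtain ⟨N0, hN0⟩ := eventually_atTop.1 hL'
    obtain ⟨N1, hN1⟩ := Metric.cauchySeq_iff.1 (hg q hqS).cauchySeq (ε / 4) (by positivity)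
    refine ⟨max N0 N1, fun a ha b hb => ?_⟩
    have h1 := hN0 a (le_of_max_le_left ha) q hq.1
    have h2 := hN0 b (le_of_max_le_left hb) q hq.1
    have h3 := hN1 a (le_of_max_le_right ha) b (le_of_max_le_right hb)
    have h4 := dist_triangle4 (f a p) (f a q) (f b q) (f b p)
    rw [dist_comm (f a p) (f a q)] at h4
    linarith [hq.2]
  obtain ⟨l, hl⟩ := cauchySeq_tendsto_of_complete hcauchy
  refine ⟨l, hl, ?_⟩
  rw [Metric.tendsto_nhdsWithin_nhds]
  intro ε hε
  refine ⟨min r (ε / max L 1), lt_min hr (by positivity), fun {q} hqS hq => ?_⟩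
  rw [lt_min_iff, lt_div_iff₀' hM] at hq
  refine lt_of_le_of_lt ?_ hq.2
  refine le_of_tendsto ((hg q hqS).dist hl) ?_
  filter_upwards [hL'] with N h using h q hq.1

end EquiLipschitz

/-! ### Uniform bounds and limits of the normalised correlations. -/

section EdgeLimit

variable {k : ℕ}

theorem norm_edgeCorrelation_le (z : ℂ) (hz : ‖z‖ = 1) (N : ℕ) (hN : 0 < N) (u w : Fin k → ℂ)
    (hw : Function.Injective w) (hw0 : ∀ j, w j ≠ (Real.sqrt N : ℂ)) (C : ℝ)
    (hC : ∀ i j, ‖edgeKernel (k - 1) N (u i) (w j)‖ ≤ C)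
    (h8 : 1 ≤ ‖(Matrix.vandermonde u).det‖) (h9 : 1 ≤ ‖(Matrix.vandermonde w).det‖) :
    ‖edgeCorrelation z N u w‖ ≤ ‖edgeConstant k N‖ * (k.factorial * C ^ k) := by
  have h7 : ‖(Matrix.of fun i j => edgeKernel (k - 1) N (u i) (w j)).det‖ ≤
      k.factorial * C ^ k := by
    have := Matrix.det_le (abv := NormedField.toAbsoluteValue ℂ)
      (A := Matrix.of fun i j => edgeKernel (k - 1) N (u i) (w j)) (x := C) hC
    rw [Fintype.card_fin, nsmul_eq_mul] at this
    exact this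
  calc ‖edgeCorrelation z N u w‖ ≤ ‖edgeCorrelation z N u w‖ *
        (‖(Matrix.vandermonde u).det‖ * ‖(Matrix.vandermonde w).det‖) :=
        le_mul_of_one_le_right (norm_nonneg _) (one_le_mul_of_one_le_of_one_le h8 h9)
    _ = ‖edgeConstant k N‖ *
        ‖(Matrix.of fun i j => edgeKernel (k - 1) N (u i) (w j)).det‖ := by
        rw [← norm_mul, ← norm_mul, edgeCorrelation_mul_vandermonde z hz N hN u w hw hw0, norm_mul]
    _ ≤ _ := mul_le_mul_of_nonneg_left h7 (norm_nonneg _)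

theorem norm_edgeCorrelation_le_of_polydisc (z : ℂ) (N : ℕ) (r : Fin k → ℝ) (hr : ∀ i, 0 < r i)
    (C : ℝ) (hC : ∀ u w : Fin k → ℂ, (∀ i, ‖u i‖ = r i) → (∀ i, ‖w i‖ = r i) →
      ‖edgeCorrelation z N u w‖ ≤ C) (u w : Fin k → ℂ) (hu : ∀ i, ‖u i‖ ≤ r i)
    (hw : ∀ i, ‖w i‖ ≤ r i) : ‖edgeCorrelation z N u w‖ ≤ C := by
  exact norm_le_of_forall_norm_eq_prod (edgeCorrelation z N) (differentiable_edgeCorrelation z N)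
    r hr C hC u w hu hw

/-- Division by Vandermonde determinants costs nothing on the torus of radii `R + 1 + i`, and the
maximum modulus principle then covers the degenerate points inside. -/
theorem eventually_norm_edgeCorrelation_le (z : ℂ) (hz : ‖z‖ = 1) (k : ℕ) (R : ℝ) (hR : 0 ≤ R) :
    ∃ C : ℝ, ∀ᶠ N in atTop, ∀ u w : Fin k → ℂ, (∀ i, ‖u i‖ ≤ R) → (∀ i, ‖w i‖ ≤ R) →
      ‖edgeCorrelation z N u w‖ ≤ C := by
  -- The radius `R + 1 + k` exceeds every torus radius. In the final bound, `2` dominates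
  -- `edgeConstant`, which tends to one.
  obtain ⟨C, hC⟩ := exists_norm_edgeKernel_le (k - 1) (R + 1 + k)
  refine ⟨2 * (k.factorial * (max C 0) ^ k), ?_⟩
  have hsqrt := Real.tendsto_sqrt_atTop.comp (tendsto_natCast_atTop_atTop (R := ℝ))
  have hconst : ∀ᶠ N in atTop, ‖edgeConstant k N‖ < 2 :=
    (tendsto_edgeConstant k).norm.eventually_lt_const (by simp)
  have hs1 : ∀ᶠ N : ℕ in atTop, ((k - 1 : ℕ) : ℝ) + 1 ≤ Real.sqrt N :=
    hsqrt.eventually_ge_atTop _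
  have hs2 : ∀ᶠ N : ℕ in atTop, R + 1 + k < Real.sqrt N := hsqrt.eventually_gt_atTop _
  filter_upwards [hs1, hs2, hconst, eventually_gt_atTop 0] with N h1 h2 h3 hN u w hu hw
  have hi0 (i : Fin k) : (0 : ℝ) ≤ (i : ℕ) := Nat.cast_nonneg _
  have hrk (i : Fin k) : R + 1 + (i : ℕ) ≤ R + 1 + k := by
    have : ((i : ℕ) : ℝ) ≤ k := Nat.cast_le.2 i.2.le
    linarith
  refine norm_edgeCorrelation_le_of_polydisc z N (fun i => R + 1 + (i : ℕ))
    (fun i => by linarith [hi0 i]) _ (fun u w hu hw => ?_) u w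
    (fun i => (hu i).trans (by linarith [hi0 i])) fun i => (hw i).trans (by linarith [hi0 i])
  have hinj : Function.Injective w := by
    intro a b hab
    have : ((a : ℕ) : ℝ) = (b : ℕ) := by
      have := congrArg norm hab
      rw [hw, hw] at this
      linarith
    exact Fin.ext (Nat.cast_injective this)
  refine (norm_edgeCorrelation_le z hz N hN u w hinj (fun j hj => ?_) (max C 0) (fun i j => ?_)
    (one_le_norm_det_vandermonde (R + 1) u hu) (one_le_norm_det_vandermonde (R + 1) w hw)).trans
    (mul_le_mul_of_nonneg_right h3.le (by positivity))
  · have h5 := congrArg norm hj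
    rw [hw, Complex.norm_real, Real.norm_of_nonneg (Real.sqrt_nonneg _)] at h5
    linarith [hrk j]
  · exact (hC N h1 _ _ ((hu i).trans_le (hrk i)) ((hw j).trans_le (hrk j))).trans (le_max_left _ _)

/-- A Schwarz estimate on the unit ball around `p`, with a bound independent of `N`. -/
theorem edgeCorrelation_locally_equiLipschitz (z : ℂ) (hz : ‖z‖ = 1)
    (p : (Fin k → ℂ) × (Fin k → ℂ)) : ∃ r > 0, ∃ L : ℝ, ∀ᶠ N in atTop, ∀ q ∈ Metric.ball p r,
      dist (edgeCorrelation z N q.1 q.2) (edgeCorrelation z N p.1 p.2) ≤ L * dist q p := by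
  obtain ⟨C, hC⟩ := eventually_norm_edgeCorrelation_le z hz k (‖p‖ + 1) (by positivity)
  refine ⟨1, one_pos, (C + C) / 1, ?_⟩
  filter_upwards [hC] with N h q hq
  have hb (q : (Fin k → ℂ) × (Fin k → ℂ)) (hq : q ∈ Metric.ball p 1) :
      ‖edgeCorrelation z N q.1 q.2‖ ≤ C := by
    have h1 : ‖q‖ ≤ ‖p‖ + 1 := by
      have h2 := norm_le_norm_add_norm_sub p q
      have h3 := mem_ball_iff_norm.1 hq
      rw [← norm_neg, neg_sub] at h3
      linarith
    exact h _ _ (fun i => ((norm_le_pi_norm q.1 i).trans (norm_fst_le q)).trans h1)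
      fun i => ((norm_le_pi_norm q.2 i).trans (norm_snd_le q)).trans h1
  refine Complex.dist_le_div_mul_dist_of_mapsTo_ball
    (f := fun q : (Fin k → ℂ) × (Fin k → ℂ) => edgeCorrelation z N q.1 q.2)
    (differentiable_edgeCorrelation z N).differentiableOn (fun q hq => ?_) hq
  rw [Metric.mem_closedBall]
  refine (dist_le_norm_add_norm _ _).trans (add_le_add (hb q hq) (hb p (Metric.mem_ball_self one_pos)))

/-- The limit of the normalised correlation functions at pairs without degeneracies. -/
theorem tendsto_edgeCorrelation_of_injective (z : ℂ) (hz : ‖z‖ = 1) (u w : Fin k → ℂ)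
    (hu : Function.Injective u) (hw : Function.Injective w) :
    Tendsto (fun N => edgeCorrelation z N u w) atTop
      (𝓝 ((Matrix.of fun i j => edgeLimitKernel (u i) (w j)).det /
        ((Matrix.vandermonde u).det * (Matrix.vandermonde w).det))) := by
  have hV : (Matrix.vandermonde u).det * (Matrix.vandermonde w).det ≠ 0 :=
    mul_ne_zero (Matrix.det_vandermonde_ne_zero_iff.2 hu) (Matrix.det_vandermonde_ne_zero_iff.2 hw)
  have hdet : Tendsto (fun N => (Matrix.of fun i j => edgeKernel (k - 1) N (u i) (w j)).det) atTop
      (𝓝 (Matrix.of fun i j => edgeLimitKernel (u i) (w j)).det) := by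
    simp only [Matrix.det_apply']
    refine tendsto_finsetSum _ fun σ _ => Tendsto.const_mul _ (tendsto_finsetProd _ fun i _ => ?_)
    exact tendsto_edgeKernel _ _ _
  have h := ((tendsto_edgeConstant k).mul hdet).div_const
    ((Matrix.vandermonde u).det * (Matrix.vandermonde w).det)
  rw [one_mul] at h
  refine h.congr' ?_
  have hsqrt := Real.tendsto_sqrt_atTop.comp (tendsto_natCast_atTop_atTop (R := ℝ))
  filter_upwards [hsqrt.eventually_gt_atTop ‖w‖, eventually_gt_atTop 0] with N h1 hN
  rw [div_eq_iff hV, edgeCorrelation_mul_vandermonde z hz N hN u w hw]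
  intro j hj
  have h5 := norm_le_pi_norm w j
  rw [hj, Complex.norm_real, Real.norm_of_nonneg (Real.sqrt_nonneg _)] at h5
  exact absurd h1 (not_lt.2 h5)

end EdgeLimit

/-! ### Andréief's identity. -/

section Andreief

variable {α : Type*} [MeasurableSpace α] (μ : Measure α) [SigmaFinite μ] {k : ℕ}

omit [MeasurableSpace α] in
theorem det_mul_det_eq_sum (f g : Fin k → α → ℂ) (s : Fin k → α) :
    (Matrix.of fun i j => f i (s j)).det * (Matrix.of fun i j => g j (s i)).det =
      ∑ σ : Equiv.Perm (Fin k), ∑ τ : Equiv.Perm (Fin k),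
        ((Equiv.Perm.sign σ : ℤ) : ℂ) * ((Equiv.Perm.sign τ : ℤ) : ℂ) *
          ∏ i, f (σ i) (s i) * g (τ i) (s i) := by
  rw [← Matrix.det_transpose (Matrix.of fun i j => g j (s i)), Matrix.det_apply', Matrix.det_apply',
    Finset.sum_mul_sum]
  refine Finset.sum_congr rfl fun σ _ => Finset.sum_congr rfl fun τ _ => ?_
  rw [Finset.prod_mul_distrib]
  simp only [Matrix.of_apply, Matrix.transpose_apply]
  ring

theorem integrable_det_mul_det (f g : Fin k → α → ℂ)
    (h : ∀ i j, Integrable (fun a => f i a * g j a) μ) :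
    Integrable (fun s : Fin k → α => (Matrix.of fun i j => f i (s j)).det *
      (Matrix.of fun i j => g j (s i)).det) (Measure.pi fun _ => μ) := by
  simp only [det_mul_det_eq_sum]
  refine integrable_finsetSum _ fun σ _ => integrable_finsetSum _ fun τ _ => Integrable.const_mul ?_ _
  exact Integrable.fintype_prod (f := fun i a => f (σ i) a * g (τ i) a) fun i => h _ _

/-- Andréief's identity. -/
theorem integral_det_mul_det (f g : Fin k → α → ℂ)
    (h : ∀ i j, Integrable (fun a => f i a * g j a) μ) :
    ∫ s : Fin k → α, (Matrix.of fun i j => f i (s j)).det *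
      (Matrix.of fun i j => g j (s i)).det ∂(Measure.pi fun _ => μ) =
      k.factorial * (Matrix.of fun i j => ∫ a, f i a * g j a ∂μ).det := by
  set M : Matrix (Fin k) (Fin k) ℂ := Matrix.of fun i j => ∫ a, f i a * g j a ∂μ with hM
  have hint (σ τ : Equiv.Perm (Fin k)) : Integrable (fun s : Fin k → α =>
      ((Equiv.Perm.sign σ : ℤ) : ℂ) * ((Equiv.Perm.sign τ : ℤ) : ℂ) *
        ∏ i, f (σ i) (s i) * g (τ i) (s i)) (Measure.pi fun _ => μ) :=
    (Integrable.fintype_prod (f := fun i a => f (σ i) a * g (τ i) a) fun i => h _ _).const_mul _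
  simp only [det_mul_det_eq_sum]
  rw [integral_finsetSum _ fun σ _ => integrable_finsetSum _ fun τ _ => hint σ τ]
  simp_rw [integral_finsetSum _ fun τ _ => hint _ τ, integral_const_mul]
  rw [Finset.sum_comm]
  -- For fixed `τ` the sum over `σ` is the determinant with permuted columns, and the sign of `τ`
  -- undoes the permutation. Each of the `k!` values of `τ` thus contributes the same determinant.
  have h1 (τ : Equiv.Perm (Fin k)) : ∑ σ : Equiv.Perm (Fin k), ((Equiv.Perm.sign σ : ℤ) : ℂ) *
      ((Equiv.Perm.sign τ : ℤ) : ℂ) * ∫ s : Fin k → α, ∏ i, f (σ i) (s i) * g (τ i) (s i)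
        ∂(Measure.pi fun _ => μ) = M.det := by
    have h2 : (M.submatrix id τ).det = ((Equiv.Perm.sign τ : ℤ) : ℂ) * M.det :=
      Matrix.det_permute' τ M
    have h3 : ((Equiv.Perm.sign τ : ℤ) : ℂ) * ((Equiv.Perm.sign τ : ℤ) : ℂ) = 1 := by
      rw [← Int.cast_mul, ← Units.val_mul, Int.units_mul_self]; simp
    have h4 : ((Equiv.Perm.sign τ : ℤ) : ℂ) * (M.submatrix id τ).det = M.det := by
      rw [h2, ← mul_assoc, h3, one_mul]
    rw [← h4, Matrix.det_apply', Finset.mul_sum]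
    refine Finset.sum_congr rfl fun σ _ => ?_
    rw [integral_fintype_prod_eq_prod (f := fun i a => f (σ i) a * g (τ i) a)]
    simp only [Matrix.submatrix_apply, hM, Matrix.of_apply, id_eq]
    ring
  rw [Finset.sum_congr rfl fun τ _ => h1 τ, Finset.sum_const, Finset.card_univ, Fintype.card_perm,
    Fintype.card_fin, nsmul_eq_mul]

end Andreief

/-! ### The limit kernel as a Karlin–McGregor quantity. -/

section KarlinMcGregor

variable {k : ℕ}

theorem brownianDensity_half_mul (u w : ℂ) (s : ℝ) :
    brownianDensity (1 / 2) u s * brownianDensity (1 - 1 / 2) s w =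
      (Real.pi : ℂ)⁻¹ * Complex.exp (-2 * (s : ℂ) ^ 2 + 2 * (u + w) * s + -(u ^ 2 + w ^ 2)) := by
  have h1 : (Real.sqrt Real.pi : ℂ) * (Real.sqrt Real.pi : ℂ) = (Real.pi : ℂ) := by
    rw [← Complex.ofReal_mul, Real.mul_self_sqrt Real.pi_pos.le]
  have h2 : (1 : ℝ) - 1 / 2 = 1 / 2 := by norm_num
  have h3 : 2 * Real.pi * (1 / 2) = Real.pi := by ring
  have h4 : (2 : ℂ) * ((1 / 2 : ℝ) : ℂ) = 1 := by norm_num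
  rw [brownianDensity, brownianDensity, h2, h3, h4, mul_mul_mul_comm, ← Complex.exp_add, one_div,
    ← mul_inv, h1]
  congr 2
  ring

theorem integrable_brownianDensity_half_mul (u w : ℂ) :
    Integrable fun s : ℝ => brownianDensity (1 / 2) u s * brownianDensity (1 - 1 / 2) s w := by
  simp only [brownianDensity_half_mul]
  exact (integrable_cexp_quadratic (by norm_num) _ _).const_mul _

theorem volume_restrict_orthant : (volume : Measure (Fin k → ℝ)).restrict
    {s : Fin k → ℝ | ∀ i, s i ∈ Set.Ioi (0 : ℝ)} =
      Measure.pi fun _ => (volume : Measure ℝ).restrict (Set.Ioi 0) := by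
  rw [← Measure.restrict_pi_pi, volume_pi]
  congr 1
  ext s
  simp

theorem integrableOn_karlinMcGregorIntegrand (u w : Fin k → ℂ) :
    IntegrableOn (karlinMcGregorIntegrand (1 / 2) u w)
      {s : Fin k → ℝ | ∀ i, s i ∈ Set.Ioi (0 : ℝ)} := by
  rw [IntegrableOn, volume_restrict_orthant]
  exact integrable_det_mul_det _ (fun i (s : ℝ) => brownianDensity (1 / 2) (u i) s)
    (fun j (s : ℝ) => brownianDensity (1 - 1 / 2) s (w j))
    fun i j => (integrable_brownianDensity_half_mul _ _).integrableOn

/-- Substitute `t = 2s` and match the quadratic exponents. The substitution gives the factor `2`,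
and `π` comes from the two Brownian normalisations. -/
theorem edgeLimitKernel_eq (u w : ℂ) : edgeLimitKernel u w = 2 * Real.pi *
    ∫ s in Set.Ioi (0 : ℝ), brownianDensity (1 / 2) u s * brownianDensity (1 - 1 / 2) s w := by
  have hpi : (Real.pi : ℂ) ≠ 0 := Complex.ofReal_ne_zero.2 Real.pi_ne_zero
  have h := integral_comp_mul_left_Ioi
    (fun t : ℝ => Complex.exp (u * w - (t - (u + w)) ^ 2 / 2)) 0 two_pos
  rw [mul_zero, Complex.real_smul] at h
  have h2 : ∫ t in Set.Ioi (0 : ℝ), Complex.exp (u * w - (t - (u + w)) ^ 2 / 2) =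
      2 * ∫ t in Set.Ioi (0 : ℝ),
        Complex.exp (u * w - (((2 * t : ℝ) : ℂ) - (u + w)) ^ 2 / 2) := by
    rw [h]
    push_cast
    rw [mul_inv_cancel_left₀ two_ne_zero]
  rw [edgeLimitKernel, h2, mul_left_comm, mul_assoc]
  congr 1
  rw [← integral_const_mul, ← integral_const_mul]
  refine setIntegral_congr_fun measurableSet_Ioi fun t _ => ?_
  simp only [brownianDensity_half_mul]
  rw [mul_inv_cancel_left₀ hpi, ← Complex.exp_add]
  congr 1
  push_cast
  ring

theorem karlinMcGregor_half (u w : Fin k → ℂ) :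
    (2 * (Real.pi : ℂ)) ^ k / (k.factorial : ℂ) * karlinMcGregor (1 / 2) u w (Set.Ioi 0) =
      (Matrix.of fun i j => edgeLimitKernel (u i) (w j)).det := by
  have h := integral_det_mul_det ((volume : Measure ℝ).restrict (Set.Ioi 0))
    (fun i (s : ℝ) => brownianDensity (1 / 2) (u i) s)
    (fun j (s : ℝ) => brownianDensity (1 - 1 / 2) s (w j))
    fun i j => (integrable_brownianDensity_half_mul _ _).integrableOn
  have h1 : karlinMcGregor (1 / 2) u w (Set.Ioi 0) = k.factorial *
      (Matrix.of fun i j => ∫ s in Set.Ioi (0 : ℝ),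
        brownianDensity (1 / 2) (u i) s * brownianDensity (1 - 1 / 2) s (w j)).det := by
    rw [← h, karlinMcGregor, volume_restrict_orthant]
    rfl
  have h2 : (Matrix.of fun i j => edgeLimitKernel (u i) (w j)) = (2 * (Real.pi : ℂ)) •
      Matrix.of fun i j => ∫ s in Set.Ioi (0 : ℝ),
        brownianDensity (1 / 2) (u i) s * brownianDensity (1 - 1 / 2) s (w j) := by
    ext i j
    simp only [Matrix.of_apply, Matrix.smul_apply, edgeLimitKernel_eq, smul_eq_mul]
  have h3 : (k.factorial : ℂ) ≠ 0 := Nat.cast_ne_zero.2 k.factorial_ne_zero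
  rw [h2, Matrix.det_smul, Fintype.card_fin, h1]
  field_simp

/-- The ratio of determinants to which the normalised correlation functions converge. -/
theorem edgeRatio_eq (u v : Fin k → ℂ) :
    (2 * (Real.pi : ℂ)) ^ k / (k.factorial : ℂ) * edgeRatio u v =
      (Matrix.of fun i j => edgeLimitKernel (u i) (conj (v j))).det /
        ((Matrix.vandermonde u).det * (Matrix.vandermonde fun j => conj (v j)).det) := by
  rw [edgeRatio, ← mul_div_assoc, karlinMcGregor_half, Matrix.det_vandermonde,
    Matrix.det_vandermonde, ← Finset.prod_mul_distrib]
  simp only [← Finset.prod_mul_distrib]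

end KarlinMcGregor

/-! ### Identification of the limit, with or without degeneracies. -/

section EdgeF

variable {k : ℕ}

theorem injective_conj_comp_iff (v : Fin k → ℂ) :
    Function.Injective (fun j => conj (v j)) ↔ Function.Injective v :=
  (starRingEnd ℂ).injective.of_comp_iff v

/-- One number `l` is both the limit in `N` at the given pair and the limit of the determinantal
ratio along nondegenerate pairs. Conjugating the second vector preserves nondegeneracy and transfers
the latter to `edgeRatio`. -/
theorem tendsto_edgeCorrelation_and_edgeRatio (z : ℂ) (hz : ‖z‖ = 1) (u v : Fin k → ℂ) :
    Tendsto (fun N => edgeCorrelation z N u fun j => conj (v j)) atTop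
        (𝓝 ((2 * (Real.pi : ℂ)) ^ k / (k.factorial : ℂ) * edgeF u v)) ∧
      Tendsto (fun p : (Fin k → ℂ) × (Fin k → ℂ) => edgeRatio p.1 p.2)
        (𝓝[nondegeneratePairs k] (u, v)) (𝓝 (edgeF u v)) := by
  set c : ℂ := (2 * (Real.pi : ℂ)) ^ k / (k.factorial : ℂ) with hc
  have hc0 : c ≠ 0 := div_ne_zero (pow_ne_zero _ (mul_ne_zero two_ne_zero
    (Complex.ofReal_ne_zero.2 Real.pi_ne_zero))) (Nat.cast_ne_zero.2 k.factorial_ne_zero)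
  obtain ⟨l, hl, hlg⟩ := exists_tendsto_of_locally_equiLipschitz
    (fun N (p : (Fin k → ℂ) × (Fin k → ℂ)) => edgeCorrelation z N p.1 p.2)
    (fun p => (Matrix.of fun i j => edgeLimitKernel (p.1 i) (p.2 j)).det /
        ((Matrix.vandermonde p.1).det * (Matrix.vandermonde p.2).det)) (nondegeneratePairs k)
    mem_closure_nondegeneratePairs
    (fun p hp => tendsto_edgeCorrelation_of_injective z hz p.1 p.2 hp.1 hp.2)
    (edgeCorrelation_locally_equiLipschitz z hz) (u, fun j => conj (v j))
  have hconj : Tendsto (fun p : (Fin k → ℂ) × (Fin k → ℂ) => (p.1, fun j => conj (p.2 j)))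
      (𝓝[nondegeneratePairs k] (u, v)) (𝓝[nondegeneratePairs k] (u, fun j => conj (v j))) := by
    refine tendsto_nhdsWithin_iff.2 ⟨?_, ?_⟩
    · have : Continuous fun p : (Fin k → ℂ) × (Fin k → ℂ) =>
          ((p.1, fun j => conj (p.2 j)) : (Fin k → ℂ) × (Fin k → ℂ)) := by fun_prop
      exact (this.tendsto (u, v)).mono_left nhdsWithin_le_nhds
    · filter_upwards [self_mem_nhdsWithin] with p hp
      exact ⟨hp.1, (injective_conj_comp_iff p.2).2 hp.2⟩
  have hratio : Tendsto (fun p : (Fin k → ℂ) × (Fin k → ℂ) => edgeRatio p.1 p.2)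
      (𝓝[nondegeneratePairs k] (u, v)) (𝓝 (c⁻¹ * l)) := by
    refine ((hlg.comp hconj).const_mul c⁻¹).congr fun p => ?_
    rw [Function.comp_apply, ← edgeRatio_eq, inv_mul_cancel_left₀ hc0]
  have hF : edgeF u v = c⁻¹ * l := by
    rw [edgeF]
    split_ifs with h
    · have h1 := tendsto_edgeCorrelation_of_injective z hz u (fun j => conj (v j)) h.1
        ((injective_conj_comp_iff v).2 h.2)
      rw [← edgeRatio_eq] at h1
      rw [tendsto_nhds_unique hl h1, inv_mul_cancel_left₀ hc0]
    -- Density makes the punctured filter nontrivial, so `limUnder` is the actual limit.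
    · have : (𝓝[nondegeneratePairs k] (u, v)).NeBot :=
        mem_closure_iff_nhdsWithin_neBot.1 (mem_closure_nondegeneratePairs (u, v))
      exact hratio.limUnder_eq
  rw [hF, mul_inv_cancel_left₀ hc0]
  exact ⟨hl, hratio⟩

end EdgeF

/-! ### The edge asymptotics. -/

theorem mainTheorem6 (k : ℕ) (z : ℂ) (hz : ‖z‖ = 1) (u v : Fin k → ℂ) :
    (∀ N : ℕ, Integrable
      (charPolyProduct N (fun j => edgePoint z N (u j)) (fun j => edgePoint z N (v j)))
      (gaussianEntries N)) ∧
    IntegrableOn (karlinMcGregorIntegrand (1 / 2) u (fun j => conj (v j)))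
      {s : Fin k → ℝ | ∀ i, s i ∈ Set.Ioi (0 : ℝ)} ∧
    Tendsto (fun p : (Fin k → ℂ) × (Fin k → ℂ) => edgeRatio p.1 p.2)
      (𝓝[nondegeneratePairs k] (u, v)) (𝓝 (edgeF u v)) ∧
    Tendsto
      (fun N : ℕ =>
        charPolyCorrelation N (fun j => edgePoint z N (u j)) (fun j => edgePoint z N (v j)) /
          edgePrefactor N u v)
      atTop (𝓝 ((2 * (Real.pi : ℂ)) ^ k / (k.factorial : ℂ) * edgeF u v)) ∧
    (edgeF u v ≠ 0 →
      ∃ ε : ℕ → ℂ, Tendsto ε atTop (𝓝 0) ∧ ∀ N : ℕ,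
        charPolyCorrelation N (fun j => edgePoint z N (u j)) (fun j => edgePoint z N (v j)) =
          edgePrefactor N u v * ((2 * (Real.pi : ℂ)) ^ k / (k.factorial : ℂ)) * edgeF u v *
            (1 + ε N)) := by
  have hF := tendsto_edgeCorrelation_and_edgeRatio z hz u v
  have hlim : Tendsto (fun N : ℕ =>
      charPolyCorrelation N (fun j => edgePoint z N (u j)) (fun j => edgePoint z N (v j)) /
        edgePrefactor N u v) atTop
      (𝓝 ((2 * (Real.pi : ℂ)) ^ k / (k.factorial : ℂ) * edgeF u v)) :=
    hF.1.congr fun N => edgeCorrelation_conj z N u v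
  refine ⟨fun N => integrable_charPolyProduct N _ _, integrableOn_karlinMcGregorIntegrand _ _,
    hF.2, hlim, fun h0 => ?_⟩
  have hc0 : (2 * (Real.pi : ℂ)) ^ k / (k.factorial : ℂ) * edgeF u v ≠ 0 :=
    mul_ne_zero (div_ne_zero (pow_ne_zero _ (mul_ne_zero two_ne_zero
      (Complex.ofReal_ne_zero.2 Real.pi_ne_zero))) (Nat.cast_ne_zero.2 k.factorial_ne_zero)) h0
  refine ⟨fun N => charPolyCorrelation N (fun j => edgePoint z N (u j))
    (fun j => edgePoint z N (v j)) / edgePrefactor N u v /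
      ((2 * (Real.pi : ℂ)) ^ k / (k.factorial : ℂ) * edgeF u v) - 1, ?_, fun N => ?_⟩
  · have h := (hlim.div_const ((2 * (Real.pi : ℂ)) ^ k / (k.factorial : ℂ) * edgeF u v)).sub_const 1
    rwa [div_self hc0, sub_self] at h
  · have hp : edgePrefactor N u v ≠ 0 := Complex.exp_ne_zero _
    rw [add_sub_cancel, mul_assoc (edgePrefactor N u v), div_div, mul_div_cancel₀]
    exact mul_ne_zero hp hc0
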